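/- All logarithms are to base $2$. The size of a decision tree is its number of leaves, and $\mathrm{size}(f)$ is the least size of a decision tree computing $f$. A function $f:\{0,1\}^n\to\{\pm1\}$ is monotone if $x\preceq y$ (coordinatewise) implies $f(x)\le f(y)$, and $\mathrm{Inf}_i(f)=\Pr_x[f(x)\ne f(x^{\oplus i})]$ for uniform $x\in\{0,1\}^n$, where $x^{\oplus i}$ is $x$ with its $i$-th coordinate flipped. $\textsc{BuildTopDownDT}(f,\varepsilon)$ starts from the tree with a single leaf. As long as the tree, with each leaf $\ell$ labelled by $\mathrm{sign}(\mathbb E[f_\ell])$ (where $f_\ell$ is the restriction of $f$ by the path to $\ell$), differs from $f$ on more than an $\varepsilon$ fraction of $\{0,1\}^n$, it selects a leaf $\ell$ for which the score $2^{-|\ell|}\max_i \mathrm{Inf}_i(f_\ell)$ is largest ($|\ell|$ is the depth of $\ell$) and replaces it with a query to a most influential variable of $f_\ell$. $\textsc{TopDownDTSize}(f,\varepsilon)$ denotes the size of the final tree when all ties are broken in the most favourable way, i.e. the least size over all possible ways of breaking ties. (a) (Exact representation.) There are constants $c_1,c_2,c_3>0$ such that for every $n\ge 1$ there is a monotone $f:\{0,1\}^n\to\{\pm1\}$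 whose decision tree size $s=\mathrm{size}(f)$ satisfies $c_1n\le s\le c_2n$ and for which $\textsc{TopDownDTSize}(f,0)\ge 2^{c_3s}$. (b) (Approximate representation.) For every $\varepsilon\in(0,\frac12)$ and every function $s(n)\le 2^{\tilde O(n^{4/5})}$ there are monotone functions $f:\{0,1\}^n\to\{\pm1\}$ computed by decision trees of size at most $s=s(n)$, and with $\mathrm{size}(f)\ge s^{\tilde\Omega(1)}$, such that $\textsc{TopDownDTSize}(f,\varepsilon)\ge s^{\tilde\Omega((\log s)^{1/4})}$. Explicitly: for every $\varepsilon\in(0,\frac12)$ and every $A\in\mathbb N$ there are $c>0$ and $K\in\mathbb N$ such that for every function $s:\mathbb N\to\mathbb N$ with $1\le s(n)\le 2^{A\,n^{4/5}(\log(n+1))^{A}}$ for all $n\ge1$, and every $n\ge 1$, there is a monotone $f:\{0,1\}^n\to\{\pm1\}$ such that, with $s=s(n)$, $$s^{\,c/(\log(2+\log s))^{K}}\le \mathrm{size}(f)\le s\qquad\text{and}\qquad \textsc{TopDownDTSize}(f,\varepsilon)\ge s^{\,c\,(\log s)^{1/4}/(\log(2+\log s))^{K}}.$$ -/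

import Mathlib

namespace TopDownDT

/-- Boolean functions on `{0,1}^n`. The two output values `-1 < +1` are encoded as `false < true`,
so that `Monotone f` (for the coordinatewise order) is the usual notion of a monotone function. -/
abbrev BoolFun (n : ℕ) : Type := (Fin n → Bool) → Bool

/-- Binary trees whose internal nodes query one of `n` variables and whose leaves carry a label in
`α`; the first child is followed if the queried variable is `0`, the second one if it is `1`. -/
inductive QueryTree (n : ℕ) (α : Type) : Type where
  | leaf (a : α) : QueryTree n α
  | node (i : Fin n) (t₀ t₁ : QueryTree n α) : QueryTree n α

/-- Decision trees: the leaves are labelled by output values. -/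
abbrev DecisionTree (n : ℕ) : Type := QueryTree n Bool

/-- Bare trees: the leaves are unlabelled. -/
abbrev BareTree (n : ℕ) : Type := QueryTree n Unit

namespace QueryTree

/-- The size of a tree is its number of leaves. -/
def size {n : ℕ} {α : Type} : QueryTree n α → ℕ
  | leaf _ => 1
  | node _ t₀ t₁ => t₀.size + t₁.size

/-- The label of the leaf that is reached on input `x`. -/
def eval {n : ℕ} {α : Type} : QueryTree n α → (Fin n → Bool) → α
  | leaf a, _ => a
  | node i t₀ t₁, x => if x i then t₁.eval x else t₀.eval x

/-- The leaves of a tree, each given as the path (queried variable, answer) from the root to it. -/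
def leaves {n : ℕ} {α : Type} : QueryTree n α → List (List (Fin n × Bool))
  | leaf _ => [[]]
  | node i t₀ t₁ =>
      t₀.leaves.map (fun π => (i, false) :: π) ++ t₁.leaves.map (fun π => (i, true) :: π)

end QueryTree

/-- The optimal decision tree size of `f`. -/
noncomputable def dtSize {n : ℕ} (f : BoolFun n) : ℕ :=
  sInf {m : ℕ | ∃ T : DecisionTree n, T.eval = f ∧ T.size = m}

/-- `error(f, g) = Pr[f(x) ≠ g(x)]` for uniform `x`. -/
noncomputable def error {n : ℕ} (f g : BoolFun n) : ℝ :=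
  ((Finset.univ.filter (fun x : Fin n → Bool => f x ≠ g x)).card : ℝ) / 2 ^ n

/-- `Inf_i(f) = Pr[f(x) ≠ f(x ⊕ i)]` for uniform `x`, where `x ⊕ i` is `x` with its `i`-th
coordinate flipped. -/
noncomputable def influence {n : ℕ} (f : BoolFun n) (i : Fin n) : ℝ :=
  ((Finset.univ.filter
    (fun x : Fin n → Bool => f x ≠ f (Function.update x i (!(x i))))).card : ℝ) / 2 ^ n

/-- The subfunction `f_{x_i = b}`, kept as a function of all `n` coordinates (it ignores the
`i`-th one). -/
def restrict {n : ℕ} (f : BoolFun n) (i : Fin n) (b : Bool) : BoolFun n :=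
  fun x => f (Function.update x i b)

/-- The subfunction `f_π` of `f` at the end of a path `π`. -/
def restrictPath {n : ℕ} : BoolFun n → List (Fin n × Bool) → BoolFun n
  | f, [] => f
  | f, q :: π => restrictPath (restrict f q.1 q.2) π

/-- The sign of `E[f]`, for `f` with values `±1`: `+1` if at least half of the values are `+1`, and
`-1` otherwise. -/
def majorityLabel {n : ℕ} (f : BoolFun n) : Bool :=
  decide (2 ^ n ≤ 2 * (Finset.univ.filter (fun x : Fin n → Bool => f x = true)).card)

/-- The `f`-completion of a bare tree: each leaf `ℓ` is labelled by the sign of `E[f_ℓ]`. -/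
def completion {n : ℕ} : BareTree n → BoolFun n → DecisionTree n
  | .leaf _, f => .leaf (majorityLabel f)
  | .node i t₀ t₁, f =>
      .node i (completion t₀ (restrict f i false)) (completion t₁ (restrict f i true))

/-- The error with respect to `f` of the `f`-completion of a bare tree. -/
noncomputable def bareError {n : ℕ} (T : BareTree n) (f : BoolFun n) : ℝ :=
  error (completion T f).eval f

/-- `i` is a most influential variable of `f`. -/
def IsMostInfluential {n : ℕ} (f : BoolFun n) (i : Fin n) : Prop :=
  ∀ j : Fin n, influence f j ≤ influence f i

/-- The score of the leaf at the end of the path `π`: the influence of the most influential variable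
of `f_π`, times the probability `2^{-|π|}` of reaching the leaf. -/
noncomputable def score {n : ℕ} (f : BoolFun n) (π : List (Fin n × Bool)) : ℝ :=
  (1 / 2) ^ π.length * ⨆ i : Fin n, influence (restrictPath f π) i

/-- The tree obtained from `T` by replacing the leaf at the end of the path `π` with a query to
`x_j`. -/
def splitLeaf {n : ℕ} : BareTree n → List (Fin n × Bool) → Fin n → BareTree n
  | .leaf _, [], j => .node j (.leaf ()) (.leaf ())
  | .leaf _, _ :: _, _ => .leaf ()
  | .node i t₀ t₁, [], _ => .node i t₀ t₁
  | .node i t₀ t₁, q :: π, j =>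
      if q.2 then .node i t₀ (splitLeaf t₁ π j) else .node i (splitLeaf t₀ π j) t₁

/-- One iteration of the loop of `BuildTopDownDT(f, ε)`: the `f`-completion of `T` is not an
`ε`-approximation of `f`, and `T'` is obtained from `T` by splitting a leaf of highest score with a
query to a most influential variable of the subfunction at that leaf. Ties between variables and
between leaves may be broken in any way. -/
def Step {n : ℕ} (f : BoolFun n) (ε : ℝ) (T T' : BareTree n) : Prop :=
  ε < bareError T f ∧
    ∃ π ∈ T.leaves, ∃ i : Fin n,
      (∀ π' ∈ T.leaves, score f π' ≤ score f π) ∧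
      IsMostInfluential (restrictPath f π) i ∧
      T' = splitLeaf T π i

/-- `T` is a final bare tree of a run of `BuildTopDownDT(f, ε)`, for some way of breaking ties: it
is reached from the one-leaf tree, and its `f`-completion is an `ε`-approximation of `f`. -/
def IsOutput {n : ℕ} (f : BoolFun n) (ε : ℝ) (T : BareTree n) : Prop :=
  Relation.ReflTransGen (Step f ε) (.leaf ()) T ∧ bareError T f ≤ ε

/-- `TopDownDTSize(f, ε)`: the size of the tree built by `BuildTopDownDT(f, ε)` when ties are broken
in the most favourable way, i.e. the least size of a possible output. (A positive lower bound on
this number therefore says in particular that outputs exist.) -/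
noncomputable def topDownDTSize {n : ℕ} (f : BoolFun n) (ε : ℝ) : ℕ :=
  sInf {m : ℕ | ∃ T : BareTree n, IsOutput f ε T ∧ T.size = m}

end TopDownDT

namespace TopDownDT

open Finset

/-! Neither the tie-breaking nor the choice of the leaf matters. Every tree the procedure reaches is
`Greedy`: each node queries a relevant, most influential variable of its subfunction. By
`le_topDownDTSize` it suffices to bound the size of all greedy trees of small error, and this can be
done by induction on the tree.

(a) Iterate `gadget`, which wraps a balanced function `r` in five fresh variables. A good tree
queries the `a`s and `b`s first: the gadget equals `r` if the `a`s are 0 and the `b`s are 1, and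
otherwise it is constant or equal to `y`. So one copy of a tree for `r` suffices, and the size grows
by 12. A greedy tree queries `y` first, because its influence is 9/16, against 1/4 for the `a`s and
`b`s and at most 1/16 for the rest. Both restrictions are then chains of conjunctions and
disjunctions ending in `r`. In a chain the most influential variables are chain variables, and one
of the two answers merely deletes the queried one (`Chain.exactSizeAtLeast`). Hence both subtrees
are at least as large as a greedy tree for `r`, and the size doubles (`Fresh.exactSizeAtLeast`).

(b) The selector function `Layout.sel` has `N * u` tribes of width `w`, each pointing to one of `N`
blocks of `m` variables. A good tree queries all tribe variables, after which at most one block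
matters; its size is `2 ^ (N * u * w + m)`. A greedy tree acts otherwise. A tribe variable has
influence at most `2 * 2 ^ (-w)`, while a variable of a block that is mostly unqueried and nearly
balanced has influence of order `1 / (N √m)`. If `2 ^ w` is a large multiple of `N √m`, block
variables are queried first (`Layout.exists_block_of_isMostInfluential`).

The state of a path is measured by the sum `Φ` of the squares of the block sums. A query to a block
variable raises `Φ` by exactly 1 on average, so after `t = τ N m` queries `Φ` is rarely above `θ² N
m`. While `Φ` is below that, most blocks are nearly unbiased; as the number of tribes is tuned so
that the selector with unbiased blocks is balanced (`exists_tribe_count`), every leaf met so far has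
error near 1/2 (`Layout.abs_mean_sgn_sel_le`). A tree of error `ε < 1/2` must therefore follow a
constant fraction of the paths beyond depth `t`, which gives `2 ^ Ω(N m)` leaves
(`Layout.bareError_ge`).

With `l = log s`, the choice `m ≈ l / 4`, `N ≈ l ^ (1/4)` up to logarithms and `2 ^ w ≈ l ^ (3/4)`
keeps the good tree below `2 ^ l`, makes `N m` about `l ^ (5/4)`, and fits into `n` variables
because `l` is at most about `n ^ (4/5)`. -/

/-! ### Averages over the cube -/

/-- The average of a real-valued function over the uniform distribution on the cube. -/
noncomputable def mean {n : ℕ} (φ : (Fin n → Bool) → ℝ) : ℝ := (∑ z, φ z) / 2 ^ n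

section Mean

variable {n : ℕ}

lemma mean_add (φ ψ : (Fin n → Bool) → ℝ) :
    mean (fun z => φ z + ψ z) = mean φ + mean ψ := by
  simp [mean, sum_add_distrib, add_div]

lemma mean_sub (φ ψ : (Fin n → Bool) → ℝ) :
    mean (fun z => φ z - ψ z) = mean φ - mean ψ := by
  simp [mean, sum_sub_distrib, sub_div]

lemma mean_const_mul (c : ℝ) (φ : (Fin n → Bool) → ℝ) :
    mean (fun z => c * φ z) = c * mean φ := by
  simp [mean, ← mul_sum, mul_div_assoc]

lemma mean_const (c : ℝ) : mean (fun _ : Fin n → Bool => c) = c := by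
  simp [mean]

lemma mean_sum {ι : Type*} (s : Finset ι) (φ : ι → (Fin n → Bool) → ℝ) :
    mean (fun z => ∑ i ∈ s, φ i z) = ∑ i ∈ s, mean (φ i) := by
  simp only [mean, ← sum_div]
  rw [sum_comm]

lemma mean_mono {φ ψ : (Fin n → Bool) → ℝ} (h : ∀ z, φ z ≤ ψ z) : mean φ ≤ mean ψ := by
  unfold mean
  gcongr with z
  exact h z

lemma abs_mean_le (φ : (Fin n → Bool) → ℝ) : |mean φ| ≤ mean (fun z => |φ z|) := by
  unfold mean
  rw [abs_div, abs_of_pos (by positivity : (0 : ℝ) < 2 ^ n)]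
  gcongr
  exact abs_sum_le_sum_abs _ _

lemma mean_pos {φ : (Fin n → Bool) → ℝ} (h : ∀ z, 0 ≤ φ z) {z : Fin n → Bool} (hz : 0 < φ z) :
    0 < mean φ := by
  unfold mean
  have := sum_pos' (fun z _ => h z) ⟨z, mem_univ _, hz⟩
  positivity

/-- Flipping one coordinate. -/
def flipAt (i : Fin n) (z : Fin n → Bool) : Fin n → Bool := Function.update z i (!(z i))

lemma flipAt_involutive (i : Fin n) : Function.Involutive (flipAt i) := by
  intro z
  simp [flipAt]

lemma mean_flipAt (φ : (Fin n → Bool) → ℝ) (i : Fin n) :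
    mean (fun z => φ (flipAt i z)) = mean φ := by
  unfold mean
  congr 1
  exact Equiv.sum_comp (flipAt_involutive i).toPerm φ

lemma mean_split (φ : (Fin n → Bool) → ℝ) (i : Fin n) :
    mean φ = (mean (fun z => φ (Function.update z i false)) +
      mean (fun z => φ (Function.update z i true))) / 2 := by
  have h : ∀ z, φ z + φ (flipAt i z) =
      φ (Function.update z i false) + φ (Function.update z i true) := by
    intro z
    cases hz : z i
    · have : Function.update z i false = z := by rw [← hz]; simp
      simp [flipAt, hz, this]
    · have : Function.update z i true = z := by rw [← hz]; simp
      simp [flipAt, hz, this, add_comm]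
  rw [← mean_add, ← funext h, mean_add, mean_flipAt]
  ring

-- Independence by double counting: exchanging the coordinates outside `s` between two inputs is, up
-- to order, an involution on pairs of inputs. It turns a product evaluated at two independent
-- points into a product evaluated at one.
open Classical in
lemma mean_mul {φ ψ : (Fin n → Bool) → ℝ} {s t : Set (Fin n)} (hφ : DependsOn φ s)
    (hψ : DependsOn ψ t) (hst : Disjoint s t) :
    mean (fun z => φ z * ψ z) = mean φ * mean ψ := by
  let mix : (Fin n → Bool) × (Fin n → Bool) → (Fin n → Bool) × (Fin n → Bool) :=
    fun p => (fun i => if i ∈ s then p.1 i else p.2 i, fun i => if i ∈ s then p.2 i else p.1 i)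
  have hmix : Function.Involutive mix := by
    rintro ⟨a, b⟩
    ext i <;> simp only [mix] <;> split_ifs <;> rfl
  have h1 : ∑ p : (Fin n → Bool) × (Fin n → Bool), φ p.1 * ψ p.2 =
      ∑ p : (Fin n → Bool) × (Fin n → Bool), φ p.1 * ψ p.1 := by
    rw [← Equiv.sum_comp hmix.toPerm (fun p => φ p.1 * ψ p.1)]
    refine sum_congr rfl fun p _ => ?_
    congr 1
    · apply hφ
      intro i hi
      simp [mix, hi]
    · apply hψ
      intro i hi
      have : i ∉ s := fun h => Set.disjoint_left.mp hst h hi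
      simp [mix, this]
  rw [Fintype.sum_prod_type, Fintype.sum_prod_type] at h1
  simp only [sum_const, ← mul_sum, ← sum_mul] at h1
  have h2 : (0 : ℝ) < 2 ^ n := by positivity
  have h3 : (Finset.univ : Finset (Fin n → Bool)).card = 2 ^ n := by simp
  rw [h3] at h1
  simp only [mean]
  rw [div_mul_div_comm, h1, ← smul_sum, nsmul_eq_mul]
  push_cast
  field_simp

end Mean

/-! ### Errors and influences -/

section Influence

variable {n : ℕ}

lemma error_eq_mean (f g : BoolFun n) :
    error f g = mean (fun z => if f z ≠ g z then 1 else 0) := by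
  simp only [error, mean, sum_boole]

lemma influence_eq_mean (f : BoolFun n) (i : Fin n) :
    influence f i = mean (fun z => if f z ≠ f (flipAt i z) then 1 else 0) := by
  unfold influence mean
  rw [sum_boole]
  rfl

lemma error_nonneg (f g : BoolFun n) : 0 ≤ error f g := by
  unfold error; positivity

lemma influence_nonneg (f : BoolFun n) (i : Fin n) : 0 ≤ influence f i := by
  unfold influence; positivity

@[simp] lemma error_self (f : BoolFun n) : error f f = 0 := by
  simp [error]

lemma error_split (f g : BoolFun n) (i : Fin n) :
    error f g = (error (restrict f i false) (restrict g i false) +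
      error (restrict f i true) (restrict g i true)) / 2 := by
  simp only [error_eq_mean]
  exact mean_split _ i

lemma influence_split (f : BoolFun n) {i j : Fin n} (h : j ≠ i) :
    influence f j = (influence (restrict f i false) j + influence (restrict f i true) j) / 2 := by
  simp only [influence_eq_mean]
  rw [mean_split _ i]
  simp only [restrict, flipAt]
  simp only [Function.update_of_ne h, Function.update_comm h]

lemma influence_eq_error (f : BoolFun n) (i : Fin n) :
    influence f i = error (restrict f i false) (restrict f i true) := by
  rw [influence_eq_mean, error_eq_mean]
  congr 1
  ext z
  cases hz : z i
  · have : Function.update z i false = z := by rw [← hz]; simp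
    simp [flipAt, hz, restrict, this]
  · have : Function.update z i true = z := by rw [← hz]; simp
    simp [flipAt, hz, restrict, this, eq_comm]

lemma influence_pos_iff (f : BoolFun n) (i : Fin n) :
    0 < influence f i ↔ ∃ z, f z ≠ f (flipAt i z) := by
  constructor
  · intro h
    by_contra! hc
    rw [influence_eq_mean] at h
    simp [← hc, mean_const] at h
  · rintro ⟨z, hz⟩
    rw [influence_eq_mean]
    refine mean_pos (fun z => by positivity) (z := z) ?_
    simp [hz]

lemma influence_eq_zero_of_restrict_eq {f : BoolFun n} {i : Fin n} (h : ∀ b, restrict f i b = f) :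
    influence f i = 0 := by
  rw [influence_eq_error, h, h, error_self]

lemma influence_restrict_self (f : BoolFun n) (i : Fin n) (b : Bool) :
    influence (restrict f i b) i = 0 := by
  apply influence_eq_zero_of_restrict_eq
  intro c
  ext z
  simp [restrict]

lemma eq_const_of_influence_eq_zero {f : BoolFun n} (h : ∀ i, influence f i = 0)
    (x y : Fin n → Bool) : f x = f y := by
  have hf : ∀ i z, f (flipAt i z) = f z := by
    intro i z
    by_contra hc
    have := (influence_pos_iff f i).2 ⟨z, Ne.symm hc⟩
    exact this.ne' (h i)
  have hu : ∀ i z b, f (Function.update z i b) = f z := by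
    intro i z b
    by_cases hb : b = z i
    · simp [hb]
    · have : b = !(z i) := by cases b <;> cases hz : z i <;> simp_all
      rw [this]
      exact hf i z
  -- Pass from `x` to `y` one coordinate at a time.
  have key : ∀ s : Finset (Fin n), f (fun i => if i ∈ s then y i else x i) = f x := by
    intro s
    induction s using Finset.induction_on with
    | empty => simp
    | insert a s ha ih =>
      rw [← ih, ← hu a (fun i => if i ∈ s then y i else x i) (y a)]
      congr 1
      ext i
      by_cases hi : i = a
      · subst hi; simp [ha]
      · simp only [mem_insert, hi, false_or, ne_eq, not_false_eq_true, Function.update_of_ne]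
  simpa using (key Finset.univ).symm

end Influence

/-! ### Top-down trees -/

section TopDown

variable {n : ℕ}

/-- Every internal node of the tree queries a most influential variable of the subfunction at that
node, and this variable is relevant. -/
def Greedy : BareTree n → BoolFun n → Prop
  | .leaf _, _ => True
  | .node i t₀ t₁, f => 0 < influence f i ∧ IsMostInfluential f i ∧
      Greedy t₀ (restrict f i false) ∧ Greedy t₁ (restrict f i true)

lemma greedy_splitLeaf {T : BareTree n} {f : BoolFun n} (hT : Greedy T f)
    {π : List (Fin n × Bool)} (hπ : π ∈ T.leaves) {i : Fin n}
    (hpos : 0 < influence (restrictPath f π) i)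
    (hi : IsMostInfluential (restrictPath f π) i) : Greedy (splitLeaf T π i) f := by
  induction T generalizing f π with
  | leaf a =>
    simp only [QueryTree.leaves, List.mem_singleton] at hπ
    subst hπ
    exact ⟨hpos, hi, trivial, trivial⟩
  | node j t₀ t₁ ih₀ ih₁ =>
    simp only [QueryTree.leaves, List.mem_append, List.mem_map] at hπ
    obtain ⟨h0, h1, h2, h3⟩ := hT
    rcases hπ with ⟨π', h, rfl⟩ | ⟨π', h, rfl⟩
    · exact ⟨h0, h1, ih₀ h2 h hpos hi, h3⟩
    · exact ⟨h0, h1, h2, ih₁ h3 h hpos hi⟩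

lemma eval_completion_leaf_of_influence_eq_zero {f : BoolFun n} (h : ∀ i, influence f i = 0)
    (z : Fin n → Bool) : majorityLabel f = f z := by
  have hc : ∀ x, f x = f z := fun x => eq_const_of_influence_eq_zero h x z
  unfold majorityLabel
  cases hz : f z
  · simp [hc, hz]
  · simp [hc, hz]

/-- A leaf with a constant subfunction receives the correct label, so an error can only occur at a
leaf that still has a relevant variable. -/
lemma exists_influence_pos_of_eval_ne {T : BareTree n} {f : BoolFun n} {z : Fin n → Bool}
    (h : (completion T f).eval z ≠ f z) :
    ∃ π ∈ T.leaves, ∃ j, 0 < influence (restrictPath f π) j := by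
  induction T generalizing f with
  | leaf a =>
    refine ⟨[], by simp [QueryTree.leaves], ?_⟩
    by_contra! hc
    exact h (eval_completion_leaf_of_influence_eq_zero
      (fun i => le_antisymm (hc i) (influence_nonneg _ _)) z)
  | node i t₀ t₁ ih₀ ih₁ =>
    have hr : ∀ b, z i = b → restrict f i b z = f z := by
      rintro b rfl
      simp [restrict]
    simp only [completion, QueryTree.eval] at h
    cases hz : z i
    · simp only [hz, Bool.false_eq_true, if_false] at h
      rw [← hr _ hz] at h
      obtain ⟨π, hπ, j, hj⟩ := ih₀ h
      exact ⟨(i, false) :: π, by simp [QueryTree.leaves, hπ], j, hj⟩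
    · simp only [hz, if_true] at h
      rw [← hr _ hz] at h
      obtain ⟨π, hπ, j, hj⟩ := ih₁ h
      exact ⟨(i, true) :: π, by simp [QueryTree.leaves, hπ], j, hj⟩

lemma exists_eval_ne_of_bareError_pos {T : BareTree n} {f : BoolFun n} (h : 0 < bareError T f) :
    ∃ z, (completion T f).eval z ≠ f z := by
  by_contra! hc
  simp [bareError, error, hc] at h

lemma score_pos_influence {f : BoolFun n} {π π' : List (Fin n × Bool)} {i j : Fin n}
    (hle : score f π' ≤ score f π) (hj : 0 < influence (restrictPath f π') j)
    (hi : IsMostInfluential (restrictPath f π) i) : 0 < influence (restrictPath f π) i := by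
  have : Nonempty (Fin n) := ⟨i⟩
  have h1 : 0 < score f π' := by
    have : influence (restrictPath f π') j ≤ ⨆ i, influence (restrictPath f π') i :=
      le_ciSup (f := fun i => influence (restrictPath f π') i) (Set.finite_range _).bddAbove j
    unfold score
    have h2 := hj.trans_le this
    positivity
  have h2 := h1.trans_le hle
  unfold score at h2
  have h3 : (0 : ℝ) < ⨆ i, influence (restrictPath f π) i :=
    pos_of_mul_pos_right h2 (by positivity)
  exact h3.trans_le (ciSup_le hi)

/-- A step is taken only while the error exceeds `ε ≥ 0`. Some leaf then has a positive score, hence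
so does the selected one, and the variable queried there is relevant. -/
lemma greedy_of_reachable {f : BoolFun n} {ε : ℝ} (hε : 0 ≤ ε) {T : BareTree n}
    (h : Relation.ReflTransGen (Step f ε) (.leaf ()) T) : Greedy T f := by
  induction h with
  | refl => trivial
  | tail _ hs ih =>
    obtain ⟨herr, π, hπ, i, hsc, hi, rfl⟩ := hs
    obtain ⟨z, hz⟩ := exists_eval_ne_of_bareError_pos (hε.trans_lt herr)
    obtain ⟨π', hπ', j, hj⟩ := exists_influence_pos_of_eval_ne hz
    exact greedy_splitLeaf ih hπ (score_pos_influence (hsc π' hπ') hj hi) hi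

/-! ### Termination of the procedure -/

/-- The number of relevant variables. -/
noncomputable def relevantCount (f : BoolFun n) : ℕ :=
  (univ.filter fun i => 0 < influence f i).card

lemma relevantCount_restrict_lt {f : BoolFun n} {i : Fin n} (h : 0 < influence f i) (b : Bool) :
    relevantCount (restrict f i b) < relevantCount f := by
  apply card_lt_card
  rw [ssubset_iff_of_subset]
  · exact ⟨i, by simpa using h, by simp [influence_restrict_self]⟩
  · intro j hj
    simp only [mem_filter, mem_univ, true_and] at hj ⊢
    have hij : j ≠ i := by
      rintro rfl
      simp [influence_restrict_self] at hj
    rw [influence_split f hij]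
    have h0 := influence_nonneg (restrict f i false) j
    have h1 := influence_nonneg (restrict f i true) j
    cases b <;> linarith

/-- A potential of bare trees that decreases when a relevant variable is queried. -/
noncomputable def potential : BareTree n → BoolFun n → ℕ
  | .leaf _, f => 3 ^ relevantCount f
  | .node i t₀ t₁, f => potential t₀ (restrict f i false) + potential t₁ (restrict f i true)

/-- The base 3 beats the doubling: a split replaces `3 ^ r` by at most `2 * 3 ^ (r - 1)`. -/
lemma potential_splitLeaf_lt {T : BareTree n} {f : BoolFun n}
    {π : List (Fin n × Bool)} (hπ : π ∈ T.leaves) {i : Fin n}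
    (hpos : 0 < influence (restrictPath f π) i) :
    potential (splitLeaf T π i) f < potential T f := by
  induction T generalizing f π with
  | leaf a =>
    simp only [QueryTree.leaves, List.mem_singleton] at hπ
    subst hπ
    simp only [splitLeaf, potential, restrictPath] at hpos ⊢
    have h0 := relevantCount_restrict_lt hpos false
    have h1 := relevantCount_restrict_lt hpos true
    obtain ⟨r, hr⟩ : ∃ r, relevantCount f = r + 1 := ⟨relevantCount f - 1, by omega⟩
    have h2 : 3 ^ relevantCount (restrict f i false) ≤ 3 ^ r :=
      Nat.pow_le_pow_right (by norm_num) (by omega)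
    have h3 : 3 ^ relevantCount (restrict f i true) ≤ 3 ^ r :=
      Nat.pow_le_pow_right (by norm_num) (by omega)
    rw [hr, pow_succ]
    have : 0 < 3 ^ r := by positivity
    omega
  | node j t₀ t₁ ih₀ ih₁ =>
    simp only [QueryTree.leaves, List.mem_append, List.mem_map] at hπ
    rcases hπ with ⟨π', h, rfl⟩ | ⟨π', h, rfl⟩
    · simpa [splitLeaf, potential] using ih₀ h hpos
    · simpa [splitLeaf, potential] using ih₁ h hpos

lemma leaves_ne_nil (T : BareTree n) : T.leaves ≠ [] := by
  induction T with
  | leaf a => simp [QueryTree.leaves]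
  | node i t₀ t₁ ih₀ ih₁ => simp [QueryTree.leaves, ih₀]

lemma exists_isOutput_of_reachable (hn : 1 ≤ n) {f : BoolFun n} {ε : ℝ} (hε : 0 ≤ ε) (N : ℕ) :
    ∀ T : BareTree n, potential T f ≤ N → Relation.ReflTransGen (Step f ε) (.leaf ()) T →
      ∃ T', IsOutput f ε T' := by
  have : Nonempty (Fin n) := ⟨⟨0, hn⟩⟩
  induction N with
  | zero =>
    intro T hT _
    exfalso
    have : ∀ (T : BareTree n) (f : BoolFun n), 0 < potential T f := by
      intro T
      induction T with
      | leaf a => intro f; simp [potential]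
      | node i t₀ t₁ ih₀ ih₁ => intro f; simp [potential, ih₀]
    exact (this T f).ne' (by omega)
  | succ N ih =>
    intro T hT hr
    by_cases herr : bareError T f ≤ ε
    · exact ⟨T, hr, herr⟩
    · push Not at herr
      obtain ⟨π, hπ, hmax⟩ := T.leaves.toFinset.exists_max_image (score f)
        (by simpa using leaves_ne_nil T)
      obtain ⟨i, hi⟩ := Finite.exists_max (influence (restrictPath f π))
      simp only [List.mem_toFinset] at hπ hmax
      obtain ⟨z, hz⟩ := exists_eval_ne_of_bareError_pos (hε.trans_lt herr)
      obtain ⟨π', hπ', j, hj⟩ := exists_influence_pos_of_eval_ne hz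
      have hpos := score_pos_influence (hmax π' hπ') hj hi
      have hlt := potential_splitLeaf_lt hπ hpos
      exact ih _ (by omega) (hr.tail ⟨herr, π, hπ, i, hmax, hi, rfl⟩)

/-- A lower bound on the size of all greedy trees of small error is a lower bound on the size of the
top-down tree. -/
lemma le_topDownDTSize (hn : 1 ≤ n) {f : BoolFun n} {ε : ℝ} (hε : 0 ≤ ε) {M : ℝ}
    (h : ∀ T : BareTree n, Greedy T f → bareError T f ≤ ε → M ≤ T.size) :
    M ≤ topDownDTSize f ε := by
  -- The infimum of the empty set of naturals is 0, so an output has to exist before any positive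
  -- lower bound can hold.
  obtain ⟨T₀, hT₀⟩ := exists_isOutput_of_reachable hn (f := f) hε _ (.leaf ()) le_rfl .refl
  obtain ⟨T, hT, hs⟩ := Nat.sInf_mem
    (s := {m : ℕ | ∃ T : BareTree n, IsOutput f ε T ∧ T.size = m}) ⟨_, T₀, hT₀, rfl⟩
  rw [topDownDTSize, ← hs]
  exact h T (greedy_of_reachable hε hT.1) hT.2

lemma restrict_restrict_of_indep {f : BoolFun n} {i j : Fin n} (h : ∀ b, restrict f i b = f)
    (b c : Bool) : restrict (restrict f j c) i b = restrict f j c := by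
  by_cases hij : i = j
  · subst hij
    simp [h]
  · ext z
    simp only [restrict]
    rw [Function.update_comm hij]
    exact congrFun (h b) _

lemma restrict_restrict_self (f : BoolFun n) (i : Fin n) (b c : Bool) :
    restrict (restrict f i c) i b = restrict f i c := by
  ext z
  simp [restrict]

/-- A greedy tree never queries an irrelevant variable. -/
lemma eval_completion_update {T : BareTree n} {f : BoolFun n} (hT : Greedy T f) {i : Fin n}
    (h : ∀ b, restrict f i b = f) (z : Fin n → Bool) (b : Bool) :
    (completion T f).eval (Function.update z i b) = (completion T f).eval z := by
  induction T generalizing f with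
  | leaf a => simp [completion, QueryTree.eval]
  | node j t₀ t₁ ih₀ ih₁ =>
    obtain ⟨h0, -, h2, h3⟩ := hT
    have hij : j ≠ i := by
      rintro rfl
      simp [influence_eq_zero_of_restrict_eq h] at h0
    simp only [completion, QueryTree.eval, Function.update_of_ne hij]
    rw [ih₀ h2 fun b => restrict_restrict_of_indep h b _,
      ih₁ h3 fun b => restrict_restrict_of_indep h b _]

/-- Below its query `i` is irrelevant, so the greedy subtrees avoid it. Their errors, measured on
the whole cube, therefore agree with the errors on the two subcubes. -/
lemma bareError_node {i : Fin n} {t₀ t₁ : BareTree n} {f : BoolFun n}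
    (h₀ : Greedy t₀ (restrict f i false)) (h₁ : Greedy t₁ (restrict f i true)) :
    bareError (.node i t₀ t₁) f =
      (bareError t₀ (restrict f i false) + bareError t₁ (restrict f i true)) / 2 := by
  simp only [bareError]
  rw [error_split _ _ i]
  have e₀ : restrict (completion (.node i t₀ t₁) f).eval i false =
      (completion t₀ (restrict f i false)).eval := by
    ext z
    simp only [restrict, completion, QueryTree.eval, Function.update_self, Bool.false_eq_true,
      if_false]
    exact eval_completion_update h₀ (fun b => restrict_restrict_self f i b _) z false
  have e₁ : restrict (completion (.node i t₀ t₁) f).eval i true =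
      (completion t₁ (restrict f i true)).eval := by
    ext z
    simp only [restrict, completion, QueryTree.eval, Function.update_self, if_true]
    exact eval_completion_update h₁ (fun b => restrict_restrict_self f i b _) z true
  rw [e₀, e₁]

lemma bareError_nonneg (T : BareTree n) (f : BoolFun n) : 0 ≤ bareError T f := error_nonneg _ _

lemma one_le_size {α : Type} (T : QueryTree n α) : 1 ≤ T.size := by
  induction T with
  | leaf a => simp [QueryTree.size]
  | node i t₀ t₁ ih₀ ih₁ => simp only [QueryTree.size]; omega

/-- The `±1`-valued version of a Boolean. -/
def sgn (b : Bool) : ℝ := if b then 1 else -1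

/-- The bound holds for either constant label; that the majority is chosen is not needed. -/
lemma bareError_leaf_ge (f : BoolFun n) :
    (1 - |mean (fun z => sgn (f z))|) / 2 ≤ bareError (.leaf ()) f := by
  rw [bareError, error_eq_mean]
  simp only [completion, QueryTree.eval]
  have : ∀ c : Bool, (1 - |mean (fun z => sgn (f z))|) / 2 ≤
      mean (fun z => if c ≠ f z then (1 : ℝ) else 0) := by
    intro c
    have e : (fun z => if c ≠ f z then (1 : ℝ) else 0) =
        fun z => 1 / 2 - (sgn c / 2) * sgn (f z) := by
      ext z
      cases c <;> cases f z <;> norm_num [sgn]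
    rw [e, mean_sub, mean_const, mean_const_mul]
    have h₁ := neg_abs_le (mean (fun z => sgn (f z)))
    have h₂ := le_abs_self (mean (fun z => sgn (f z)))
    have h₃ : sgn c = 1 ∨ sgn c = -1 := by cases c <;> simp [sgn]
    rcases h₃ with h | h <;> rw [h] <;> linarith
  exact this _

end TopDown

/-! ### Optimal trees -/

section Optimal

variable {n : ℕ}

lemma dtSize_le {f : BoolFun n} {T : DecisionTree n} (h : T.eval = f) : dtSize f ≤ T.size :=
  Nat.sInf_le ⟨T, h, rfl⟩

lemma exists_tree_of_dependsOn (s : Finset (Fin n)) :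
    ∀ f : BoolFun n, DependsOn f (s : Set (Fin n)) →
      ∃ T : DecisionTree n, T.eval = f ∧ T.size ≤ 2 ^ s.card := by
  induction s using Finset.induction_on with
  | empty =>
    intro f hf
    refine ⟨.leaf (f fun _ => false), ?_, by simp [QueryTree.size]⟩
    ext z
    simp only [QueryTree.eval]
    exact hf (by simp)
  | insert i s hi ih =>
    intro f hf
    have hr : ∀ b, DependsOn (restrict f i b) (s : Set (Fin n)) := by
      intro b x y hxy
      apply hf
      intro j hj
      by_cases hji : j = i
      · subst hji; simp
      · simp only [Function.update_of_ne hji]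
        exact hxy j (by simpa [hji] using hj)
    obtain ⟨T₀, h₀, s₀⟩ := ih _ (hr false)
    obtain ⟨T₁, h₁, s₁⟩ := ih _ (hr true)
    refine ⟨.node i T₀ T₁, ?_, ?_⟩
    · ext z
      simp only [QueryTree.eval, h₀, h₁, restrict]
      cases hz : z i
      · have : Function.update z i false = z := by rw [← hz]; simp
        simp [this]
      · have : Function.update z i true = z := by rw [← hz]; simp
        simp [this]
    · rw [card_insert_of_notMem hi, pow_succ]
      simp only [QueryTree.size]
      omega

lemma exists_tree (f : BoolFun n) : ∃ T : DecisionTree n, T.eval = f ∧ T.size = dtSize f := by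
  obtain ⟨T, hT, -⟩ := exists_tree_of_dependsOn univ f fun x y h => by
    rw [funext fun i => h i (by simp)]
  exact Nat.sInf_mem (s := {m : ℕ | ∃ T : DecisionTree n, T.eval = f ∧ T.size = m}) ⟨_, T, hT, rfl⟩

end Optimal

/-! ### Chains of conjunctions and disjunctions -/

section Chains

variable {n : ℕ}

/-- `f` does not depend on the variable `i`. -/
def Indep (f : BoolFun n) (i : Fin n) : Prop := ∀ b, restrict f i b = f

lemma Indep.update {f : BoolFun n} {i : Fin n} (h : Indep f i) (z : Fin n → Bool) (b : Bool) :
    f (Function.update z i b) = f z := congrFun (h b) z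

/-- The probability that `f` takes the value `1`. -/
noncomputable def density (f : BoolFun n) : ℝ := mean fun z => if f z then 1 else 0

lemma density_split (f : BoolFun n) (i : Fin n) :
    density f = (density (restrict f i false) + density (restrict f i true)) / 2 :=
  mean_split _ i

lemma error_false (f : BoolFun n) : error (fun _ => false) f = density f := by
  rw [error_eq_mean, density]
  congr 1
  ext z
  cases f z <;> simp

lemma error_true (f : BoolFun n) : error f (fun _ => true) = 1 - density f := by
  rw [error_eq_mean, density, ← mean_const (n := n) 1, ← mean_sub, mean_const]
  congr 1
  ext z
  cases f z <;> simp

/-- The conjunction of a variable and a function. -/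
def andVar (v : Fin n) (g : BoolFun n) : BoolFun n := fun z => z v && g z

/-- The disjunction of a variable and a function. -/
def orVar (v : Fin n) (g : BoolFun n) : BoolFun n := fun z => z v || g z

lemma restrict_andVar_false (v : Fin n) (g : BoolFun n) :
    restrict (andVar v g) v false = fun _ => false := by
  ext z; simp [restrict, andVar]

lemma restrict_andVar_true {v : Fin n} {g : BoolFun n} (h : Indep g v) :
    restrict (andVar v g) v true = g := by
  ext z; simp [restrict, andVar, h.update]

lemma restrict_orVar_false {v : Fin n} {g : BoolFun n} (h : Indep g v) :
    restrict (orVar v g) v false = g := by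
  ext z; simp [restrict, orVar, h.update]

lemma restrict_orVar_true (v : Fin n) (g : BoolFun n) :
    restrict (orVar v g) v true = fun _ => true := by
  ext z; simp [restrict, orVar]

lemma restrict_andVar_of_ne {v i : Fin n} (h : v ≠ i) (g : BoolFun n) (b : Bool) :
    restrict (andVar v g) i b = andVar v (restrict g i b) := by
  ext z; simp [restrict, andVar, h]

lemma restrict_orVar_of_ne {v i : Fin n} (h : v ≠ i) (g : BoolFun n) (b : Bool) :
    restrict (orVar v g) i b = orVar v (restrict g i b) := by
  ext z; simp [restrict, orVar, h]

lemma indep_andVar {v i : Fin n} (h : v ≠ i) {g : BoolFun n} (hg : Indep g i) :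
    Indep (andVar v g) i := fun b => by rw [restrict_andVar_of_ne h, hg b]

lemma indep_orVar {v i : Fin n} (h : v ≠ i) {g : BoolFun n} (hg : Indep g i) :
    Indep (orVar v g) i := fun b => by rw [restrict_orVar_of_ne h, hg b]

lemma influence_const (c : Bool) (i : Fin n) : influence (fun _ => c) i = 0 := by
  simp [influence]

lemma density_const (c : Bool) : density (fun _ : Fin n → Bool => c) = if c then 1 else 0 := by
  simp [density, mean_const]

lemma density_andVar {v : Fin n} {g : BoolFun n} (h : Indep g v) :
    density (andVar v g) = density g / 2 := by
  rw [density_split _ v, restrict_andVar_false, restrict_andVar_true h, density_const]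
  simp

lemma density_orVar {v : Fin n} {g : BoolFun n} (h : Indep g v) :
    density (orVar v g) = (density g + 1) / 2 := by
  rw [density_split _ v, restrict_orVar_false h, restrict_orVar_true, density_const]
  simp

lemma influence_andVar_self {v : Fin n} {g : BoolFun n} (h : Indep g v) :
    influence (andVar v g) v = density g := by
  rw [influence_eq_error, restrict_andVar_false, restrict_andVar_true h, error_false]

lemma influence_orVar_self {v : Fin n} {g : BoolFun n} (h : Indep g v) :
    influence (orVar v g) v = 1 - density g := by
  rw [influence_eq_error, restrict_orVar_false h, restrict_orVar_true, error_true]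

lemma influence_andVar_of_ne {v j : Fin n} {g : BoolFun n} (h : Indep g v) (hj : j ≠ v) :
    influence (andVar v g) j = influence g j / 2 := by
  rw [influence_split _ hj, restrict_andVar_false, restrict_andVar_true h, influence_const]
  ring

lemma influence_orVar_of_ne {v j : Fin n} {g : BoolFun n} (h : Indep g v) (hj : j ≠ v) :
    influence (orVar v g) j = influence g j / 2 := by
  rw [influence_split _ hj, restrict_orVar_true, restrict_orVar_false h, influence_const]
  ring

/-- `Chain r l f` holds if `f` arises from `r` by successive conjunctions and disjunctions with the
fresh variables listed in `l`, the outermost one being the head of the list. -/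
inductive Chain (r : BoolFun n) : List (Fin n) → BoolFun n → Prop
  | base : Chain r [] r
  | and {v : Fin n} {l : List (Fin n)} {g : BoolFun n} (hv : v ∉ l) (hg : Indep g v)
      (h : Chain r l g) : Chain r (v :: l) (andVar v g)
  | or {v : Fin n} {l : List (Fin n)} {g : BoolFun n} (hv : v ∉ l) (hg : Indep g v)
      (h : Chain r l g) : Chain r (v :: l) (orVar v g)

/-- The neutral answer, 1 for a conjunction and 0 for a disjunction, deletes the variable from the
chain and leaves `r` intact. -/
lemma Chain.exists_restrict {r f : BoolFun n} {l : List (Fin n)} (h : Chain r l f) {i : Fin n}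
    (hi : i ∈ l) : ∃ b, Chain r (l.erase i) (restrict f i b) := by
  induction h with
  | base => simp at hi
  | @and v l g hv hg h ih =>
    by_cases hvi : v = i
    · subst hvi
      exact ⟨true, by rwa [restrict_andVar_true hg, List.erase_cons_head]⟩
    · obtain ⟨b, hb⟩ := ih (by simpa [Ne.symm hvi] using hi)
      refine ⟨b, ?_⟩
      rw [restrict_andVar_of_ne hvi, List.erase_cons_tail (by simpa using hvi)]
      exact .and (fun h' => hv (List.mem_of_mem_erase h'))
        (fun c => restrict_restrict_of_indep hg c b) hb
  | @or v l g hv hg h ih =>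
    by_cases hvi : v = i
    · subst hvi
      exact ⟨false, by rwa [restrict_orVar_false hg, List.erase_cons_head]⟩
    · obtain ⟨b, hb⟩ := ih (by simpa [Ne.symm hvi] using hi)
      refine ⟨b, ?_⟩
      rw [restrict_orVar_of_ne hvi, List.erase_cons_tail (by simpa using hvi)]
      exact .or (fun h' => hv (List.mem_of_mem_erase h'))
        (fun c => restrict_restrict_of_indep hg c b) hb

/-- The witness is the innermost chain variable. Right after it is added its influence is 1/2, since
`r` is balanced, while the influences of `r` have been halved to below 1/2. Each further layer
halves both sides of the comparison. -/
lemma Chain.exists_influential {r f : BoolFun n} (hr : density r = 1 / 2)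
    (hlt : ∀ j, influence r j < 1) {l : List (Fin n)} (h : Chain r l f) (hl : l ≠ []) :
    ∃ v ∈ l, ∀ j ∉ l, influence f j < influence f v := by
  induction h with
  | base => simp at hl
  | @and v l g hv hg h ih =>
    by_cases hl' : l = []
    · subst hl'
      cases h
      refine ⟨v, by simp, fun j hj => ?_⟩
      rw [influence_andVar_self hg, influence_andVar_of_ne hg (by simpa using hj), hr]
      linarith [hlt j]
    · obtain ⟨v₀, hv₀, hmax⟩ := ih hl'
      refine ⟨v₀, by simp [hv₀], fun j hj => ?_⟩
      simp only [List.mem_cons, not_or] at hj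
      rw [influence_andVar_of_ne hg hj.1, influence_andVar_of_ne hg fun h => hv (h ▸ hv₀)]
      linarith [hmax j hj.2]
  | @or v l g hv hg h ih =>
    by_cases hl' : l = []
    · subst hl'
      cases h
      refine ⟨v, by simp, fun j hj => ?_⟩
      rw [influence_orVar_self hg, influence_orVar_of_ne hg (by simpa using hj), hr]
      linarith [hlt j]
    · obtain ⟨v₀, hv₀, hmax⟩ := ih hl'
      refine ⟨v₀, by simp [hv₀], fun j hj => ?_⟩
      simp only [List.mem_cons, not_or] at hj
      rw [influence_orVar_of_ne hg hj.1, influence_orVar_of_ne hg fun h => hv (h ▸ hv₀)]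
      linarith [hmax j hj.2]

/-- Every greedy tree that computes `f` exactly has size at least `M`. -/
def ExactSizeAtLeast (f : BoolFun n) (M : ℕ) : Prop :=
  ∀ T : BareTree n, Greedy T f → bareError T f ≤ 0 → M ≤ T.size

lemma bareError_leaf_pos {f : BoolFun n} {i : Fin n} (h : 0 < influence f i) (a : Unit) :
    0 < bareError (.leaf a) f := by
  obtain ⟨z, hz⟩ := (influence_pos_iff f i).1 h
  have : ∃ z, majorityLabel f ≠ f z := by
    by_contra! hc
    exact hz ((hc z).symm.trans (hc _))
  obtain ⟨z, hz⟩ := this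
  rw [bareError, error_eq_mean]
  refine mean_pos (fun z => by positivity) (z := z) ?_
  simp [completion, QueryTree.eval, hz]

lemma exists_node_of_influence_pos {f : BoolFun n} {i : Fin n} (h : 0 < influence f i)
    {T : BareTree n} (hT : Greedy T f) (he : bareError T f ≤ 0) :
    ∃ j t₀ t₁, T = .node j t₀ t₁ ∧ IsMostInfluential f j ∧ Greedy t₀ (restrict f j false) ∧
      Greedy t₁ (restrict f j true) ∧ bareError t₀ (restrict f j false) ≤ 0 ∧
      bareError t₁ (restrict f j true) ≤ 0 := by
  cases T with
  | leaf a => exact absurd (bareError_leaf_pos h a) he.not_gt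
  | node j t₀ t₁ =>
    obtain ⟨-, h1, h2, h3⟩ := hT
    rw [bareError_node h2 h3] at he
    have h4 := bareError_nonneg t₀ (restrict f j false)
    have h5 := bareError_nonneg t₁ (restrict f j true)
    exact ⟨j, t₀, t₁, rfl, h1, h2, h3, by linarith, by linarith⟩

/-- Induction on the length of the chain: the root queries some chain variable, and the subtree
under its neutral answer is a greedy exact tree for a shorter chain over the same `r`. Which chain
variable is chosen is irrelevant. -/
lemma Chain.exactSizeAtLeast {r : BoolFun n} (hr : density r = 1 / 2)
    (hlt : ∀ j, influence r j < 1) {M : ℕ} (hM : ExactSizeAtLeast r M) (k : ℕ) :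
    ∀ {l : List (Fin n)} {f : BoolFun n}, l.length = k → Chain r l f → ExactSizeAtLeast f M := by
  induction k with
  | zero =>
    intro l f hk h
    cases h with
    | base => exact hM
    | and => simp at hk
    | or => simp at hk
  | succ k ih =>
    intro l f hk h T hT he
    obtain ⟨v, hv, hmax⟩ := h.exists_influential hr hlt (by rintro rfl; simp at hk)
    have hpos : ∃ i, 0 < influence f i := by
      by_contra! hc
      have hz : ∀ i, influence f i = 0 := fun i => le_antisymm (hc i) (influence_nonneg _ _)
      -- Each layer keeps the density strictly between 0 and 1, so a chain is never constant.
      have hd : ∀ {l : List (Fin n)} {f : BoolFun n}, Chain r l f → 0 < density f ∧ density f < 1 := by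
        intro l f h
        induction h with
        | base => rw [hr]; norm_num
        | and hv hg h ih => rw [density_andVar hg]; constructor <;> linarith
        | or hv hg h ih => rw [density_orVar hg]; constructor <;> linarith
      have hfc : f = fun _ => f fun _ => false :=
        funext fun z => eq_const_of_influence_eq_zero hz z _
      have := hd h
      rw [hfc, density_const] at this
      split_ifs at this <;> norm_num at this
    obtain ⟨i, hi⟩ := hpos
    obtain ⟨j, t₀, t₁, rfl, hj, h0, h1, e0, e1⟩ := exists_node_of_influence_pos hi hT he
    have hjl : j ∈ l := by
      by_contra hjl
      exact (hmax j hjl).not_ge (hj v)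
    obtain ⟨b, hb⟩ := h.exists_restrict hjl
    have := ih (by rw [List.length_erase_of_mem hjl]; omega) hb
    simp only [QueryTree.size]
    cases b
    · have := this t₀ h0 e0; omega
    · have := this t₁ h1 e1; omega

end Chains

/-! ### The gadget -/

section Gadget

variable {n : ℕ}

/-- If `y = 1` this is `a₁ ∨ a₂ ∨ (b₁ ∧ b₂ ∧ r)` and if `y = 0` it is `b₁ ∧ b₂ ∧ (a₁ ∨ a₂ ∨ r)`. -/
def gadget (y a₁ a₂ b₁ b₂ : Fin n) (r : BoolFun n) : BoolFun n := fun z =>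
  if z y then orVar a₁ (orVar a₂ (andVar b₁ (andVar b₂ r))) z
  else andVar b₁ (andVar b₂ (orVar a₁ (orVar a₂ r))) z

variable {y a₁ a₂ b₁ b₂ : Fin n} {r : BoolFun n}

/-- The variables of the gadget are distinct, and `r` does not depend on them. -/
structure Fresh (y a₁ a₂ b₁ b₂ : Fin n) (r : BoolFun n) : Prop where
  nodup : [y, a₁, a₂, b₁, b₂].Nodup
  indep : ∀ i ∈ [y, a₁, a₂, b₁, b₂], Indep r i

lemma indep_gadget {i : Fin n} (hi : i ∉ [y, a₁, a₂, b₁, b₂]) (hr : Indep r i) :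
    Indep (gadget y a₁ a₂ b₁ b₂ r) i := by
  simp only [List.mem_cons, List.not_mem_nil, or_false, not_or] at hi
  obtain ⟨h1, h2, h3, h4, h5⟩ := hi
  intro b
  ext z
  simp [restrict, gadget, orVar, andVar, hr.update, Ne.symm h1, Ne.symm h2, Ne.symm h3, Ne.symm h4,
    Ne.symm h5]

lemma monotone_andVar {v : Fin n} {g : BoolFun n} (hg : Monotone g) : Monotone (andVar v g) := by
  intro x z hxz
  have h1 := hxz v
  have h2 := hg hxz
  simp only [andVar]
  revert h1 h2
  cases x v <;> cases z v <;> simp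

lemma monotone_orVar {v : Fin n} {g : BoolFun n} (hg : Monotone g) : Monotone (orVar v g) := by
  intro x z hxz
  have h1 := hxz v
  have h2 := hg hxz
  simp only [orVar]
  revert h1 h2
  cases x v <;> cases z v <;> simp

/-- Besides both branches being monotone, the branch `y = 0` lies below the branch `y = 1`. -/
lemma monotone_gadget (hr : Monotone r) : Monotone (gadget y a₁ a₂ b₁ b₂ r) := by
  have h0 : Monotone (andVar b₁ (andVar b₂ (orVar a₁ (orVar a₂ r)))) :=
    monotone_andVar (monotone_andVar (monotone_orVar (monotone_orVar hr)))
  have h1 : Monotone (orVar a₁ (orVar a₂ (andVar b₁ (andVar b₂ r)))) :=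
    monotone_orVar (monotone_orVar (monotone_andVar (monotone_andVar hr)))
  have h01 : ∀ z, andVar b₁ (andVar b₂ (orVar a₁ (orVar a₂ r))) z ≤
      orVar a₁ (orVar a₂ (andVar b₁ (andVar b₂ r))) z := by
    intro z
    simp only [andVar, orVar]
    cases z a₁ <;> cases z a₂ <;> cases z b₁ <;> cases z b₂ <;> simp
  intro x z hxz
  have hy := hxz y
  simp only [gadget]
  cases hx : x y <;> cases hz : z y
  · simpa using h0 hxz
  · simpa using (h0 hxz).trans (h01 z)
  · rw [hx, hz] at hy
    exact absurd (show (true : Bool) ≤ false from hy) (by decide)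
  · simpa using h1 hxz

lemma Fresh.ne (h : Fresh y a₁ a₂ b₁ b₂ r) :
    (y ≠ a₁ ∧ y ≠ a₂ ∧ y ≠ b₁ ∧ y ≠ b₂) ∧ (a₁ ≠ a₂ ∧ a₁ ≠ b₁ ∧ a₁ ≠ b₂) ∧ (a₂ ≠ b₁ ∧
    a₂ ≠ b₂) ∧ b₁ ≠ b₂ := by
  have := h.nodup
  simp only [List.nodup_cons, List.mem_cons, List.not_mem_nil, or_false, not_or] at this
  tauto

lemma Fresh.restrict_false (h : Fresh y a₁ a₂ b₁ b₂ r) :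
    restrict (gadget y a₁ a₂ b₁ b₂ r) y false =
      andVar b₁ (andVar b₂ (orVar a₁ (orVar a₂ r))) := by
  obtain ⟨⟨h1, h2, h3, h4⟩, -⟩ := h.ne
  have hr := h.indep y (by simp)
  ext z
  simp [restrict, gadget, orVar, andVar, hr.update, Ne.symm h1, Ne.symm h2, Ne.symm h3, Ne.symm h4]

lemma Fresh.restrict_true (h : Fresh y a₁ a₂ b₁ b₂ r) :
    restrict (gadget y a₁ a₂ b₁ b₂ r) y true =
      orVar a₁ (orVar a₂ (andVar b₁ (andVar b₂ r))) := by
  obtain ⟨⟨h1, h2, h3, h4⟩, -⟩ := h.ne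
  have hr := h.indep y (by simp)
  ext z
  simp [restrict, gadget, orVar, andVar, hr.update, Ne.symm h1, Ne.symm h2, Ne.symm h3, Ne.symm h4]

lemma Fresh.indep_chain_false (h : Fresh y a₁ a₂ b₁ b₂ r) :
    Indep r a₂ ∧ Indep (orVar a₂ r) a₁ ∧ Indep (orVar a₁ (orVar a₂ r)) b₂ ∧
      Indep (andVar b₂ (orVar a₁ (orVar a₂ r))) b₁ := by
  obtain ⟨-, ⟨h1, h2, h3⟩, ⟨h4, h5⟩, h6⟩ := h.ne
  have hr : Indep r a₁ ∧ Indep r a₂ ∧ Indep r b₁ ∧ Indep r b₂ := by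
    refine ⟨?_, ?_, ?_, ?_⟩ <;> exact h.indep _ (by simp)
  refine ⟨hr.2.1, indep_orVar h1.symm hr.1, indep_orVar h3 (indep_orVar h5 hr.2.2.2), ?_⟩
  exact indep_andVar h6.symm (indep_orVar h2 (indep_orVar h4 hr.2.2.1))

lemma Fresh.indep_chain_true (h : Fresh y a₁ a₂ b₁ b₂ r) :
    Indep r b₂ ∧ Indep (andVar b₂ r) b₁ ∧ Indep (andVar b₁ (andVar b₂ r)) a₂ ∧
      Indep (orVar a₂ (andVar b₁ (andVar b₂ r))) a₁ := by
  obtain ⟨-, ⟨h1, h2, h3⟩, ⟨h4, h5⟩, h6⟩ := h.ne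
  have hr : Indep r a₁ ∧ Indep r a₂ ∧ Indep r b₁ ∧ Indep r b₂ := by
    refine ⟨?_, ?_, ?_, ?_⟩ <;> exact h.indep _ (by simp)
  refine ⟨hr.2.2.2, indep_andVar h6.symm hr.2.2.1,
    indep_andVar h4.symm (indep_andVar h5.symm hr.2.1), ?_⟩
  exact indep_orVar h1.symm (indep_andVar h2.symm (indep_andVar h3.symm hr.1))

lemma Fresh.chain_false (h : Fresh y a₁ a₂ b₁ b₂ r) :
    Chain r [b₁, b₂, a₁, a₂] (andVar b₁ (andVar b₂ (orVar a₁ (orVar a₂ r)))) := by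
  obtain ⟨-, ⟨h1, h2, h3⟩, ⟨h4, h5⟩, h6⟩ := h.ne
  obtain ⟨i1, i2, i3, i4⟩ := h.indep_chain_false
  refine .and ?_ i4 (.and ?_ i3 (.or ?_ i2 (.or ?_ i1 .base))) <;>
    simp [h1, h2.symm, h3.symm, h4.symm, h5.symm, h6]

lemma Fresh.chain_true (h : Fresh y a₁ a₂ b₁ b₂ r) :
    Chain r [a₁, a₂, b₁, b₂] (orVar a₁ (orVar a₂ (andVar b₁ (andVar b₂ r)))) := by
  obtain ⟨-, ⟨h1, h2, h3⟩, ⟨h4, h5⟩, h6⟩ := h.ne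
  obtain ⟨i1, i2, i3, i4⟩ := h.indep_chain_true
  refine .or ?_ i4 (.or ?_ i3 (.and ?_ i2 (.and ?_ i1 .base))) <;>
    simp [h1, h2, h3, h4, h5, h6]

/-- The branches have densities 7/32 and 25/32, symmetric about 1/2. Preserving the balance is what
permits the iteration. -/
lemma Fresh.density (h : Fresh y a₁ a₂ b₁ b₂ r) (hr : density r = 1 / 2) :
    TopDownDT.density (gadget y a₁ a₂ b₁ b₂ r) = 1 / 2 := by
  obtain ⟨i1, i2, i3, i4⟩ := h.indep_chain_false
  obtain ⟨j1, j2, j3, j4⟩ := h.indep_chain_true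
  rw [density_split _ y, h.restrict_false, h.restrict_true, density_andVar i4, density_andVar i3,
    density_orVar i2, density_orVar i1, density_orVar j4, density_orVar j3, density_andVar j2,
    density_andVar j1, hr]
  norm_num

lemma Fresh.influence_of_notMem (h : Fresh y a₁ a₂ b₁ b₂ r) {j : Fin n}
    (hj : j ∉ [y, a₁, a₂, b₁, b₂]) :
    influence (gadget y a₁ a₂ b₁ b₂ r) j = influence r j / 16 := by
  obtain ⟨i1, i2, i3, i4⟩ := h.indep_chain_false
  obtain ⟨j1, j2, j3, j4⟩ := h.indep_chain_true
  simp only [List.mem_cons, List.not_mem_nil, or_false, not_or] at hj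
  obtain ⟨h1, h2, h3, h4, h5⟩ := hj
  rw [influence_split _ h1, h.restrict_false, h.restrict_true, influence_andVar_of_ne i4 h4,
    influence_andVar_of_ne i3 h5, influence_orVar_of_ne i2 h2, influence_orVar_of_ne i1 h3,
    influence_orVar_of_ne j4 h2, influence_orVar_of_ne j3 h3, influence_andVar_of_ne j2 h4,
    influence_andVar_of_ne j1 h5]
  ring

/-- In one branch the influence is 1/16, in the other 7/16. -/
lemma Fresh.influence_of_mem (h : Fresh y a₁ a₂ b₁ b₂ r) (hr : TopDownDT.density r = 1 / 2)
    {j : Fin n} (hj : j ∈ [a₁, a₂, b₁, b₂]) :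
    influence (gadget y a₁ a₂ b₁ b₂ r) j = 1 / 4 := by
  obtain ⟨i1, i2, i3, i4⟩ := h.indep_chain_false
  obtain ⟨j1, j2, j3, j4⟩ := h.indep_chain_true
  obtain ⟨⟨y1, y2, y3, y4⟩, ⟨h1, h2, h3⟩, ⟨h4, h5⟩, h6⟩ := h.ne
  simp only [List.mem_cons, List.not_mem_nil, or_false] at hj
  rcases hj with rfl | rfl | rfl | rfl
  · rw [influence_split _ y1.symm, h.restrict_false, h.restrict_true, influence_andVar_of_ne i4 h2,
      influence_andVar_of_ne i3 h3, influence_orVar_self i2, density_orVar i1,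
      influence_orVar_self j4, density_orVar j3, density_andVar j2, density_andVar j1, hr]
    norm_num
  · rw [influence_split _ y2.symm, h.restrict_false, h.restrict_true, influence_andVar_of_ne i4 h4,
      influence_andVar_of_ne i3 h5, influence_orVar_of_ne i2 h1.symm, influence_orVar_self i1,
      influence_orVar_of_ne j4 h1.symm, influence_orVar_self j3, density_andVar j2,
      density_andVar j1, hr]
    norm_num
  · rw [influence_split _ y3.symm, h.restrict_false, h.restrict_true, influence_andVar_self i4,
      density_andVar i3, density_orVar i2, density_orVar i1, influence_orVar_of_ne j4 h2.symm,
      influence_orVar_of_ne j3 h4.symm, influence_andVar_self j2, density_andVar j1, hr]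
    norm_num
  · rw [influence_split _ y4.symm, h.restrict_false, h.restrict_true,
      influence_andVar_of_ne i4 h6.symm, influence_andVar_self i3, density_orVar i2,
      density_orVar i1, influence_orVar_of_ne j4 h3.symm, influence_orVar_of_ne j3 h5.symm,
      influence_andVar_of_ne j2 h6.symm, influence_andVar_self j1, hr]
    norm_num

/-- The two branches differ exactly when some `a` is 1 and some `b` is 0, an event of probability
(3/4)². Two variables of each kind are needed: with one `a` and one `b`, `y` would have influence
1/4 against 1/2 for `a`. -/
lemma Fresh.influence_y (h : Fresh y a₁ a₂ b₁ b₂ r) :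
    influence (gadget y a₁ a₂ b₁ b₂ r) y = 9 / 16 := by
  obtain ⟨-, ⟨h1, h2, h3⟩, ⟨h4, h5⟩, h6⟩ := h.ne
  rw [influence_eq_error, h.restrict_false, h.restrict_true, error_eq_mean]
  have e : (fun z : Fin n → Bool => if andVar b₁ (andVar b₂ (orVar a₁ (orVar a₂ r))) z ≠
      orVar a₁ (orVar a₂ (andVar b₁ (andVar b₂ r))) z then (1 : ℝ) else 0) =
      fun z => if (z a₁ || z a₂) && !(z b₁ && z b₂) then (1 : ℝ) else 0 := by
    ext z
    refine if_congr ?_ rfl rfl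
    simp only [andVar, orVar]
    cases z a₁ <;> cases z a₂ <;> cases z b₁ <;> cases z b₂ <;> simp
  rw [e, mean_split _ a₁]
  simp only [Function.update_self, Function.update_of_ne h1.symm, Function.update_of_ne h2.symm,
    Function.update_of_ne h3.symm]
  rw [mean_split (fun z : Fin n → Bool => if (false || z a₂) && !(z b₁ && z b₂) then (1 : ℝ) else 0)
    a₂]
  simp only [Function.update_self, Function.update_of_ne h4.symm, Function.update_of_ne h5.symm]
  have key : mean (fun z : Fin n → Bool => if !(z b₁ && z b₂) then (1 : ℝ) else 0) = 3 / 4 := by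
    rw [mean_split _ b₁]
    simp only [Function.update_self, Function.update_of_ne h6.symm]
    rw [mean_split (fun z : Fin n → Bool => if !(true && z b₂) then (1 : ℝ) else 0) b₂]
    simp [mean_const]
    norm_num
  simp only [Bool.false_or, Bool.true_or, Bool.true_and, Bool.false_and, Bool.false_eq_true,
    if_false, mean_const]
  rw [key]
  norm_num

lemma Fresh.influence_lt_one (h : Fresh y a₁ a₂ b₁ b₂ r) (hr : TopDownDT.density r = 1 / 2)
    (hle : ∀ j, influence r j ≤ 1) (j : Fin n) : influence (gadget y a₁ a₂ b₁ b₂ r) j < 1 := by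
  by_cases hj : j ∈ [y, a₁, a₂, b₁, b₂]
  · rw [List.mem_cons] at hj
    rcases hj with rfl | hj
    · rw [h.influence_y]; norm_num
    · rw [h.influence_of_mem hr hj]; norm_num
  · rw [h.influence_of_notMem hj]
    linarith [hle j]

lemma Fresh.eq_of_isMostInfluential (h : Fresh y a₁ a₂ b₁ b₂ r)
    (hr : TopDownDT.density r = 1 / 2) (hle : ∀ j, influence r j ≤ 1) {i : Fin n}
    (hi : IsMostInfluential (gadget y a₁ a₂ b₁ b₂ r) i) : i = y := by
  by_contra hne
  have h1 := hi y
  rw [h.influence_y] at h1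
  by_cases hj : i ∈ [a₁, a₂, b₁, b₂]
  · rw [h.influence_of_mem hr hj] at h1
    norm_num at h1
  · rw [h.influence_of_notMem (by simp_all)] at h1
    linarith [hle i]

lemma Fresh.exactSizeAtLeast (h : Fresh y a₁ a₂ b₁ b₂ r)
    (hr : TopDownDT.density r = 1 / 2) (hlt : ∀ j, influence r j < 1) {M : ℕ}
    (hM : ExactSizeAtLeast r M) : ExactSizeAtLeast (gadget y a₁ a₂ b₁ b₂ r) (2 * M) := by
  intro T hT he
  have hy : 0 < influence (gadget y a₁ a₂ b₁ b₂ r) y := by rw [h.influence_y]; norm_num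
  obtain ⟨j, t₀, t₁, rfl, hj, g0, g1, e0, e1⟩ := exists_node_of_influence_pos hy hT he
  obtain rfl := h.eq_of_isMostInfluential hr (fun j => (hlt j).le) hj
  rw [h.restrict_false] at g0 e0
  rw [h.restrict_true] at g1 e1
  have s0 := h.chain_false.exactSizeAtLeast hr hlt hM _ rfl _ g0 e0
  have s1 := h.chain_true.exactSizeAtLeast hr hlt hM _ rfl _ g1 e1
  simp only [QueryTree.size]
  omega

lemma exactSizeAtLeast_two {f : BoolFun n} {i : Fin n} (h : 0 < influence f i) :
    ExactSizeAtLeast f 2 := by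
  intro T hT he
  obtain ⟨j, t₀, t₁, rfl, -⟩ := exists_node_of_influence_pos h hT he
  have h0 := one_le_size t₀
  have h1 := one_le_size t₁
  simp only [QueryTree.size]
  omega

/-- A tree for the gadget that has a single copy of a given tree for `r`. -/
def gadgetTree (y a₁ a₂ b₁ b₂ : Fin n) (T : DecisionTree n) : DecisionTree n :=
  let S : DecisionTree n := .node b₁ (.node y (.leaf false) (.leaf true))
    (.node b₂ (.node y (.leaf false) (.leaf true)) (.leaf true))
  .node a₁ (.node a₂ (.node b₁ (.leaf false) (.node b₂ (.leaf false) T)) S) S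

lemma gadgetTree_eval (y a₁ a₂ b₁ b₂ : Fin n) (T : DecisionTree n) :
    (gadgetTree y a₁ a₂ b₁ b₂ T).eval = gadget y a₁ a₂ b₁ b₂ T.eval := by
  ext z
  simp only [gadgetTree, gadget, QueryTree.eval, orVar, andVar]
  cases z y <;> cases z a₁ <;> cases z a₂ <;> cases z b₁ <;> cases z b₂ <;> simp

lemma gadgetTree_size (y a₁ a₂ b₁ b₂ : Fin n) (T : DecisionTree n) :
    (gadgetTree y a₁ a₂ b₁ b₂ T).size = T.size + 12 := by
  simp only [gadgetTree, QueryTree.size]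
  omega

end Gadget

/-! ### Iterated gadgets -/

section Iterated

variable {n : ℕ}

/-- The variables queried by a tree. -/
def queried {α : Type} : QueryTree n α → Finset (Fin n)
  | .leaf _ => ∅
  | .node i t₀ t₁ => insert i (queried t₀ ∪ queried t₁)

lemma card_queried_lt_size {α : Type} (T : QueryTree n α) : (queried T).card < T.size := by
  induction T with
  | leaf a => simp [queried, QueryTree.size]
  | node i t₀ t₁ ih₀ ih₁ =>
    have h1 := card_insert_le i (queried t₀ ∪ queried t₁)
    have h2 := card_union_le (queried t₀) (queried t₁)
    simp only [queried, QueryTree.size]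
    omega

lemma eval_flipAt_of_notMem_queried {α : Type} (T : QueryTree n α) {i : Fin n} (h : i ∉ queried T)
    (z : Fin n → Bool) : T.eval (flipAt i z) = T.eval z := by
  induction T with
  | leaf a => rfl
  | node j t₀ t₁ ih₀ ih₁ =>
    simp only [queried, mem_insert, mem_union, not_or] at h
    have : flipAt i z j = z j := by simp [flipAt, Ne.symm h.1]
    simp only [QueryTree.eval, this, ih₀ h.2.1, ih₁ h.2.2]

/-- A tree must query every relevant variable, and it has fewer internal nodes than leaves. -/
lemma card_lt_dtSize {f : BoolFun n} {s : Finset (Fin n)} (h : ∀ i ∈ s, 0 < influence f i) :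
    s.card < dtSize f := by
  obtain ⟨T, hT, hs⟩ := exists_tree f
  rw [← hs]
  refine (card_le_card fun i hi => ?_).trans_lt (card_queried_lt_size T)
  by_contra hc
  obtain ⟨z, hz⟩ := (influence_pos_iff f i).1 (h i hi)
  rw [← hT, eval_flipAt_of_notMem_queried T hc] at hz
  exact hz rfl

/-- The gadget applied `k` times to the variable `v 0`. -/
def gadgetChain (v : ℕ → Fin n) : ℕ → BoolFun n
  | 0 => fun z => z (v 0)
  | k + 1 => gadget (v (5 * k + 1)) (v (5 * k + 2)) (v (5 * k + 3)) (v (5 * k + 4)) (v (5 * k + 5))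
      (gadgetChain v k)

lemma monotone_gadgetChain (v : ℕ → Fin n) (k : ℕ) : Monotone (gadgetChain v k) := by
  induction k with
  | zero => exact fun x z h => h (v 0)
  | succ k ih => exact monotone_gadget ih

lemma indep_gadgetChain (v : ℕ → Fin n) (k : ℕ) {i : Fin n} (h : ∀ j ≤ 5 * k, v j ≠ i) :
    Indep (gadgetChain v k) i := by
  induction k with
  | zero =>
    intro b
    ext z
    simp [restrict, gadgetChain, h 0 (by omega)]
  | succ k ih =>
    refine indep_gadget ?_ (ih fun j hj => h j (by omega))
    simp only [List.mem_cons, List.not_mem_nil, or_false, not_or]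
    refine ⟨?_, ?_, ?_, ?_, ?_⟩ <;> exact (h _ (by omega)).symm

lemma influence_le_one (f : BoolFun n) (i : Fin n) : influence f i ≤ 1 := by
  rw [influence_eq_mean]
  refine (mean_mono (ψ := fun _ => 1) fun z => ?_).trans (mean_const 1).le
  split_ifs <;> norm_num

lemma gadgetChain_fresh {v : ℕ → Fin n} {k : ℕ} (hv : Set.InjOn v {i | i ≤ 5 * (k + 1)}) :
    Fresh (v (5 * k + 1)) (v (5 * k + 2)) (v (5 * k + 3)) (v (5 * k + 4)) (v (5 * k + 5))
      (gadgetChain v k) := by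
  have hne : ∀ i j, i ≤ 5 * (k + 1) → j ≤ 5 * (k + 1) → i ≠ j → v i ≠ v j :=
    fun i j hi hj hij h => hij (hv hi hj h)
  constructor
  · simp only [List.nodup_cons, List.mem_cons, List.not_mem_nil, or_false, not_or,
      not_false_eq_true, List.nodup_nil, and_true]
    refine ⟨⟨?_, ?_, ?_, ?_⟩, ⟨?_, ?_, ?_⟩, ⟨?_, ?_⟩, ?_⟩ <;>
      exact hne _ _ (by omega) (by omega) (by omega)
  · intro i hi
    simp only [List.mem_cons, List.not_mem_nil, or_false] at hi
    apply indep_gadgetChain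
    intro j hj
    rcases hi with rfl | rfl | rfl | rfl | rfl <;>
      exact hne _ _ (by omega) (by omega) (by omega)

lemma density_gadgetChain {v : ℕ → Fin n} {k : ℕ} (hv : Set.InjOn v {i | i ≤ 5 * k}) :
    density (gadgetChain v k) = 1 / 2 := by
  induction k with
  | zero =>
    rw [density_split _ (v 0)]
    have h : ∀ b, restrict (gadgetChain v 0) (v 0) b = fun _ => b := by
      intro b; ext z; simp [restrict, gadgetChain]
    rw [h, h, density_const, density_const]
    simp
  | succ k ih =>
    exact (gadgetChain_fresh hv).density (ih (hv.mono fun i hi => by simp at hi ⊢; omega))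

lemma exactSizeAtLeast_gadgetChain {v : ℕ → Fin n} {k : ℕ}
    (hv : Set.InjOn v {i | i ≤ 5 * (k + 1)}) :
    ExactSizeAtLeast (gadgetChain v (k + 1)) (2 ^ k) := by
  induction k with
  -- The doubling starts only at the second gadget: it requires all influences of the inner function
  -- to be below 1, which fails for the single variable `gadgetChain v 0`.
  | zero => exact fun T _ _ => one_le_size T
  | succ k ih =>
    have hv' : Set.InjOn v {i | i ≤ 5 * (k + 1)} := hv.mono fun i hi => by simp at hi ⊢; omega
    have hv'' : Set.InjOn v {i | i ≤ 5 * k} := hv.mono fun i hi => by simp at hi ⊢; omega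
    rw [pow_succ, mul_comm]
    exact (gadgetChain_fresh hv).exactSizeAtLeast (density_gadgetChain hv')
      ((gadgetChain_fresh hv').influence_lt_one (density_gadgetChain hv'') (influence_le_one _))
      (ih hv')

lemma influence_gadgetChain_pos {v : ℕ → Fin n} {k i : ℕ}
    (hv : Set.InjOn v {i | i ≤ 5 * k}) (hi : i < k) :
    0 < influence (gadgetChain v k) (v (5 * i + 1)) := by
  induction k with
  | zero => omega
  | succ k ih =>
    have hf := gadgetChain_fresh hv
    by_cases hik : i = k
    · subst hik
      exact (hf.influence_y).symm ▸ by norm_num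
    · have hne : ∀ j, 5 * k < j → j ≤ 5 * (k + 1) → v (5 * i + 1) ≠ v j := by
        intro j h1 h2 h
        have := hv (show 5 * i + 1 ≤ 5 * (k + 1) by omega) h2 h
        omega
      have := hf.influence_of_notMem (j := v (5 * i + 1)) (by
        simp only [List.mem_cons, List.not_mem_nil, or_false, not_or]
        refine ⟨?_, ?_, ?_, ?_, ?_⟩ <;> exact hne _ (by omega) (by omega))
      rw [gadgetChain, this]
      have := ih (hv.mono fun i hi => by simp at hi ⊢; omega) (by omega)
      positivity

lemma influence_gadgetChain_zero (v : ℕ → Fin n) : 0 < influence (gadgetChain v 0) (v 0) := by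
  rw [influence_pos_iff]
  exact ⟨fun _ => false, by simp [gadgetChain, flipAt]⟩

lemma exists_tree_gadgetChain (v : ℕ → Fin n) (k : ℕ) :
    ∃ T : DecisionTree n, T.eval = gadgetChain v k ∧ T.size = 12 * k + 2 := by
  induction k with
  | zero =>
    refine ⟨.node (v 0) (.leaf false) (.leaf true), ?_, rfl⟩
    ext z
    simp [QueryTree.eval, gadgetChain]
  | succ k ih =>
    obtain ⟨T, hT, hs⟩ := ih
    refine ⟨gadgetTree (v (5 * k + 1)) (v (5 * k + 2)) (v (5 * k + 3)) (v (5 * k + 4))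
      (v (5 * k + 5)) T, ?_, ?_⟩
    · rw [gadgetTree_eval, hT, gadgetChain]
    · rw [gadgetTree_size, hs]; omega

/-- The lower bound for exact representation. -/
theorem exact_lower_bound (n : ℕ) (hn : 1 ≤ n) : ∃ f : BoolFun n, Monotone f ∧
    (1 / 5 : ℝ) * n ≤ dtSize f ∧ (dtSize f : ℝ) ≤ 12 * n ∧
    (2 : ℝ) ^ ((1 / 26 : ℝ) * dtSize f) ≤ topDownDTSize f 0 := by
  obtain ⟨k, hk1, hk2⟩ : ∃ k, 5 * k + 1 ≤ n ∧ n ≤ 5 * k + 5 := ⟨(n - 1) / 5, by omega, by omega⟩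
  -- The default index 0 is never reached: only the indices up to `5 * k`, which are below `n`,
  -- occur in the function.
  let v : ℕ → Fin n := fun i => if h : i < n then ⟨i, h⟩ else ⟨0, hn⟩
  have hv : Set.InjOn v {i | i ≤ 5 * k} := by
    intro i hi j hj hij
    simp only [Set.mem_ofPred_eq] at hi hj
    simpa [v, show i < n by omega, show j < n by omega] using hij
  obtain ⟨T, hT, hs⟩ := exists_tree_gadgetChain v k
  have hub : dtSize (gadgetChain v k) ≤ 12 * k + 2 := hs ▸ dtSize_le hT
  have hub' : (dtSize (gadgetChain v k) : ℝ) ≤ 12 * k + 2 := by exact_mod_cast hub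
  have hk1' : (5 * k + 1 : ℝ) ≤ n := by exact_mod_cast hk1
  have hk2' : (n : ℝ) ≤ 5 * k + 5 := by exact_mod_cast hk2
  refine ⟨gadgetChain v k, monotone_gadgetChain v k, ?_, by linarith, ?_⟩
  · have hlb : ((range k).image fun i => v (5 * i + 1)).card < dtSize (gadgetChain v k) := by
      apply card_lt_dtSize
      intro i hi
      obtain ⟨j, hj, rfl⟩ := mem_image.1 hi
      exact influence_gadgetChain_pos hv (mem_range.1 hj)
    rw [card_image_of_injOn, card_range] at hlb
    · have : (k + 1 : ℝ) ≤ dtSize (gadgetChain v k) := by exact_mod_cast hlb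
      linarith
    · intro i hi j hj hij
      simp only [coe_range, Set.mem_Iio] at hi hj
      have := hv (show 5 * i + 1 ≤ 5 * k by omega) (show 5 * j + 1 ≤ 5 * k by omega) hij
      omega
  · have h2 : ∃ i, 0 < influence (gadgetChain v k) i := by
      rcases k with _ | k
      · exact ⟨_, influence_gadgetChain_zero v⟩
      · exact ⟨_, influence_gadgetChain_pos hv (Nat.succ_pos k)⟩
    obtain ⟨i, hi⟩ := h2
    -- The constant 26 comes from two gadgets: their tree has `12 * 2 + 2` leaves, while the
    -- guaranteed lower bound is just `2 ^ 1`. For fewer gadgets the trivial bound 2 is enough.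
    rcases Nat.lt_or_ge k 2 with hk | hk
    · calc (2 : ℝ) ^ ((1 / 26 : ℝ) * dtSize (gadgetChain v k)) ≤ (2 : ℝ) ^ (1 : ℝ) := by
            apply Real.rpow_le_rpow_of_exponent_le (by norm_num)
            have : (k : ℝ) ≤ 1 := by exact_mod_cast (by omega : k ≤ 1)
            linarith
        _ = (2 : ℕ) := by norm_num
        _ ≤ _ := le_topDownDTSize hn le_rfl fun T hT he => by
            exact_mod_cast exactSizeAtLeast_two hi T hT he
    · obtain ⟨k, rfl⟩ : ∃ l, k = l + 1 := ⟨k - 1, by omega⟩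
      calc (2 : ℝ) ^ ((1 / 26 : ℝ) * dtSize (gadgetChain v (k + 1))) ≤ (2 : ℝ) ^ (k : ℝ) := by
            apply Real.rpow_le_rpow_of_exponent_le (by norm_num)
            have : (1 : ℝ) ≤ k := by exact_mod_cast (by omega : 1 ≤ k)
            push_cast at hub'
            linarith
        _ = ((2 ^ k : ℕ) : ℝ) := by rw [Real.rpow_natCast]; push_cast; rfl
        _ ≤ _ := le_topDownDTSize hn le_rfl fun T hT he => by
            exact_mod_cast exactSizeAtLeast_gadgetChain hv T hT he

end Iterated

/-! ### The simple random walk -/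

section Walk

/-- The probability that a simple random walk is at `k` after `r` steps. -/
noncomputable def walk : ℕ → ℤ → ℝ
  | 0, k => if k = 0 then 1 else 0
  | r + 1, k => (walk r (k - 1) + walk r (k + 1)) / 2

lemma walk_nonneg (r : ℕ) (k : ℤ) : 0 ≤ walk r k := by
  induction r generalizing k with
  | zero => unfold walk; split_ifs <;> norm_num
  | succ r ih => unfold walk; linarith [ih (k - 1), ih (k + 1)]

lemma walk_neg (r : ℕ) (k : ℤ) : walk r (-k) = walk r k := by
  induction r generalizing k with
  | zero => simp [walk]
  | succ r ih =>
    have h1 := ih (k + 1)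
    have h2 := ih (k - 1)
    rw [show -(k + 1) = -k - 1 by ring] at h1
    rw [show -(k - 1) = -k + 1 by ring] at h2
    simp only [walk]
    rw [h1, h2]
    ring

lemma walk_eq_zero_of_lt {r : ℕ} {k : ℤ} (h : k < -r) : walk r k = 0 := by
  induction r generalizing k with
  | zero => simp only [walk]; rw [if_neg]; omega
  | succ r ih =>
    simp only [walk]
    rw [ih (by push_cast at h; omega), ih (by push_cast at h; omega)]
    simp

lemma walk_eq_zero_of_odd {r : ℕ} {k : ℤ} (h : (k + r) % 2 = 1) : walk r k = 0 := by
  induction r generalizing k with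
  | zero => simp only [walk]; rw [if_neg]; omega
  | succ r ih =>
    simp only [walk]
    rw [ih (by push_cast at h; omega), ih (by push_cast at h; omega)]
    simp

lemma walk_eq_choose (r c : ℕ) : walk r (2 * c - r) = (r.choose c : ℝ) / 2 ^ r := by
  induction r generalizing c with
  | zero =>
    rcases c with _ | c
    · simp [walk]
    · simp only [walk]
      rw [if_neg (by push_cast; omega)]
      simp
  | succ r ih =>
    simp only [walk]
    rcases c with _ | c
    · rw [walk_eq_zero_of_lt (by push_cast; omega)]
      have := ih 0
      rw [show (2 * ((0 : ℕ) : ℤ) - ((r + 1 : ℕ) : ℤ) + 1) = 2 * ((0 : ℕ) : ℤ) - r by push_cast; ring,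
        this]
      simp [pow_succ]
      field_simp
    · rw [show (2 * ((c + 1 : ℕ) : ℤ) - ((r + 1 : ℕ) : ℤ) - 1) = 2 * (c : ℤ) - r by push_cast; ring,
        show (2 * ((c + 1 : ℕ) : ℤ) - ((r + 1 : ℕ) : ℤ) + 1) = 2 * ((c + 1 : ℕ) : ℤ) - r by
          push_cast; ring, ih, ih, Nat.choose_succ_succ, pow_succ]
      push_cast
      field_simp

/-! ### Estimates of binomial coefficients -/

lemma centralBinom_sq_mul_le (h : ℕ) : (h.centralBinom : ℝ) ^ 2 * (2 * h + 1) ≤ 16 ^ h := by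
  induction h with
  | zero => simp
  | succ h ih =>
    have e : ((h : ℝ) + 1) * (h + 1).centralBinom = 2 * (2 * h + 1) * h.centralBinom := by
      exact_mod_cast Nat.succ_mul_centralBinom_succ h
    have hp : (0 : ℝ) < (h + 1) ^ 2 := by positivity
    have e2 : ((h : ℝ) + 1) ^ 2 * ((h + 1).centralBinom : ℝ) ^ 2 =
        4 * (2 * h + 1) ^ 2 * (h.centralBinom : ℝ) ^ 2 := by
      rw [← mul_pow, e]; ring
    rw [← mul_le_mul_iff_right₀ hp]
    push_cast
    calc ((h : ℝ) + 1) ^ 2 * (((h + 1).centralBinom : ℝ) ^ 2 * (2 * (h + 1) + 1))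
        = 4 * (2 * h + 1) * (2 * h + 3) * ((h.centralBinom : ℝ) ^ 2 * (2 * h + 1)) := by
          rw [← mul_assoc, e2]; ring
      _ ≤ 4 * (2 * h + 1) * (2 * h + 3) * (16 : ℝ) ^ h := by gcongr
      _ ≤ (16 * (h + 1) ^ 2) * (16 : ℝ) ^ h := by
          refine mul_le_mul_of_nonneg_right ?_ (by positivity)
          nlinarith
      _ = (h + 1) ^ 2 * (16 : ℝ) ^ (h + 1) := by ring

lemma le_centralBinom_sq_mul (h : ℕ) (hh : 1 ≤ h) :
    (16 : ℝ) ^ h ≤ (h.centralBinom : ℝ) ^ 2 * (4 * h) := by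
  induction h, hh using Nat.le_induction with
  | base => simp [Nat.centralBinom, Nat.choose]; norm_num
  | succ h hh ih =>
    have e : ((h : ℝ) + 1) * (h + 1).centralBinom = 2 * (2 * h + 1) * h.centralBinom := by
      exact_mod_cast Nat.succ_mul_centralBinom_succ h
    have hp : (0 : ℝ) < (h + 1) * h := by
      have : (1 : ℝ) ≤ h := by exact_mod_cast hh
      positivity
    have e2 : ((h : ℝ) + 1) ^ 2 * ((h + 1).centralBinom : ℝ) ^ 2 =
        4 * (2 * h + 1) ^ 2 * (h.centralBinom : ℝ) ^ 2 := by
      rw [← mul_pow, e]; ring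
    rw [← mul_le_mul_iff_right₀ hp]
    push_cast
    calc ((h : ℝ) + 1) * h * 16 ^ (h + 1) = (16 * (h + 1) * h) * 16 ^ h := by ring
      _ ≤ (16 * (h + 1) * h) * ((h.centralBinom : ℝ) ^ 2 * (4 * h)) := by gcongr
      _ ≤ (4 * (2 * h + 1) ^ 2) * ((h.centralBinom : ℝ) ^ 2 * (4 * h)) := by
          refine mul_le_mul_of_nonneg_right ?_ (by positivity)
          nlinarith
      _ = (h + 1) * h * (((h + 1).centralBinom : ℝ) ^ 2 * (4 * (h + 1))) := by
          linear_combination (-4 * (h : ℝ)) * e2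

lemma middle_choose_sq_mul_le (r : ℕ) :
    ((r.choose (r / 2) : ℝ) / 2 ^ r) ^ 2 * (r + 1) ≤ 1 := by
  rcases Nat.even_or_odd' r with ⟨h, rfl | rfl⟩
  · have := centralBinom_sq_mul_le h
    rw [show 2 * h / 2 = h by omega, ← Nat.centralBinom_eq_two_mul_choose, div_pow, div_mul_eq_mul_div,
      div_le_one (by positivity), ← pow_mul, show 2 * h * 2 = 4 * h by ring, pow_mul]
    push_cast
    norm_num
    exact this
  · have := centralBinom_sq_mul_le (h + 1)
    have e : ((h + 1).centralBinom : ℝ) = 2 * ((2 * h + 1).choose h : ℝ) := by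
      rw [Nat.centralBinom_eq_two_mul_choose, show 2 * (h + 1) = (2 * h + 1) + 1 by ring,
        Nat.choose_succ_succ, Nat.choose_symm_half]
      push_cast
      ring
    rw [show (2 * h + 1) / 2 = h by omega, div_pow, div_mul_eq_mul_div,
      div_le_one (by positivity), ← pow_mul, show (2 * h + 1) * 2 = 4 * h + 2 by ring, pow_add,
      pow_mul]
    rw [e] at this
    push_cast at this ⊢
    norm_num
    rw [pow_succ (16 : ℝ)] at this
    nlinarith [sq_nonneg ((2 * h + 1).choose h : ℝ)]

lemma walk_le (r : ℕ) (k : ℤ) : walk r k ≤ 1 / √(r + 1) := by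
  have h0 : (r.choose (r / 2) : ℝ) / 2 ^ r ≤ 1 / √(r + 1) := by
    rw [le_div_iff₀ (by positivity), ← abs_of_nonneg (a := _ * _) (by positivity),
      ← sq_le_one_iff_abs_le_one, mul_pow, Real.sq_sqrt (by positivity)]
    exact middle_choose_sq_mul_le r
  rcases lt_or_ge k (-r) with hk | hk
  · rw [walk_eq_zero_of_lt hk]; positivity
  · rcases Int.emod_two_eq_zero_or_one (k + r) with h | h
    · obtain ⟨c, hc⟩ : ∃ c : ℕ, k = 2 * c - r := ⟨((k + r) / 2).toNat, by omega⟩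
      rw [hc, walk_eq_choose]
      refine le_trans ?_ h0
      gcongr
      exact_mod_cast Nat.choose_le_middle c r
    · rw [walk_eq_zero_of_odd h]; positivity

/-- Going from `h + s` to `h + s + 1` loses a fraction `(2 * s + 1) / (h + s + 1)` of the
coefficient, which is at most `(2 * s + 1) / h` of the central one. The odd numbers sum to a square.
-/
lemma choose_add_ge (h s : ℕ) (hs : s ≤ h) :
    (h.centralBinom : ℝ) * (1 - s ^ 2 / h) ≤ ((2 * h).choose (h + s) : ℝ) := by
  induction s with
  | zero => simp [Nat.centralBinom_eq_two_mul_choose]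
  | succ s ih =>
    have ih := ih (by omega)
    have e : ((2 * h).choose (h + s + 1) : ℝ) * (h + s + 1) = (2 * h).choose (h + s) * (h - s) := by
      have := Nat.choose_succ_right_eq (2 * h) (h + s)
      rw [show 2 * h - (h + s) = h - s by omega] at this
      have h' : ((h - s : ℕ) : ℝ) = h - s := by rw [Nat.cast_sub (by omega)]
      rw [← h']
      exact_mod_cast this
    have hh : (1 : ℝ) ≤ h := by exact_mod_cast (by omega : 1 ≤ h)
    have hle : ((2 * h).choose (h + s) : ℝ) ≤ h.centralBinom := by
      exact_mod_cast Nat.choose_le_centralBinom (h + s) h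
    have hp : (0 : ℝ) < h + s + 1 := by positivity
    have e' : ((2 * h).choose (h + (s + 1)) : ℝ) =
        (2 * h).choose (h + s) - (2 * h).choose (h + s) * ((2 * s + 1) / (h + s + 1)) := by
      rw [← add_assoc, eq_sub_iff_add_eq, ← mul_left_inj' hp.ne', add_mul, e]
      field_simp
      ring
    have h2 : ((2 * h).choose (h + s) : ℝ) * ((2 * s + 1) / (h + s + 1)) ≤
        h.centralBinom * ((2 * s + 1) / h) := by
      gcongr
      linarith [(Nat.cast_nonneg s : (0 : ℝ) ≤ s)]
    rw [e']
    push_cast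
    calc (h.centralBinom : ℝ) * (1 - ((s : ℝ) + 1) ^ 2 / h)
        = h.centralBinom * (1 - s ^ 2 / h) - h.centralBinom * ((2 * s + 1) / h) := by
          field_simp; ring
      _ ≤ _ := by linarith

lemma walk_even_ge (h : ℕ) (s : ℤ) (hh : 1 ≤ h) (hs : 2 * s ^ 2 ≤ h) :
    1 / (4 * √h) ≤ walk (2 * h) (2 * s) := by
  wlog h0 : 0 ≤ s generalizing s
  · have := this (-s) (by simpa using hs) (by omega)
    rwa [show 2 * (-s) = -(2 * s) by ring, walk_neg] at this
  obtain ⟨c, rfl⟩ := Int.eq_ofNat_of_zero_le h0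
  have hc : 2 * c ^ 2 ≤ h := by exact_mod_cast hs
  have hch : c ≤ h := by nlinarith
  have e := walk_eq_choose (2 * h) (h + c)
  rw [show (2 * ((h + c : ℕ) : ℤ) - ((2 * h : ℕ) : ℤ)) = 2 * c by push_cast; ring] at e
  rw [e]
  have h1 := choose_add_ge h c hch
  have hpos : (1 : ℝ) ≤ h := by exact_mod_cast hh
  have h2 : (1 / 2 : ℝ) ≤ 1 - c ^ 2 / h := by
    have : (2 * c ^ 2 : ℝ) ≤ h := by exact_mod_cast hc
    have : (c ^ 2 / h : ℝ) ≤ 1 / 2 := by rw [div_le_iff₀ (by positivity)]; linarith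
    linarith
  have h3 : (4 : ℝ) ^ h ≤ h.centralBinom * (2 * √h) := by
    have := le_centralBinom_sq_mul h hh
    refine (sq_le_sq₀ (by positivity) (by positivity)).1 ?_
    rw [← pow_mul, mul_comm h 2, pow_mul, mul_pow, mul_pow, Real.sq_sqrt (by positivity)]
    norm_num
    linarith
  rw [pow_mul, div_le_div_iff₀ (by positivity) (by positivity)]
  norm_num
  calc (4 : ℝ) ^ h ≤ h.centralBinom * (2 * √h) := h3
    _ = (h.centralBinom * (1 / 2)) * (4 * √h) := by ring
    _ ≤ (h.centralBinom * (1 - c ^ 2 / h)) * (4 * √h) := by gcongr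
    _ ≤ _ := by gcongr

/-- Exactly one of `k` and `k + 1` has the parity of `r`. If `r` is odd, undoing one step reduces to
an even number of steps, at the cost of a factor 2. -/
lemma walk_add_walk_ge (r : ℕ) (k : ℤ) (h : (|k| + 2) ^ 2 + 1 ≤ r) :
    1 / (8 * √r) ≤ walk r k + walk r (k + 1) := by
  have hk0 := abs_nonneg k
  have key : ∀ (g : ℕ) (s : ℤ), 2 * g ≤ r → 4 ≤ 2 * g → (r : ℤ) ≤ 2 * g + 1 →
      (2 * s) ^ 2 ≤ (|k| + 2) ^ 2 → 1 / (8 * √r) ≤ walk (2 * g) (2 * s) / 2 := by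
    intro g s h1 h2 h3 h4
    have := walk_even_ge g s (by omega) (by nlinarith)
    have h5 : √(g : ℝ) ≤ √r := Real.sqrt_le_sqrt (by exact_mod_cast (by omega : g ≤ r))
    have h6 : (0 : ℝ) < √g := Real.sqrt_pos.2 (by exact_mod_cast (by omega : 0 < g))
    calc 1 / (8 * √(r : ℝ)) ≤ 1 / (8 * √g) := by gcongr
      _ = 1 / (4 * √g) / 2 := by field_simp; norm_num
      _ ≤ _ := by linarith
  have hr5 : (5 : ℤ) ≤ r := by nlinarith
  have hsq : ∀ s : ℤ, |2 * s| ≤ |k| + 2 → (2 * s) ^ 2 ≤ (|k| + 2) ^ 2 := fun s hs =>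
    sq_le_sq' (by linarith [abs_le.1 hs]) (abs_le.1 hs).2
  have hn1 := walk_nonneg r k
  have hn2 := walk_nonneg r (k + 1)
  have hka : |k| = k ∨ |k| = -k := abs_choice k
  rcases Nat.even_or_odd' r with ⟨g, rfl | rfl⟩
  · rcases Int.even_or_odd' k with ⟨s, hs | hs⟩
    · have := key g s le_rfl (by omega) (by omega) (hsq s (by rw [← hs]; omega))
      rw [← hs] at this
      linarith
    · have := key g (s + 1) le_rfl (by omega) (by omega)
        (hsq _ (by rw [abs_le]; constructor <;> rcases hka with h | h <;> omega))
      rw [show 2 * (s + 1) = k + 1 by omega] at this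
      linarith
  · have hstep : ∀ j, walk (2 * g) (j - 1) / 2 ≤ walk (2 * g + 1) j := by
      intro j
      have := walk_nonneg (2 * g) (j + 1)
      simp only [walk]
      linarith
    rcases Int.even_or_odd' k with ⟨s, hs | hs⟩
    · have h1 := key g s (by omega) (by omega) (by omega) (hsq s (by rw [← hs]; omega))
      have h2 := hstep (k + 1)
      rw [show k + 1 - 1 = 2 * s by omega] at h2
      linarith
    · have h1 := key g s (by omega) (by omega) (by omega)
        (hsq _ (by rw [abs_le]; constructor <;> rcases hka with h | h <;> omega))
      have h2 := hstep k
      rw [show k - 1 = 2 * s by omega] at h2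
      linarith

end Walk

/-! ### Sums of random signs -/

section Signs

variable {n : ℕ}

/-- The sum of the signs of `z` over the coordinates in `F`. -/
def isum (F : Finset (Fin n)) (z : Fin n → Bool) : ℤ := ∑ i ∈ F, if z i then 1 else -1

lemma isum_update_of_notMem {F : Finset (Fin n)} {i : Fin n} (hi : i ∉ F) (z : Fin n → Bool)
    (b : Bool) : isum F (Function.update z i b) = isum F z := by
  refine sum_congr rfl fun j hj => ?_
  rw [Function.update_of_ne (ne_of_mem_of_not_mem hj hi)]

lemma isum_insert {F : Finset (Fin n)} {i : Fin n} (hi : i ∉ F) (z : Fin n → Bool) :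
    isum (insert i F) z = (if z i then 1 else -1) + isum F z :=
  sum_insert hi

lemma isum_congr {F : Finset (Fin n)} {z z' : Fin n → Bool} (h : ∀ i ∈ F, z i = z' i) :
    isum F z = isum F z' :=
  sum_congr rfl fun i hi => by rw [h i hi]

lemma isum_mono (F : Finset (Fin n)) {z z' : Fin n → Bool} (h : z ≤ z') :
    isum F z ≤ isum F z' := by
  refine sum_le_sum fun i _ => ?_
  have := h i
  revert this
  cases z i <;> cases z' i <;> simp

lemma mean_isum_eq (F : Finset (Fin n)) (k : ℤ) :
    mean (fun z => if isum F z = k then 1 else 0) = walk F.card k := by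
  induction F using Finset.induction_on generalizing k with
  | empty =>
    simp only [isum, sum_empty, card_empty, walk, mean_const, eq_comm]
  | insert i F hi ih =>
    rw [mean_split _ i, card_insert_of_notMem hi, walk, ← ih, ← ih]
    simp only [isum_insert hi, isum_update_of_notMem hi, Function.update_self, Bool.false_eq_true,
      if_false, if_true]
    rw [add_comm]
    have e1 : ∀ a : ℤ, 1 + a = k ↔ a = k - 1 := fun a => by omega
    have e2 : ∀ a : ℤ, -1 + a = k ↔ a = k + 1 := fun a => by omega
    simp only [e1, e2]

/-- The expected sign of `s` plus the sum of random signs over `F`. -/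
noncomputable def bias (s : ℤ) (F : Finset (Fin n)) : ℝ :=
  mean fun z => sgn (decide (0 < s + isum F z))

/-- Raising `s` by one changes the sign only where the random sum equals `-s`. -/
lemma bias_add_one (s : ℤ) (F : Finset (Fin n)) :
    bias (s + 1) F = bias s F + 2 * walk F.card (-s) := by
  rw [bias, bias, ← mean_isum_eq, ← mean_const_mul, ← mean_add]
  congr 1
  ext z
  by_cases h1 : 0 < s + isum F z
  · have h2 : 0 < s + 1 + isum F z := by omega
    have h3 : isum F z ≠ -s := by omega
    simp [h1, h2, h3, sgn]
  · by_cases h2 : isum F z = -s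
    · have h3 : 0 < s + 1 + isum F z := by omega
      simp [h2, sgn]
      norm_num
    · have h3 : ¬ 0 < s + 1 + isum F z := by omega
      simp [h1, h2, h3, sgn]

lemma mean_not (φ : (Fin n → Bool) → ℝ) : mean (fun z => φ fun i => !(z i)) = mean φ := by
  unfold mean
  congr 1
  have : Function.Involutive (fun (z : Fin n → Bool) i => !(z i)) := fun z => by simp
  exact Equiv.sum_comp this.toPerm φ

lemma isum_not (F : Finset (Fin n)) (z : Fin n → Bool) :
    isum F (fun i => !(z i)) = -isum F z := by
  rw [isum, isum, ← sum_neg_distrib]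
  refine sum_congr rfl fun i _ => ?_
  cases z i <;> simp

/-- Flipping all coordinates cancels everything except ties, which count as negative. -/
lemma bias_zero (F : Finset (Fin n)) : bias 0 F = -walk F.card 0 := by
  have h1 : bias 0 F + bias 0 F = (-2) * walk F.card 0 := by
    nth_rewrite 2 [bias]
    rw [← mean_not, bias, ← mean_add, ← mean_isum_eq, ← mean_const_mul]
    congr 1
    ext z
    rw [isum_not]
    rcases lt_trichotomy (isum F z) 0 with h | h | h
    · have h2 : ¬ 0 < isum F z := by omega
      simp [h, h2, h.ne, sgn]
    · simp [h, sgn]; norm_num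
    · have h2 : ¬ isum F z < 0 := by omega
      simp [h, h2, h.ne', sgn]
  linarith

/-- Start from `bias_zero` and move `|s|` steps by `bias_add_one`; each step costs at most twice the
largest point probability of the walk. -/
lemma abs_bias_le (s : ℤ) (F : Finset (Fin n)) :
    |bias s F| ≤ (2 * |(s : ℝ)| + 1) / √(F.card + 1) := by
  set W := 1 / √((F.card : ℝ) + 1) with hW
  have hw : ∀ k, 0 ≤ walk F.card k ∧ walk F.card k ≤ W := fun k => ⟨walk_nonneg _ _, walk_le _ _⟩
  have h1 : ∀ k : ℕ, |bias (k : ℤ) F| ≤ (2 * k + 1) * W := by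
    intro k
    induction k with
    | zero =>
      have := hw 0
      simp only [Nat.cast_zero, bias_zero]
      rw [abs_neg, abs_of_nonneg this.1]
      linarith [this.2]
    | succ k ih =>
      have h2 := hw (-k)
      push_cast
      rw [bias_add_one, abs_le] at *
      constructor <;> linarith [ih.1, ih.2]
  have h2 : ∀ k : ℕ, |bias (-(k : ℤ)) F| ≤ (2 * k + 1) * W := by
    intro k
    induction k with
    | zero => simpa using h1 0
    | succ k ih =>
      have h2 := hw (k + 1)
      have h3 := bias_add_one (-(k : ℤ) - 1) F
      rw [show -(k : ℤ) - 1 + 1 = -k by ring, show -(-(k : ℤ) - 1) = k + 1 by ring] at h3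
      rw [abs_le] at ih ⊢
      push_cast
      rw [show -((k : ℤ) + 1) = -k - 1 by ring]
      constructor <;> linarith [ih.1, ih.2]
  rw [div_eq_mul_one_div, ← hW]
  rcases Int.eq_nat_or_neg s with ⟨k, rfl | rfl⟩
  · simpa using h1 k
  · simpa using h2 k

lemma abs_bias_le_one (s : ℤ) (F : Finset (Fin n)) : |bias s F| ≤ 1 := by
  refine (abs_mean_le _).trans ?_
  refine (mean_mono (ψ := fun _ => 1) fun z => ?_).trans (mean_const 1).le
  unfold sgn
  split_ifs <;> norm_num

end Signs

/-! ### The selector function -/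

/-- A system of pairwise disjoint sets of variables: `N * u` tribes of width `w`, and `N` blocks of
size `m`; the tribe `(a, j)` points to the block `a`. -/
structure Layout (n N u w m : ℕ) where
  X : Fin N × Fin u → Finset (Fin n)
  Y : Fin N → Finset (Fin n)
  card_X : ∀ τ, (X τ).card = w
  card_Y : ∀ a, (Y a).card = m
  disjoint_X : ∀ τ τ', τ ≠ τ' → Disjoint (X τ) (X τ')
  disjoint_Y : ∀ a a', a ≠ a' → Disjoint (Y a) (Y a')
  disjoint_XY : ∀ τ a, Disjoint (X τ) (Y a)

lemma exists_layout {n N u w m : ℕ} (h : N * u * w + N * m ≤ n) :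
    Nonempty (Layout n N u w m) := by
  have hc : Fintype.card (((Fin N × Fin u) × Fin w) ⊕ (Fin N × Fin m)) ≤ Fintype.card (Fin n) := by
    simpa using h
  obtain ⟨e⟩ := Function.Embedding.nonempty_of_card_le hc
  have he := e.injective
  refine ⟨⟨fun τ => univ.image fun j => e (.inl (τ, j)), fun a => univ.image fun j => e (.inr (a, j)),
    ?_, ?_, ?_, ?_, ?_⟩⟩
  · intro τ
    rw [card_image_of_injective _ fun j j' h => by simpa using he h]
    simp
  · intro τ
    rw [card_image_of_injective _ fun j j' h => by simpa using he h]
    simp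
  · intro τ τ' hne
    rw [disjoint_left]
    simp only [mem_image, mem_univ, true_and, not_exists, forall_exists_index]
    rintro _ j rfl j' h
    have := he h
    simp only [Sum.inl.injEq, Prod.mk.injEq] at this
    exact hne this.1.symm
  · intro τ τ' hne
    rw [disjoint_left]
    simp only [mem_image, mem_univ, true_and, not_exists, forall_exists_index]
    rintro _ j rfl j' h
    have := he h
    simp only [Sum.inr.injEq, Prod.mk.injEq] at this
    exact hne this.1.symm
  · intro τ τ'
    rw [disjoint_left]
    simp only [mem_image, mem_univ, true_and, not_exists, forall_exists_index]
    rintro _ j rfl j' h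
    have := he h
    simp at this

/-! ### Restrictions as overwriting of coordinates -/

/-- Overwriting the coordinates in `Q` by those of `v`. -/
def overwrite {n : ℕ} (Q : Finset (Fin n)) (v z : Fin n → Bool) : Fin n → Bool :=
  fun i => if i ∈ Q then v i else z i

section Overwrite

variable {n : ℕ}

lemma overwrite_update {Q : Finset (Fin n)} {v : Fin n → Bool} {i : Fin n} (hi : i ∉ Q) (b : Bool)
    (z : Fin n → Bool) :
    overwrite Q v (Function.update z i b) = overwrite (insert i Q) (Function.update v i b) z := by
  ext j
  by_cases hj : j = i
  · subst hj; simp [overwrite, hi]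
  · simp [overwrite, hj]

lemma restrict_overwrite {Q : Finset (Fin n)} {v : Fin n → Bool} {i : Fin n} (hi : i ∉ Q)
    (f : BoolFun n) (b : Bool) :
    restrict (fun z => f (overwrite Q v z)) i b =
      fun z => f (overwrite (insert i Q) (Function.update v i b) z) := by
  ext z
  simp only [restrict]
  rw [overwrite_update hi]

lemma isum_overwrite (F Q : Finset (Fin n)) (v z : Fin n → Bool) :
    isum F (overwrite Q v z) = isum (F ∩ Q) v + isum (F \ Q) z := by
  have h1 : isum F (overwrite Q v z) =
      isum (F ∩ Q) (overwrite Q v z) + isum (F \ Q) (overwrite Q v z) := by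
    rw [isum, isum, isum, add_comm, ← sum_sdiff (inter_subset_left (s₁ := F) (s₂ := Q)),
      sdiff_inter_self_left]
  rw [h1]
  congr 1
  · exact isum_congr fun i hi => by simp [overwrite, (mem_inter.1 hi).2]
  · exact isum_congr fun i hi => by simp [overwrite, (mem_sdiff.1 hi).2]

lemma exists_tree_of_overwrite (s : Finset (Fin n)) (M : ℕ) :
    ∀ f : BoolFun n, (∀ v, ∃ T : DecisionTree n, T.eval = (fun z => f (overwrite s v z)) ∧
      T.size ≤ M) → ∃ T : DecisionTree n, T.eval = f ∧ T.size ≤ 2 ^ s.card * M := by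
  induction s using Finset.induction_on with
  | empty =>
    intro f hf
    have h : ∀ v z : Fin n → Bool, overwrite ∅ v z = z := fun v z => by ext i; simp [overwrite]
    simpa [h] using hf fun _ => false
  | insert i s hi ih =>
    intro f hf
    have hr : ∀ b, ∃ T : DecisionTree n, T.eval = restrict f i b ∧ T.size ≤ 2 ^ s.card * M := by
      intro b
      refine ih _ fun v => ?_
      obtain ⟨T, hT, hs⟩ := hf (Function.update v i b)
      refine ⟨T, ?_, hs⟩
      rw [hT]
      ext z
      simp only [restrict]
      congr 1
      ext j
      by_cases hj : j = i
      · subst hj; simp [overwrite]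
      · simp [overwrite, hj]
    obtain ⟨T₀, h₀, s₀⟩ := hr false
    obtain ⟨T₁, h₁, s₁⟩ := hr true
    refine ⟨.node i T₀ T₁, ?_, ?_⟩
    · ext z
      simp only [QueryTree.eval, h₀, h₁, restrict]
      cases hz : z i
      · have : Function.update z i false = z := by rw [← hz]; simp
        simp [this]
      · have : Function.update z i true = z := by rw [← hz]; simp
        simp [this]
    · rw [card_insert_of_notMem hi, pow_succ]
      simp only [QueryTree.size]
      linarith

end Overwrite

namespace Layout

variable {n N u w m : ℕ} (L : Layout n N u w m)

/-- All variables of the tribe are `1`. -/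
def Sat (τ : Fin N × Fin u) (z : Fin n → Bool) : Prop := ∀ i ∈ L.X τ, z i = true

/-- The majority of the variables of the block are `1`. -/
def Maj (a : Fin N) (z : Fin n → Bool) : Prop := 0 < isum (L.Y a) z

open Classical in
/-- The selector function: `0` if no tribe is satisfied, the majority of the block that the tribe
points to if exactly one tribe is satisfied, and `1` if at least two tribes are satisfied. -/
noncomputable def sel : BoolFun n := fun z =>
  decide (∃ τ, L.Sat τ z ∧ (L.Maj τ.1 z ∨ ∃ τ', τ' ≠ τ ∧ L.Sat τ' z))

lemma sel_eq_true {z : Fin n → Bool} :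
    L.sel z = true ↔ ∃ τ, L.Sat τ z ∧ (L.Maj τ.1 z ∨ ∃ τ', τ' ≠ τ ∧ L.Sat τ' z) := by
  simp [sel]

lemma sel_congr {z z' : Fin n → Bool} (hs : ∀ τ, L.Sat τ z ↔ L.Sat τ z')
    (hm : ∀ a, L.Maj a z ↔ L.Maj a z') : L.sel z = L.sel z' := by
  rw [Bool.eq_iff_iff, sel_eq_true, sel_eq_true]
  simp only [hs, hm]

lemma monotone_sel : Monotone L.sel := by
  intro x z hxz
  have hs : ∀ τ, L.Sat τ x → L.Sat τ z := fun τ h i hi => by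
    have := hxz i
    rw [h i hi] at this
    exact Bool.eq_true_of_true_le this
  have hm : ∀ a, L.Maj a x → L.Maj a z := fun a h => h.trans_le (isum_mono _ hxz)
  rw [Bool.le_iff_imp, sel_eq_true, sel_eq_true]
  rintro ⟨τ, h1, h2 | ⟨τ', h2, h3⟩⟩
  · exact ⟨τ, hs _ h1, .inl (hm _ h2)⟩
  · exact ⟨τ, hs _ h1, .inr ⟨τ', h2, hs _ h3⟩⟩

open Classical in
/-- The indicator of the event that the tribe is satisfied. -/
noncomputable def ind (τ : Fin N × Fin u) (z : Fin n → Bool) : ℝ := if L.Sat τ z then 1 else 0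

/-- The indicator of the event that no tribe is satisfied. -/
noncomputable def indNone (z : Fin n → Bool) : ℝ := ∏ τ, (1 - L.ind τ z)

/-- The indicator of the event that the tribe is the only satisfied one. -/
noncomputable def indOnly (τ : Fin N × Fin u) (z : Fin n → Bool) : ℝ :=
  L.ind τ z * ∏ τ' ∈ univ.erase τ, (1 - L.ind τ' z)

lemma ind_of_sat {τ : Fin N × Fin u} {z : Fin n → Bool} (h : L.Sat τ z) : L.ind τ z = 1 := by
  simp [ind, h]

lemma ind_of_not_sat {τ : Fin N × Fin u} {z : Fin n → Bool} (h : ¬ L.Sat τ z) :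
    L.ind τ z = 0 := by
  simp [ind, h]

/-- Splitting by the number of satisfied tribes (none, one, at least two) makes the value linear in
products of independent factors, ready for taking means. -/
lemma sgn_sel (z : Fin n → Bool) : sgn (L.sel z) =
    1 - 2 * L.indNone z - ∑ τ, L.indOnly τ z +
      ∑ τ, L.indOnly τ z * sgn (decide (0 < isum (L.Y τ.1) z)) := by
  by_cases h : ∃ τ, L.Sat τ z
  · obtain ⟨τ, hτ⟩ := h
    have hnone : L.indNone z = 0 := by
      refine prod_eq_zero (mem_univ τ) ?_
      simp [L.ind_of_sat hτ]
    by_cases h2 : ∃ τ', τ' ≠ τ ∧ L.Sat τ' z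
    · obtain ⟨τ', hne, hτ'⟩ := h2
      have honly : ∀ σ, L.indOnly σ z = 0 := by
        intro σ
        refine mul_eq_zero_of_right _ ?_
        by_cases hσ : σ = τ
        · exact prod_eq_zero (mem_erase.2 ⟨hσ ▸ hne, mem_univ τ'⟩) (by simp [L.ind_of_sat hτ'])
        · exact prod_eq_zero (mem_erase.2 ⟨Ne.symm hσ, mem_univ τ⟩) (by simp [L.ind_of_sat hτ])
      have hsel : L.sel z = true := L.sel_eq_true.2 ⟨τ, hτ, .inr ⟨τ', hne, hτ'⟩⟩
      simp [hnone, honly, hsel, sgn]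
    · push Not at h2
      have honly : ∀ σ ≠ τ, L.indOnly σ z = 0 := fun σ hσ =>
        mul_eq_zero_of_left (L.ind_of_not_sat (h2 σ hσ)) _
      have hself : L.indOnly τ z = 1 := by
        rw [indOnly, L.ind_of_sat hτ, one_mul]
        refine prod_eq_one fun σ hσ => ?_
        rw [L.ind_of_not_sat (h2 σ (mem_erase.1 hσ).1)]
        simp
      rw [hnone, sum_eq_single τ (fun σ _ hσ => honly σ hσ) (by simp),
        sum_eq_single τ (fun σ _ hσ => by rw [honly σ hσ, zero_mul]) (by simp), hself]
      have hsel : L.sel z = decide (0 < isum (L.Y τ.1) z) := by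
        rw [Bool.eq_iff_iff, sel_eq_true, decide_eq_true_iff]
        constructor
        · rintro ⟨σ, h1, h3⟩
          have hσ : σ = τ := by
            by_contra hc
            exact h2 σ hc h1
          subst hσ
          rcases h3 with h3 | ⟨σ', h4, h5⟩
          · exact h3
          · exact absurd h5 (h2 σ' h4)
        · exact fun h => ⟨τ, hτ, .inl h⟩
      rw [hsel]
      ring
  · push Not at h
    have hnone : L.indNone z = 1 := prod_eq_one fun τ _ => by simp [L.ind_of_not_sat (h τ)]
    have honly : ∀ σ, L.indOnly σ z = 0 := fun σ => mul_eq_zero_of_left (L.ind_of_not_sat (h σ)) _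
    have hsel : L.sel z = false := by
      rw [← Bool.not_eq_true, sel_eq_true]
      rintro ⟨τ, hτ, -⟩
      exact h τ hτ
    simp [hnone, honly, hsel, sgn]
    norm_num

/-! ### Expectation and influences of the restricted selector function -/

lemma dependsOn_ind (τ : Fin N × Fin u) : DependsOn (L.ind τ) (L.X τ : Set (Fin n)) := by
  intro x z h
  have : L.Sat τ x ↔ L.Sat τ z := by
    refine forall₂_congr fun i hi => ?_
    rw [h i hi]
  simp only [ind]
  split_ifs <;> tauto

lemma mean_all_true (F : Finset (Fin n)) (p : (Fin n → Bool) → Prop) [DecidablePred p]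
    (hp : ∀ z, p z ↔ ∀ i ∈ F, z i = true) :
    mean (fun z => if p z then 1 else 0) = (1 / 2) ^ F.card := by
  induction F using Finset.induction_on generalizing p with
  | empty => simp [hp, mean_const]
  | insert i F hi ih =>
    rw [mean_split _ i, card_insert_of_notMem hi]
    have hu : ∀ z b, (∀ j ∈ F, Function.update z i b j = true) ↔ ∀ j ∈ F, z j = true := by
      intro z b
      refine forall₂_congr fun j hj => ?_
      rw [Function.update_of_ne (ne_of_mem_of_not_mem hj hi)]
    have h0 : ∀ z, ¬ p (Function.update z i false) := fun z => by simp [hp]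
    have h1 : ∀ z, p (Function.update z i true) ↔ ∀ j ∈ F, z j = true := fun z => by
      simp [hp, hu]
    rw [ih (fun z => p (Function.update z i true)) h1]
    simp only [h0, if_false, mean_const]
    ring

lemma mean_ind (τ : Fin N × Fin u) : mean (L.ind τ) = (1 / 2) ^ w := by
  classical
  have := mean_all_true (L.X τ) (L.Sat τ) fun z => Iff.rfl
  rw [L.card_X τ] at this
  rw [← this]
  congr! 1

lemma dependsOn_prod (s : Finset (Fin N × Fin u)) :
    DependsOn (fun z => ∏ τ ∈ s, (1 - L.ind τ z)) ((s.biUnion L.X : Finset (Fin n)) : Set (Fin n)) := by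
  intro x z h
  refine prod_congr rfl fun τ hτ => ?_
  rw [L.dependsOn_ind τ fun i hi => h i (mem_coe.2 (mem_biUnion.2 ⟨τ, hτ, hi⟩))]

lemma disjoint_biUnion {s : Finset (Fin N × Fin u)} {τ : Fin N × Fin u} (h : τ ∉ s) :
    Disjoint (L.X τ : Set (Fin n)) ((s.biUnion L.X : Finset (Fin n)) : Set (Fin n)) := by
  rw [disjoint_coe, disjoint_biUnion_right]
  exact fun σ hσ => L.disjoint_X _ _ fun he => h (he ▸ hσ)

lemma mean_prod (s : Finset (Fin N × Fin u)) :
    mean (fun z => ∏ τ ∈ s, (1 - L.ind τ z)) = (1 - (1 / 2) ^ w) ^ s.card := by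
  classical
  induction s using Finset.induction_on with
  | empty => simp [mean_const]
  | insert τ s hτ ih =>
    simp only [prod_insert hτ]
    rw [mean_mul (φ := fun z => 1 - L.ind τ z) (s := L.X τ) (t := (s.biUnion L.X : Finset (Fin n))) ?_
      (L.dependsOn_prod s) (L.disjoint_biUnion hτ), ih, mean_sub, mean_const, mean_ind,
      card_insert_of_notMem hτ, pow_succ]
    · ring
    · intro x z h
      simp only [L.dependsOn_ind τ h]

lemma mean_indNone : mean L.indNone = (1 - (1 / 2) ^ w) ^ (N * u) := by
  have := L.mean_prod univ
  rw [card_univ, Fintype.card_prod, Fintype.card_fin, Fintype.card_fin] at this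
  exact this

lemma mean_indOnly_mul (τ : Fin N × Fin u) {h : (Fin n → Bool) → ℝ} {F : Finset (Fin n)}
    (hF : F ⊆ univ.biUnion L.Y) (hh : DependsOn h (F : Set (Fin n))) :
    mean (fun z => L.indOnly τ z * h z) =
      (1 / 2) ^ w * (1 - (1 / 2) ^ w) ^ (N * u - 1) * mean h := by
  have hd1 : DependsOn (L.indOnly τ) ((univ.biUnion L.X : Finset (Fin n)) : Set (Fin n)) := by
    intro x z hxz
    have : ∀ σ, L.ind σ x = L.ind σ z := fun σ => L.dependsOn_ind σ fun i hi =>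
      hxz i (mem_coe.2 (mem_biUnion.2 ⟨σ, mem_univ _, hi⟩))
    simp only [indOnly, this]
  have hdisj : Disjoint ((univ.biUnion L.X : Finset (Fin n)) : Set (Fin n)) (F : Set (Fin n)) := by
    rw [disjoint_coe]
    refine disjoint_of_subset_right hF ?_
    rw [disjoint_biUnion_left]
    intro σ _
    rw [disjoint_biUnion_right]
    exact fun a _ => L.disjoint_XY σ a
  rw [mean_mul hd1 hh hdisj]
  congr 1
  have hτ : τ ∉ univ.erase τ := by simp
  unfold indOnly
  rw [mean_mul (L.dependsOn_ind τ) (L.dependsOn_prod _) (L.disjoint_biUnion hτ), L.mean_ind,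
    L.mean_prod, card_erase_of_mem (mem_univ _)]
  simp

lemma sat_overwrite {Q : Finset (Fin n)} (hQ : Q ⊆ univ.biUnion L.Y) (v z : Fin n → Bool)
    (τ : Fin N × Fin u) : L.Sat τ (overwrite Q v z) ↔ L.Sat τ z := by
  refine forall₂_congr fun i hi => ?_
  have : i ∉ Q := by
    intro hiQ
    obtain ⟨a, -, ha⟩ := mem_biUnion.1 (hQ hiQ)
    exact disjoint_left.1 (L.disjoint_XY τ a) hi ha
  simp [overwrite, this]

lemma ind_overwrite {Q : Finset (Fin n)} (hQ : Q ⊆ univ.biUnion L.Y) (v z : Fin n → Bool)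
    (τ : Fin N × Fin u) : L.ind τ (overwrite Q v z) = L.ind τ z := by
  by_cases h : L.Sat τ z
  · rw [L.ind_of_sat h, L.ind_of_sat ((L.sat_overwrite hQ v z τ).2 h)]
  · rw [L.ind_of_not_sat h, L.ind_of_not_sat (mt (L.sat_overwrite hQ v z τ).1 h)]

/-- The sum of the signs of the queried variables of a block. -/
def blockSum (Q : Finset (Fin n)) (v : Fin n → Bool) (a : Fin N) : ℤ := isum (L.Y a ∩ Q) v

/-- The probability that a given tribe is the only satisfied one. -/
noncomputable def onlyProb (_ : Layout n N u w m) : ℝ :=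
  (1 / 2) ^ w * (1 - (1 / 2) ^ w) ^ (N * u - 1)

/-- Only block variables are fixed, so the law of the tribes is unchanged and stays independent of
the blocks. Each block is the target of `u` tribes. -/
lemma mean_sgn_sel {Q : Finset (Fin n)} (hQ : Q ⊆ univ.biUnion L.Y) (v : Fin n → Bool) :
    mean (fun z => sgn (L.sel (overwrite Q v z))) =
      1 - 2 * (1 - (1 / 2) ^ w) ^ (N * u) - N * u * L.onlyProb +
        u * L.onlyProb * ∑ a, bias (L.blockSum Q v a) (L.Y a \ Q) := by
  have hb : ∀ (F : Finset (Fin n)) (s : ℤ),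
      DependsOn (fun z : Fin n → Bool => sgn (decide (0 < s + isum F z))) (F : Set (Fin n)) := by
    intro F s x z h
    simp only [isum_congr h]
  have hone : ∀ τ, mean (L.indOnly τ) = L.onlyProb := by
    intro τ
    have := L.mean_indOnly_mul τ (h := fun _ => 1) (F := ∅) (by simp) (fun x z _ => rfl)
    simpa [mean_const, onlyProb] using this
  simp only [sgn_sel, indNone, indOnly, L.ind_overwrite hQ, isum_overwrite]
  rw [mean_add, mean_sub, mean_sub, mean_const, mean_const_mul, mean_sum, mean_sum]
  have e1 : mean (fun z => ∏ τ, (1 - L.ind τ z)) = (1 - (1 / 2) ^ w) ^ (N * u) := L.mean_indNone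
  have e2 : ∀ τ, mean (fun z => L.ind τ z * ∏ τ' ∈ univ.erase τ, (1 - L.ind τ' z)) =
      L.onlyProb := hone
  have e3 : ∀ τ : Fin N × Fin u, mean (fun z => (L.ind τ z * ∏ τ' ∈ univ.erase τ, (1 - L.ind τ' z)) *
      sgn (decide (0 < isum (L.Y τ.1 ∩ Q) v + isum (L.Y τ.1 \ Q) z))) =
      L.onlyProb * bias (L.blockSum Q v τ.1) (L.Y τ.1 \ Q) := by
    intro τ
    refine L.mean_indOnly_mul τ ?_ (hb _ _)
    exact fun i hi => mem_biUnion.2 ⟨τ.1, mem_univ _, (mem_sdiff.1 hi).1⟩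
  simp only [e1, e2, e3]
  have e4 : ∑ τ : Fin N × Fin u, bias (L.blockSum Q v τ.1) (L.Y τ.1 \ Q) =
      u * ∑ a, bias (L.blockSum Q v a) (L.Y a \ Q) := by
    rw [Fintype.sum_prod_type]
    simp only [sum_const, card_univ, Fintype.card_fin, nsmul_eq_mul, ← mul_sum]
  rw [← mul_sum, e4]
  simp only [sum_const, card_univ, Fintype.card_prod, Fintype.card_fin, nsmul_eq_mul]
  push_cast
  ring

/-- Such a variable can matter only if the other `w - 1` variables of its tribe are all 1. -/
lemma influence_tribe_le {Q : Finset (Fin n)} (hQ : Q ⊆ univ.biUnion L.Y) (v : Fin n → Bool)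
    {τ : Fin N × Fin u} {i : Fin n} (hi : i ∈ L.X τ) :
    influence (fun z => L.sel (overwrite Q v z)) i ≤ 2 * (1 / 2) ^ w := by
  have hiY : ∀ a, i ∉ L.Y a := fun a ha => disjoint_left.1 (L.disjoint_XY τ a) hi ha
  have hiQ : i ∉ Q := by
    intro h
    obtain ⟨a, -, ha⟩ := mem_biUnion.1 (hQ h)
    exact hiY a ha
  have hiX : ∀ σ, σ ≠ τ → i ∉ L.X σ := fun σ hσ h => disjoint_left.1 (L.disjoint_X σ τ hσ) h hi
  have hw : ((L.X τ).erase i).card + 1 = w := by rw [card_erase_add_one hi, L.card_X]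
  rw [influence_eq_mean]
  have : (2 * (1 / 2) ^ w : ℝ) = (1 / 2) ^ ((L.X τ).erase i).card := by
    calc (2 * (1 / 2) ^ w : ℝ) = 2 * (1 / 2) ^ (((L.X τ).erase i).card + 1) := by rw [hw]
      _ = _ := by rw [pow_succ]; ring
  rw [this, ← mean_all_true _ (fun z => ∀ j ∈ (L.X τ).erase i, z j = true) fun z => Iff.rfl]
  refine mean_mono fun z => ?_
  split_ifs with h1 h2 h2 <;> try norm_num
  push Not at h2
  obtain ⟨j, hj, hzj⟩ := h2
  refine absurd (L.sel_congr (fun σ => ?_) (fun a => ?_)) h1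
  · rw [L.sat_overwrite hQ, L.sat_overwrite hQ]
    by_cases hσ : σ = τ
    · subst hσ
      have hne := (mem_erase.1 hj).1
      have h3 : ¬ L.Sat σ z := fun h => hzj (h j (mem_erase.1 hj).2)
      have h4 : ¬ L.Sat σ (flipAt i z) := fun h => hzj (by
        have := h j (mem_erase.1 hj).2
        rwa [flipAt, Function.update_of_ne hne] at this)
      simp [h3, h4]
    · refine forall₂_congr fun k hk => ?_
      rw [flipAt, Function.update_of_ne (ne_of_mem_of_not_mem hk (hiX σ hσ))]
  · unfold Maj
    rw [isum_overwrite, isum_overwrite, flipAt, isum_update_of_notMem]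
    exact fun h => hiY a (mem_sdiff.1 h).1

lemma influence_eq_zero {Q : Finset (Fin n)} (hQ : Q ⊆ univ.biUnion L.Y) (v : Fin n → Bool)
    {i : Fin n} (hX : ∀ τ, i ∉ L.X τ) (hY : ∀ a, i ∉ L.Y a \ Q) :
    influence (fun z => L.sel (overwrite Q v z)) i = 0 := by
  apply influence_eq_zero_of_restrict_eq
  intro b
  ext z
  refine L.sel_congr (fun σ => ?_) fun a => ?_
  · rw [L.sat_overwrite hQ, L.sat_overwrite hQ]
    refine forall₂_congr fun k hk => ?_
    rw [Function.update_of_ne (ne_of_mem_of_not_mem hk (hX σ))]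
  · unfold Maj
    rw [isum_overwrite, isum_overwrite, isum_update_of_notMem (hY a)]

lemma blockSum_insert {Q : Finset (Fin n)} (v : Fin n → Bool) {i : Fin n} {a : Fin N}
    (ha : i ∈ L.Y a) (hi : i ∉ Q) (b : Bool) (a' : Fin N) :
    L.blockSum (insert i Q) (Function.update v i b) a' =
      L.blockSum Q v a' + if a' = a then (if b then 1 else -1) else 0 := by
  have hiQ : ∀ a', i ∉ L.Y a' ∩ Q := fun a' h => hi (mem_inter.1 h).2
  unfold blockSum
  by_cases h : a' = a
  · subst h
    rw [if_pos rfl, inter_insert_of_mem ha, isum_insert (hiQ _), isum_update_of_notMem (hiQ _),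
      Function.update_self, add_comm]
  · have : i ∉ L.Y a' := fun h' => disjoint_left.1 (L.disjoint_Y _ _ h) h' ha
    rw [if_neg h, inter_insert_of_notMem this, isum_update_of_notMem (hiQ _), add_zero]

lemma sum_blockSum_sq_insert {Q : Finset (Fin n)} (v : Fin n → Bool) {i : Fin n} {a : Fin N}
    (ha : i ∈ L.Y a) (hi : i ∉ Q) (b : Bool) :
    ∑ a', (L.blockSum (insert i Q) (Function.update v i b) a' : ℝ) ^ 2 =
      ∑ a', (L.blockSum Q v a' : ℝ) ^ 2 + 2 * sgn b * L.blockSum Q v a + 1 := by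
  have : ∀ a', (L.blockSum (insert i Q) (Function.update v i b) a' : ℝ) ^ 2 =
      (L.blockSum Q v a' : ℝ) ^ 2 +
        if a' = a then 2 * sgn b * L.blockSum Q v a + 1 else 0 := by
    intro a'
    rw [L.blockSum_insert v ha hi]
    by_cases h : a' = a
    · subst h
      cases b <;> simp [sgn] <;> ring
    · simp [h]
  simp only [this]
  rw [sum_add_distrib, sum_ite_eq' univ a]
  simp [add_assoc]

/-- The influence is at least half the jump of the expectation. In `mean_sgn_sel` only the bias of
the block `a` changes, by two unit steps of `bias_add_one`. -/
lemma influence_block_ge {Q : Finset (Fin n)} (hQ : Q ⊆ univ.biUnion L.Y) (v : Fin n → Bool)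
    {i : Fin n} {a : Fin N} (ha : i ∈ L.Y a) (hi : i ∉ Q) :
    u * L.onlyProb * (walk ((L.Y a \ Q).card - 1) (-L.blockSum Q v a) +
      walk ((L.Y a \ Q).card - 1) (-L.blockSum Q v a + 1)) ≤
      influence (fun z => L.sel (overwrite Q v z)) i := by
  have hQ' : insert i Q ⊆ univ.biUnion L.Y :=
    insert_subset (mem_biUnion.2 ⟨a, mem_univ _, ha⟩) hQ
  have hge : (mean (fun z => sgn (L.sel (overwrite (insert i Q) (Function.update v i true) z))) -
      mean (fun z => sgn (L.sel (overwrite (insert i Q) (Function.update v i false) z)))) / 2 ≤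
      influence (fun z => L.sel (overwrite Q v z)) i := by
    rw [influence_eq_error, restrict_overwrite hi, restrict_overwrite hi, error_eq_mean,
      div_eq_inv_mul, ← mean_sub, ← mean_const_mul]
    refine mean_mono fun z => ?_
    cases L.sel (overwrite (insert i Q) (Function.update v i true) z) <;>
      cases L.sel (overwrite (insert i Q) (Function.update v i false) z) <;> norm_num [sgn]
  refine le_trans (le_of_eq ?_) hge
  rw [L.mean_sgn_sel hQ', L.mean_sgn_sel hQ', add_sub_add_left_eq_sub, ← mul_sub,
    ← sum_sub_distrib, sum_eq_single a]
  · have hsd : L.Y a \ insert i Q = (L.Y a \ Q).erase i := by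
      ext j; simp only [mem_sdiff, mem_insert, mem_erase]; tauto
    rw [L.blockSum_insert v ha hi, L.blockSum_insert v ha hi, hsd]
    have hmem : i ∈ L.Y a \ Q := mem_sdiff.2 ⟨ha, hi⟩
    have h1 := bias_add_one (L.blockSum Q v a) ((L.Y a \ Q).erase i)
    have h2 := bias_add_one (L.blockSum Q v a - 1) ((L.Y a \ Q).erase i)
    rw [card_erase_of_mem hmem] at h1 h2
    rw [show L.blockSum Q v a - 1 + 1 = L.blockSum Q v a by ring,
      show -(L.blockSum Q v a - 1) = -L.blockSum Q v a + 1 by ring] at h2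
    simp only [if_true, Bool.false_eq_true, if_false]
    rw [h1, ← sub_eq_add_neg, h2]
    ring
  · intro a' _ hne
    have : i ∉ L.Y a' := fun h => disjoint_left.1 (L.disjoint_Y _ _ hne) h ha
    have hsd : ∀ b, L.blockSum (insert i Q) (Function.update v i b) a' = L.blockSum Q v a' := by
      intro b
      rw [L.blockSum_insert v ha hi, if_neg hne, add_zero]
    rw [hsd, hsd, sub_self]
  · simp

/-! ### Optimal size of the selector function -/

/-- Once the tribes are known, either exactly one is satisfied and only its block matters, or the
value is decided and any block serves; block 0 is then the default. -/
lemma exists_dependsOn_block (hN : 1 ≤ N) (v : Fin n → Bool) :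
    ∃ a, DependsOn (fun z => L.sel (overwrite (univ.biUnion L.X) v z)) (L.Y a : Set (Fin n)) := by
  have hs : ∀ z τ, L.Sat τ (overwrite (univ.biUnion L.X) v z) ↔ L.Sat τ v := by
    intro z τ
    refine forall₂_congr fun i hi => ?_
    have : i ∈ univ.biUnion L.X := mem_biUnion.2 ⟨τ, mem_univ _, hi⟩
    rw [overwrite, if_pos this]
  have hm : ∀ a x z, (∀ i ∈ L.Y a, x i = z i) →
      (L.Maj a (overwrite (univ.biUnion L.X) v x) ↔ L.Maj a (overwrite (univ.biUnion L.X) v z)) := by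
    intro a x z h
    unfold Maj
    rw [isum_congr (z := overwrite (univ.biUnion L.X) v x)]
    intro i hi
    simp only [overwrite, h i hi]
  by_cases h : ∃ τ, L.Sat τ v ∧ ∀ τ', τ' ≠ τ → ¬ L.Sat τ' v
  · obtain ⟨τ, -, hτ⟩ := h
    refine ⟨τ.1, fun x z hxz => ?_⟩
    rw [Bool.eq_iff_iff, sel_eq_true, sel_eq_true]
    simp only [hs]
    refine exists_congr fun σ => and_congr_right fun hσ => ?_
    have : σ = τ := by
      by_contra hc
      exact hτ σ hc hσ
    subst this
    rw [hm _ _ _ hxz]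
  · push Not at h
    refine ⟨⟨0, hN⟩, fun x z hxz => ?_⟩
    rw [Bool.eq_iff_iff, sel_eq_true, sel_eq_true]
    simp only [hs]
    refine exists_congr fun σ => and_congr_right fun hσ => ?_
    obtain ⟨σ', h1, h2⟩ := h σ hσ
    have : ∃ τ', τ' ≠ σ ∧ L.Sat τ' v := ⟨σ', h1, h2⟩
    simp [this]

lemma dtSize_sel_le (hN : 1 ≤ N) : dtSize L.sel ≤ 2 ^ (N * u * w + m) := by
  obtain ⟨T, hT, hs⟩ := exists_tree_of_overwrite (univ.biUnion L.X) (2 ^ m) L.sel fun v => by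
    obtain ⟨a, ha⟩ := L.exists_dependsOn_block hN v
    simpa only [L.card_Y a] using exists_tree_of_dependsOn _ _ ha
  refine (dtSize_le hT).trans (hs.trans ?_)
  rw [pow_add]
  gcongr
  · norm_num
  · refine card_biUnion_le.trans ?_
    simp [L.card_X]

end Layout

/-- A tree that computes a threshold of the variables in `F` on a subcube has to query many of these
variables on every path. -/
lemma two_pow_le_size_of_threshold {n : ℕ} (T : DecisionTree n) :
    ∀ (h : ℕ) (F : Finset (Fin n)) (s : ℤ) (v : Fin n → Bool),
      (∀ z, (∀ i ∉ F, z i = v i) → (T.eval z = true ↔ 0 < s + isum F z)) →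
      2 * (h : ℤ) ≤ F.card - s + 1 → 2 * (h : ℤ) ≤ F.card + s → 2 ^ h ≤ T.size := by
  induction T with
  | leaf c =>
    intro h F s v hT h1 h2
    rcases h with _ | h
    · simp [QueryTree.size]
    · exfalso
      have hc : ∀ c : Bool, isum F (fun i => if i ∈ F then c else v i) =
          if c then (F.card : ℤ) else -F.card := by
        intro c
        rw [isum, sum_congr rfl (g := fun _ => if c then 1 else -1) fun i hi => by rw [if_pos hi]]
        cases c <;> simp
      -- Both margins are positive, so the all-ones and all-zeros inputs on `F` lie on different
      -- sides of the threshold, which a single leaf cannot distinguish.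
      have ht := hT (fun i => if i ∈ F then true else v i) fun i hi => if_neg hi
      have hf := hT (fun i => if i ∈ F then false else v i) fun i hi => if_neg hi
      rw [hc] at ht hf
      simp only [QueryTree.eval, if_true, Bool.false_eq_true, if_false] at ht hf
      push_cast at h1 h2
      have := ht.2 (by omega)
      have := hf.1 this
      omega
  | node i t₀ t₁ ih₀ ih₁ =>
    intro h F s v hT h1 h2
    by_cases hi : i ∈ F
    · rcases h with _ | h
      · simpa using one_le_size _
      · have hF : F = insert i (F.erase i) := (insert_erase hi).symm
        have hcard : F.card = (F.erase i).card + 1 := (card_erase_add_one hi).symm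
        have hsum : ∀ z, isum F z = (if z i then 1 else -1) + isum (F.erase i) z := by
          intro z
          conv_lhs => rw [hF]
          exact isum_insert (notMem_erase i F) z
        have h0 : 2 ^ h ≤ t₀.size := by
          refine ih₀ h (F.erase i) (s - 1) (Function.update v i false) ?_
            (by push_cast at h1 h2; omega) (by push_cast at h1 h2; omega)
          intro z hz
          have hzi : z i = false := by simpa using hz i (by simp)
          have := hT z fun j hj => by
            have hji : j ≠ i := (ne_of_mem_of_not_mem hi hj).symm
            simpa [hji] using hz j (by simp [hj])
          rw [hsum, hzi] at this
          simp only [QueryTree.eval, hzi, Bool.false_eq_true, if_false] at this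
          rw [this]
          omega
        have h1 : 2 ^ h ≤ t₁.size := by
          refine ih₁ h (F.erase i) (s + 1) (Function.update v i true) ?_
            (by push_cast at h1 h2; omega) (by push_cast at h1 h2; omega)
          intro z hz
          have hzi : z i = true := by simpa using hz i (by simp)
          have := hT z fun j hj => by
            have hji : j ≠ i := (ne_of_mem_of_not_mem hi hj).symm
            simpa [hji] using hz j (by simp [hj])
          rw [hsum, hzi] at this
          simp only [QueryTree.eval, hzi, if_true] at this
          rw [this]
          omega
        rw [pow_succ]
        simp only [QueryTree.size]
        omega
    · simp only [QueryTree.size]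
      cases hvi : v i
      · have : 2 ^ h ≤ t₀.size := by
          refine ih₀ h F s v (fun z hz => ?_) h1 h2
          rw [← hT z hz]
          simp [QueryTree.eval, hz i hi, hvi]
        omega
      · have : 2 ^ h ≤ t₁.size := by
          refine ih₁ h F s v (fun z hz => ?_) h1 h2
          rw [← hT z hz]
          simp [QueryTree.eval, hz i hi, hvi]
        omega

/-- Setting one tribe to 1 and all other tribes to 0 turns the selector into the majority of a
block. Here `1 ≤ w` is needed, as a tribe of width 0 would always be satisfied. -/
lemma Layout.two_pow_le_dtSize_sel {n N u w m : ℕ} (L : Layout n N u w m) (hN : 1 ≤ N)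
    (hu : 1 ≤ u) (hw : 1 ≤ w) : 2 ^ (m / 2) ≤ dtSize L.sel := by
  classical
  obtain ⟨T, hT, hs⟩ := exists_tree L.sel
  rw [← hs]
  let τ : Fin N × Fin u := (⟨0, hN⟩, ⟨0, hu⟩)
  refine two_pow_le_size_of_threshold T (m / 2) (L.Y τ.1) 0 (fun i => decide (i ∈ L.X τ)) ?_
    (by rw [L.card_Y]; omega) (by rw [L.card_Y]; omega)
  intro z hz
  have hX : ∀ σ, ∀ i ∈ L.X σ, z i = decide (i ∈ L.X τ) := fun σ i hi =>
    hz i fun h => disjoint_left.1 (L.disjoint_XY σ τ.1) hi h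
  have h1 : L.Sat τ z := fun i hi => by rw [hX τ i hi]; simpa using hi
  have h2 : ∀ σ, σ ≠ τ → ¬ L.Sat σ z := by
    intro σ hσ h
    obtain ⟨i, hi⟩ : (L.X σ).Nonempty := by rw [← card_pos, L.card_X]; omega
    have := h i hi
    rw [hX σ i hi, decide_eq_true_iff] at this
    exact disjoint_left.1 (L.disjoint_X _ _ hσ) hi this
  rw [hT, L.sel_eq_true, zero_add]
  constructor
  · rintro ⟨σ, h3, h4⟩
    have hσ : σ = τ := by
      by_contra hc
      exact h2 σ hc h3
    subst hσ
    rcases h4 with h4 | ⟨σ', h5, h6⟩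
    · exact h4
    · exact absurd h6 (h2 σ' h5)
  · exact fun h => ⟨τ, h1, .inl h⟩

/-! ### The number of tribes -/

section Tribes

/-- The difference of `1` and the expected value of the sign of the selector function, for `B`
tribes that are satisfied with probability `q` and unbiased blocks. -/
noncomputable def imbalance (q : ℝ) (B : ℕ) : ℝ := 2 * (1 - q) ^ B + B * (q * (1 - q) ^ (B - 1))

/-- By Bernoulli, `(k + 1) * q ≤ 1 + k * q ≤ (1 + q) ^ k`, and `(1 + q) * (1 - q) ≤ 1`. -/
lemma one_sub_pow_mul_le_one {q : ℝ} (h0 : 0 ≤ q) (h1 : q ≤ 1) (k : ℕ) :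
    (k + 1) * q * (1 - q) ^ k ≤ 1 := by
  have hb : 1 + k * q ≤ (1 + q) ^ k := one_add_mul_le_pow (by linarith) k
  have hp : 0 ≤ (1 - q) ^ k := pow_nonneg (by linarith) k
  calc (k + 1) * q * (1 - q) ^ k ≤ (1 + q) ^ k * (1 - q) ^ k := by
        gcongr
        linarith
    _ = (1 - q ^ 2) ^ k := by rw [← mul_pow]; ring
    _ ≤ 1 := pow_le_one₀ (by nlinarith) (by nlinarith)

lemma imbalance_sub_succ_le {q : ℝ} (h0 : 0 ≤ q) (h1 : q ≤ 1) (B : ℕ) :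
    imbalance q B - imbalance q (B + 1) ≤ 3 * q := by
  rcases B with _ | k
  · simp [imbalance]; linarith
  · have hk := one_sub_pow_mul_le_one h0 h1 k
    have hp : 0 ≤ (1 - q) ^ k := pow_nonneg (by linarith) k
    have hp1 : (1 - q) ^ k ≤ 1 := pow_le_one₀ (by linarith) (by linarith)
    have e : imbalance q (k + 1) - imbalance q (k + 1 + 1) =
        2 * q * ((1 - q) ^ k * (1 - q)) + q * ((k + 1) * q * (1 - q) ^ k) -
          q * (1 - q) ^ k * (1 - q) := by
      simp only [imbalance, Nat.add_sub_cancel, pow_succ]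
      push_cast
      ring
    have h2 : (1 - q) ^ k * (1 - q) ≤ 1 := mul_le_one₀ hp1 (by linarith) (by linarith)
    have h3 : 0 ≤ q * (1 - q) ^ k * (1 - q) :=
      mul_nonneg (mul_nonneg h0 hp) (by linarith)
    rw [e]
    nlinarith

lemma imbalance_sub_add_le {q : ℝ} (h0 : 0 ≤ q) (h1 : q ≤ 1) (B N : ℕ) :
    imbalance q B - imbalance q (B + N) ≤ 3 * q * N := by
  induction N with
  | zero => simp
  | succ N ih =>
    have := imbalance_sub_succ_le h0 h1 (B + N)
    rw [← add_assoc]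
    push_cast
    linarith

/-- With `x = B * q ≥ 2`, the imbalance is at most `exp (-x) * (2 + 8/7 * x)`, where `8/7` bounds `1
/ (1 - q)`; the bracket is below the quadratic Taylor polynomial of `exp x`. -/
lemma imbalance_le_one {q : ℝ} (h1 : q ≤ 1 / 8) {B : ℕ} (hB : 2 ≤ B * q) :
    imbalance q B ≤ 1 := by
  have hB0 : B ≠ 0 := by rintro rfl; norm_num at hB
  obtain ⟨k, rfl⟩ := Nat.exists_eq_succ_of_ne_zero hB0
  set x := ((k + 1 : ℕ) : ℝ) * q with hx
  have he : (1 - q) ^ (k + 1) ≤ Real.exp (-x) := by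
    rw [hx, show -(((k + 1 : ℕ) : ℝ) * q) = ((k + 1 : ℕ) : ℝ) * (-q) by ring, Real.exp_nat_mul]
    have := Real.add_one_le_exp (-q)
    exact pow_le_pow_left₀ (by linarith) (by linarith) _
  have h2 := Real.quadratic_le_exp_of_nonneg (x := x) (by linarith)
  have h3 : 2 + 8 / 7 * x ≤ Real.exp x := by nlinarith
  have hp : 0 ≤ (1 - q) ^ k := pow_nonneg (by linarith) k
  have h4 : imbalance q (k + 1) ≤ (1 - q) ^ (k + 1) * (2 + 8 / 7 * x) := by
    simp only [imbalance, Nat.add_sub_cancel]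
    have : (1 - q) ^ k ≤ 8 / 7 * (1 - q) ^ (k + 1) := by rw [pow_succ]; nlinarith
    calc 2 * (1 - q) ^ (k + 1) + ((k + 1 : ℕ) : ℝ) * (q * (1 - q) ^ k)
        = 2 * (1 - q) ^ (k + 1) + x * (1 - q) ^ k := by rw [hx]; ring
      _ ≤ 2 * (1 - q) ^ (k + 1) + x * (8 / 7 * (1 - q) ^ (k + 1)) := by gcongr
      _ = _ := by ring
  calc imbalance q (k + 1) ≤ (1 - q) ^ (k + 1) * (2 + 8 / 7 * x) := h4
    _ ≤ Real.exp (-x) * Real.exp x := by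
        gcongr
    _ = 1 := by rw [← Real.exp_add]; simp

/-- A discrete intermediate value argument: the imbalance is 2 without tribes and at most 1 once the
expected number of satisfied tribes reaches 2. Adding `N` tribes lowers it by at most `3 * q * N`,
so the least good `u` overshoots by at most `δ`. -/
lemma exists_tribe_count {q δ : ℝ} (h0 : 0 < q) (h1 : q ≤ 1 / 8) {N : ℕ} (hN : 1 ≤ N)
    (hδ : 3 * q * N ≤ δ) (hδ1 : δ ≤ 1) :
    ∃ u : ℕ, 1 ≤ u ∧ ((N * u : ℕ) : ℝ) * q ≤ 3 ∧ imbalance q (N * u) ≤ 1 ∧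
      1 - δ ≤ imbalance q (N * u) := by
  classical
  have hN' : (1 : ℝ) ≤ N := by exact_mod_cast hN
  have hqN : 0 < q * N := by positivity
  have hle := Nat.le_ceil (2 / (q * N))
  have hlt := Nat.ceil_lt_add_one (a := 2 / (q * N)) (by positivity)
  set u₀ := ⌈2 / (q * N)⌉₊ with hu₀
  rw [div_le_iff₀ hqN] at hle
  have hlt' : (u₀ : ℝ) * (q * N) < 2 + q * N := by
    calc (u₀ : ℝ) * (q * N) < (2 / (q * N) + 1) * (q * N) := by gcongr
      _ = 2 + q * N := by field_simp
  have hex : ∃ u, imbalance q (N * u) ≤ 1 :=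
    ⟨u₀, imbalance_le_one h1 (by push_cast; linarith)⟩
  have hfind := Nat.find_spec hex
  have hmin := fun k => Nat.find_min (m := k) hex
  have hfle : Nat.find hex ≤ u₀ :=
    Nat.find_min' hex (imbalance_le_one h1 (by push_cast; linarith))
  set u := Nat.find hex
  have hu1 : 1 ≤ u := by
    by_contra hc
    have : u = 0 := by omega
    rw [this] at hfind
    norm_num [imbalance] at hfind
  refine ⟨u, hu1, ?_, hfind, ?_⟩
  · have : (u : ℝ) ≤ u₀ := by exact_mod_cast hfle
    have : (u : ℝ) * (q * N) ≤ u₀ * (q * N) := by gcongr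
    push_cast
    linarith
  · have h2 := hmin (u - 1) (by omega)
    push Not at h2
    have h3 := imbalance_sub_add_le h0.le (by linarith) (N * (u - 1)) N
    rw [show N * (u - 1) + N = N * u by
      obtain ⟨k, hk⟩ : ∃ k, u = k + 1 := ⟨u - 1, by omega⟩
      rw [hk]; simp; ring] at h3
    linarith

/-- An imbalance at most 1 forces `(1 - q) ^ B ≤ 1/2`, hence `B * q ≥ 1/2` by Bernoulli. The
probability of no satisfied tribe is then at most twice that of exactly one, and an imbalance near 1
bounds the latter below. -/
lemma le_mul_onlyProb {q δ : ℝ} (h0 : 0 < q) (h1 : q ≤ 1 / 8) (hδ : δ ≤ 1 / 16) {B : ℕ}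
    (hle : imbalance q B ≤ 1) (hge : 1 - δ ≤ imbalance q B) :
    1 / 8 ≤ B * (q * (1 - q) ^ (B - 1)) := by
  rcases B with _ | k
  · norm_num [imbalance] at hle
  · have hb := one_add_mul_le_pow (a := -q) (by linarith) (k + 1)
    have hp : 0 ≤ (1 - q) ^ k := pow_nonneg (by linarith) k
    simp only [imbalance, Nat.add_sub_cancel] at *
    rw [← sub_eq_add_neg] at hb
    set x := ((k + 1 : ℕ) : ℝ) * q with hx
    have e : ((k + 1 : ℕ) : ℝ) * (q * (1 - q) ^ k) = x * (1 - q) ^ k := by rw [hx]; ring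
    rw [e] at *
    have hxp : 0 ≤ x * (1 - q) ^ k := by positivity
    have hx2 : 1 / 2 ≤ x := by rw [hx]; linarith
    have h2 : (1 - q) ^ (k + 1) ≤ (1 - q) ^ k := by rw [pow_succ]; nlinarith
    nlinarith

end Tribes

/-! ### Greedy trees for the selector function -/

namespace Layout

variable {n N u w m : ℕ} (L : Layout n N u w m)

lemma sum_card_inter_le (Q : Finset (Fin n)) : ∑ a, (L.Y a ∩ Q).card ≤ Q.card := by
  rw [← card_biUnion]
  · exact card_le_card (biUnion_subset.2 fun a _ => inter_subset_right)
  · intro a _ a' _ h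
    exact (L.disjoint_Y a a' h).mono inter_subset_left inter_subset_left

lemma card_sdiff_add (Q : Finset (Fin n)) (a : Fin N) :
    (L.Y a \ Q).card + (L.Y a ∩ Q).card = m := by
  rw [card_sdiff_add_card_inter, L.card_Y]

/-- The bound is linear in the number of queries and in the square of the block sum, so that it can
be summed over blocks. If half of the block is queried the first term exceeds 1; otherwise the block
sum is traded for its square by the inequality of means with weight `θ * √m`. -/
lemma abs_bias_block_le (hm : 1 ≤ m) {θ : ℝ} (hθ : 0 < θ) (Q : Finset (Fin n)) (v : Fin n → Bool)
    (a : Fin N) : |bias (L.blockSum Q v a) (L.Y a \ Q)| ≤ 2 / m * (L.Y a ∩ Q).card +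
      3 / 2 * (θ + 1 / √m) + 3 / (2 * θ * m) * (L.blockSum Q v a : ℝ) ^ 2 := by
  have hm' : (1 : ℝ) ≤ m := by exact_mod_cast hm
  have hc : ((L.Y a \ Q).card : ℝ) + (L.Y a ∩ Q).card = m := by exact_mod_cast L.card_sdiff_add Q a
  have hsm : 0 < √(m : ℝ) := Real.sqrt_pos.2 (by linarith)
  have hsq : √(m : ℝ) ^ 2 = m := Real.sq_sqrt (by linarith)
  have h2 : 0 ≤ 3 / 2 * (θ + 1 / √m) := by positivity
  have h3 : 0 ≤ 3 / (2 * θ * m) * (L.blockSum Q v a : ℝ) ^ 2 := by positivity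
  have h4 : 0 ≤ 2 / (m : ℝ) * (L.Y a ∩ Q).card := by positivity
  rcases le_or_gt ((m : ℝ) / 2) (L.Y a ∩ Q).card with h | h
  · have h1 := abs_bias_le_one (L.blockSum Q v a) (L.Y a \ Q)
    have : (1 : ℝ) ≤ 2 / m * (L.Y a ∩ Q).card := by
      rw [div_mul_eq_mul_div, le_div_iff₀ (by linarith)]
      linarith
    linarith
  · have h1 := abs_bias_le (L.blockSum Q v a) (L.Y a \ Q)
    set S := |(L.blockSum Q v a : ℝ)| with hS
    have hS0 : 0 ≤ S := abs_nonneg _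
    have h5 : 2 / 3 * √(m : ℝ) ≤ √((L.Y a \ Q).card + 1) := by
      apply Real.le_sqrt_of_sq_le
      rw [mul_pow, hsq]
      linarith
    have h6 : (2 * S + 1) / √((L.Y a \ Q).card + 1) ≤ (2 * S + 1) / (2 / 3 * √m) := by gcongr
    have h7 : 2 * S ≤ θ * √m + S ^ 2 / (θ * √m) := by
      rw [← sub_nonneg]
      have : θ * √m + S ^ 2 / (θ * √m) - 2 * S = (θ * √m - S) ^ 2 / (θ * √m) := by
        field_simp; ring
      rw [this]
      positivity
    have h8 : (2 * S + 1) / (2 / 3 * √m) ≤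
        3 / 2 * (θ + 1 / √m) + 3 / (2 * θ * m) * (L.blockSum Q v a : ℝ) ^ 2 := by
      have e : 3 / 2 * (θ + 1 / √(m : ℝ)) + 3 / (2 * θ * m) * (L.blockSum Q v a : ℝ) ^ 2 =
          (θ * √m + S ^ 2 / (θ * √m) + 1) / (2 / 3 * √m) := by
        have e1 : 3 / (2 * θ * m) * (L.blockSum Q v a : ℝ) ^ 2 =
            3 / (2 * θ * √(m : ℝ) ^ 2) * S ^ 2 := by rw [hS, sq_abs, hsq]
        rw [e1]
        field_simp
        ring
      rw [e]
      gcongr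
    linarith

lemma sum_abs_bias_le (hm : 1 ≤ m) {θ τ : ℝ} (hθ : 0 < θ) {Q : Finset (Fin n)}
    {v : Fin n → Bool} (hQ : (Q.card : ℝ) ≤ τ * (N * m))
    (hS : ∑ a, (L.blockSum Q v a : ℝ) ^ 2 ≤ θ ^ 2 * (N * m)) :
    ∑ a, |bias (L.blockSum Q v a) (L.Y a \ Q)| ≤ N * (2 * τ + 3 * θ + 2 / √m) := by
  have hm' : (1 : ℝ) ≤ m := by exact_mod_cast hm
  have hsm : 0 < √(m : ℝ) := Real.sqrt_pos.2 (by linarith)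
  have hc : ∑ a, ((L.Y a ∩ Q).card : ℝ) ≤ Q.card := by exact_mod_cast L.sum_card_inter_le Q
  calc ∑ a, |bias (L.blockSum Q v a) (L.Y a \ Q)|
      ≤ ∑ a, (2 / m * ((L.Y a ∩ Q).card : ℝ) +
      3 / 2 * (θ + 1 / √m) + 3 / (2 * θ * m) * (L.blockSum Q v a : ℝ) ^ 2) :=
        sum_le_sum fun a _ => L.abs_bias_block_le hm hθ Q v a
    _ = 2 / m * ∑ a, ((L.Y a ∩ Q).card : ℝ) + N * (3 / 2 * (θ + 1 / √m)) +
        3 / (2 * θ * m) * ∑ a, (L.blockSum Q v a : ℝ) ^ 2 := by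
        rw [sum_add_distrib, sum_add_distrib, mul_sum, mul_sum, sum_const, card_univ,
          Fintype.card_fin, nsmul_eq_mul]
    _ ≤ 2 / m * (τ * (N * m)) + N * (3 / 2 * (θ + 1 / √m)) +
        3 / (2 * θ * m) * (θ ^ 2 * (N * m)) := by
        gcongr
        exact hc.trans hQ
    _ = N * (2 * τ + 3 * θ + 3 / 2 / √m) := by
        field_simp
        ring
    _ ≤ N * (2 * τ + 3 * θ + 2 / √m) := by gcongr; norm_num

/-- Averaging: a bad block contributes more than `m` to the sum of `4 |Y a ∩ Q|` and 16 times the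
squared block sum, but the total is below `N * m`. -/
lemma exists_good_block (hm : 1 ≤ m) (hN : 1 ≤ N) {θ τ : ℝ} (hτθ : 4 * τ + 16 * θ ^ 2 < 1)
    {Q : Finset (Fin n)} {v : Fin n → Bool} (hQ : (Q.card : ℝ) ≤ τ * (N * m))
    (hS : ∑ a, (L.blockSum Q v a : ℝ) ^ 2 ≤ θ ^ 2 * (N * m)) :
    ∃ a, 4 * ((L.Y a ∩ Q).card : ℝ) ≤ m ∧ 16 * (L.blockSum Q v a : ℝ) ^ 2 ≤ m := by
  by_contra! hc
  have hm' : (1 : ℝ) ≤ m := by exact_mod_cast hm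
  have hN' : (1 : ℝ) ≤ N := by exact_mod_cast hN
  have hcard : ∑ a, ((L.Y a ∩ Q).card : ℝ) ≤ Q.card := by exact_mod_cast L.sum_card_inter_le Q
  have h1 : ∑ _a : Fin N, (m : ℝ) ≤
      ∑ a, (4 * ((L.Y a ∩ Q).card : ℝ) + 16 * (L.blockSum Q v a : ℝ) ^ 2) := by
    refine sum_le_sum fun a _ => ?_
    have h2 : 0 ≤ ((L.Y a ∩ Q).card : ℝ) := by positivity
    have h3 : 0 ≤ (L.blockSum Q v a : ℝ) ^ 2 := by positivity
    rcases le_or_gt (4 * ((L.Y a ∩ Q).card : ℝ)) m with h | h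
    · linarith [hc a h]
    · linarith
  rw [sum_add_distrib, ← mul_sum, ← mul_sum] at h1
  simp only [sum_const, card_univ, Fintype.card_fin, nsmul_eq_mul] at h1
  have h4 : 0 < (N : ℝ) * m := by positivity
  nlinarith

/-- As long as only few variables have been queried, all of them in blocks, and the block sums are
small, the most influential variables are in blocks. -/
lemma exists_block_of_isMostInfluential (hm : 16 ≤ m) (hN : 1 ≤ N) {θ τ : ℝ}
    (hτθ : 4 * τ + 16 * θ ^ 2 < 1) (hB : 1 / 8 ≤ ((N * u : ℕ) : ℝ) * L.onlyProb)
    (hw : 128 * (N * √(m : ℝ)) < 2 ^ w)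
    {Q : Finset (Fin n)} (hQY : Q ⊆ univ.biUnion L.Y) {v : Fin n → Bool}
    (hQ : (Q.card : ℝ) ≤ τ * (N * m))
    (hS : ∑ a, (L.blockSum Q v a : ℝ) ^ 2 ≤ θ ^ 2 * (N * m)) {i : Fin n}
    (hi : IsMostInfluential (fun z => L.sel (overwrite Q v z)) i) : ∃ a, i ∈ L.Y a \ Q := by
  obtain ⟨a, ha1, ha2⟩ := L.exists_good_block (by omega) hN hτθ hQ hS
  have hm' : (16 : ℝ) ≤ m := by exact_mod_cast hm
  have hN' : (1 : ℝ) ≤ N := by exact_mod_cast hN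
  have hsm : 0 < √(m : ℝ) := Real.sqrt_pos.2 (by linarith)
  have hc : ((L.Y a \ Q).card : ℝ) + (L.Y a ∩ Q).card = m := by exact_mod_cast L.card_sdiff_add Q a
  have hcard : 2 ≤ (L.Y a \ Q).card := by
    have : (2 : ℝ) ≤ (L.Y a \ Q).card := by linarith
    exact_mod_cast this
  obtain ⟨j, hj⟩ : (L.Y a \ Q).Nonempty := card_pos.1 (by omega)
  have hinf := L.influence_block_ge hQY v (mem_sdiff.1 hj).1 (mem_sdiff.1 hj).2
  set r := (L.Y a \ Q).card - 1 with hr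
  have hr' : (r : ℝ) + 1 = (L.Y a \ Q).card := by
    have : r + 1 = (L.Y a \ Q).card := by omega
    exact_mod_cast this
  have hwalk : 1 / (8 * √(r : ℝ)) ≤
      walk r (-L.blockSum Q v a) + walk r (-L.blockSum Q v a + 1) := by
    apply walk_add_walk_ge
    rw [abs_neg]
    have : ((|L.blockSum Q v a| : ℤ) + 2 : ℝ) ^ 2 + 1 ≤ r := by
      push_cast
      set S := |(L.blockSum Q v a : ℝ)| with hSdef
      have : S ^ 2 = (L.blockSum Q v a : ℝ) ^ 2 := sq_abs _
      nlinarith [sq_nonneg (S - 4)]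
    exact_mod_cast this
  have hrpos : (0 : ℝ) < r := by
    have : 0 < r := by omega
    exact_mod_cast this
  have hrm : 1 / (8 * √(m : ℝ)) ≤ 1 / (8 * √(r : ℝ)) := by
    have : √(r : ℝ) ≤ √m := Real.sqrt_le_sqrt (by
      have : (0 : ℝ) ≤ (L.Y a ∩ Q).card := by positivity
      linarith)
    have h0 : 0 < √(r : ℝ) := Real.sqrt_pos.2 hrpos
    gcongr
  have huB : 1 / (8 * N) ≤ u * L.onlyProb := by
    push_cast at hB
    rw [div_le_iff₀ (by positivity)]
    linarith
  -- A free variable of the good block has influence at least `1 / (64 * N * √m)`, which exceeds the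
  -- bound for tribe variables by the assumption on `w`.
  have hpos : 2 * (1 / 2 : ℝ) ^ w < influence (fun z => L.sel (overwrite Q v z)) j := by
    calc 2 * (1 / 2 : ℝ) ^ w < 1 / (8 * N) * (1 / (8 * √m)) := by
          rw [div_mul_div_comm, one_div_pow, mul_one_div, div_lt_div_iff₀ (by positivity)
            (by positivity)]
          linarith
      _ ≤ u * L.onlyProb * (walk r (-L.blockSum Q v a) + walk r (-L.blockSum Q v a + 1)) := by
          exact mul_le_mul huB (hrm.trans hwalk) (by positivity)
            (le_trans (by positivity) huB)
      _ ≤ _ := hinf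
  have hle := hi j
  have hw0 : (0 : ℝ) < 2 * (1 / 2) ^ w := by positivity
  by_contra! hno
  by_cases hX : ∃ τ, i ∈ L.X τ
  · obtain ⟨σ, hσ⟩ := hX
    have := L.influence_tribe_le hQY v hσ
    linarith
  · push Not at hX
    have := L.influence_eq_zero hQY v hX hno
    linarith

/-- The part coming from the tribes is within `δ` of 0 by the choice of their number. The rest is
the average bias of the blocks, scaled by the probability of exactly one satisfied tribe, which is
at most 1. -/
lemma abs_mean_sgn_sel_le (hm : 1 ≤ m) (hN : 1 ≤ N) {θ τ δ : ℝ} (hθ : 0 < θ)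
    (hle : imbalance ((1 / 2) ^ w) (N * u) ≤ 1)
    (hge : 1 - δ ≤ imbalance ((1 / 2) ^ w) (N * u))
    {Q : Finset (Fin n)} (hQY : Q ⊆ univ.biUnion L.Y) {v : Fin n → Bool}
    (hQ : (Q.card : ℝ) ≤ τ * (N * m))
    (hS : ∑ a, (L.blockSum Q v a : ℝ) ^ 2 ≤ θ ^ 2 * (N * m)) :
    |mean (fun z => sgn (L.sel (overwrite Q v z)))| ≤ δ + (2 * τ + 3 * θ + 2 / √m) := by
  have hN' : (1 : ℝ) ≤ N := by exact_mod_cast hN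
  have h1 := L.sum_abs_bias_le hm hθ hQ hS
  have h2 := abs_sum_le_sum_abs (fun a => bias (L.blockSum Q v a) (L.Y a \ Q)) univ
  have hq1 : (1 / 2 : ℝ) ^ w ≤ 1 := pow_le_one₀ (by norm_num) (by norm_num)
  have hp0 : 0 ≤ (1 - (1 / 2 : ℝ) ^ w) ^ (N * u) := pow_nonneg (by linarith) _
  have hp1 : 0 ≤ L.onlyProb := mul_nonneg (by positivity) (pow_nonneg (by linarith) _)
  have himb : imbalance ((1 / 2) ^ w) (N * u) =
      2 * (1 - (1 / 2 : ℝ) ^ w) ^ (N * u) + N * u * L.onlyProb := by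
    rw [imbalance, onlyProb]; push_cast; ring
  have h3 : u * L.onlyProb * N ≤ 1 := by linarith
  have hbd : 0 ≤ 2 * τ + 3 * θ + 2 / √m := by
    have h0 : 0 ≤ N * (2 * τ + 3 * θ + 2 / √m) := (sum_nonneg fun a _ => abs_nonneg _).trans h1
    exact nonneg_of_mul_nonneg_right h0 (by linarith)
  rw [L.mean_sgn_sel hQY, sub_sub, ← himb]
  refine (abs_add_le _ _).trans (add_le_add ?_ ?_)
  · rw [abs_of_nonneg (by linarith)]
    linarith
  · rw [abs_mul, abs_of_nonneg (by positivity)]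
    calc u * L.onlyProb * |∑ a, bias (L.blockSum Q v a) (L.Y a \ Q)|
        ≤ u * L.onlyProb * (N * (2 * τ + 3 * θ + 2 / √m)) := by
          gcongr
          exact h2.trans h1
      _ = (u * L.onlyProb * N) * (2 * τ + 3 * θ + 2 / √m) := by ring
      _ ≤ 1 * (2 * τ + 3 * θ + 2 / √m) := by gcongr
      _ = _ := one_mul _

/-- A greedy tree that queries block variables as long as the block sums are small has a large
error unless it is large. The sum of the squares of the block sums grows by `1` per query in
expectation. -/
lemma bareError_ge {δ μ : ℝ} (hδ : 0 ≤ δ) (hμ : 0 < μ) {t : ℕ}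
    (H1 : ∀ (Q : Finset (Fin n)) (v : Fin n → Bool), Q ⊆ univ.biUnion L.Y → Q.card ≤ t →
      ∑ a, (L.blockSum Q v a : ℝ) ^ 2 ≤ μ →
      |mean (fun z => sgn (L.sel (overwrite Q v z)))| ≤ δ)
    (H2 : ∀ (Q : Finset (Fin n)) (v : Fin n → Bool) (i : Fin n), Q ⊆ univ.biUnion L.Y →
      Q.card ≤ t → ∑ a, (L.blockSum Q v a : ℝ) ^ 2 ≤ μ →
      IsMostInfluential (fun z => L.sel (overwrite Q v z)) i → ∃ a, i ∈ L.Y a \ Q)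
    (T : BareTree n) : ∀ (j : ℕ) (Q : Finset (Fin n)) (v : Fin n → Bool),
      Q ⊆ univ.biUnion L.Y → Q.card + j = t → Greedy T (fun z => L.sel (overwrite Q v z)) →
      1 - δ - (∑ a, (L.blockSum Q v a : ℝ) ^ 2 + j) / μ - T.size / 2 ^ j ≤
        2 * bareError T (fun z => L.sel (overwrite Q v z)) := by
  induction T with
  | leaf c =>
    intro j Q v hQ hj _
    have h0 := bareError_nonneg (.leaf c) (fun z => L.sel (overwrite Q v z))
    have hs : (0 : ℝ) ≤ (QueryTree.leaf c : BareTree n).size / 2 ^ j := by positivity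
    rcases le_or_gt (∑ a, (L.blockSum Q v a : ℝ) ^ 2) μ with h | h
    · have h1 := bareError_leaf_ge (fun z => L.sel (overwrite Q v z))
      have h2 := H1 Q v hQ (by omega) h
      have h3 : 0 ≤ (∑ a, (L.blockSum Q v a : ℝ) ^ 2 + j) / μ := by positivity
      cases c
      linarith
    -- When the sum of squares has passed `μ` the left side is not positive, so nothing is left to
    -- prove; the same happens at internal nodes.
    · have h3 : 1 ≤ (∑ a, (L.blockSum Q v a : ℝ) ^ 2 + j) / μ := by
        rw [le_div_iff₀ hμ]
        have : (0 : ℝ) ≤ j := by positivity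
        linarith
      linarith
  | node i t₀ t₁ ih₀ ih₁ =>
    intro j Q v hQ hj hT
    have h0 := bareError_nonneg (.node i t₀ t₁) (fun z => L.sel (overwrite Q v z))
    have hs : (0 : ℝ) ≤ (QueryTree.node i t₀ t₁ : BareTree n).size / 2 ^ j := by positivity
    rcases lt_or_ge μ (∑ a, (L.blockSum Q v a : ℝ) ^ 2) with h | h
    · have h3 : 1 ≤ (∑ a, (L.blockSum Q v a : ℝ) ^ 2 + j) / μ := by
        rw [le_div_iff₀ hμ]
        have : (0 : ℝ) ≤ j := by positivity
        linarith
      linarith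
    · rcases j with _ | j
      -- The query budget is exhausted: the size term alone is at least 1.
      · have h3 : 0 ≤ (∑ a, (L.blockSum Q v a : ℝ) ^ 2 + ((0 : ℕ) : ℝ)) / μ := by positivity
        have h4 : (1 : ℝ) ≤ (QueryTree.node i t₀ t₁ : BareTree n).size := by
          exact_mod_cast one_le_size _
        simp only [pow_zero, div_one]
        linarith
      · obtain ⟨-, hmax, hg0, hg1⟩ := hT
        obtain ⟨a, ha⟩ := H2 Q v i hQ (by omega) h hmax
        obtain ⟨haY, hiQ⟩ := mem_sdiff.1 ha
        have hQ' : insert i Q ⊆ univ.biUnion L.Y :=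
          insert_subset (mem_biUnion.2 ⟨a, mem_univ _, haY⟩) hQ
        have hcard : (insert i Q).card + j = t := by rw [card_insert_of_notMem hiQ]; omega
        rw [bareError_node hg0 hg1]
        rw [restrict_overwrite hiQ] at hg0 hg1 ⊢
        rw [restrict_overwrite hiQ]
        have b0 := ih₀ j _ _ hQ' hcard hg0
        have b1 := ih₁ j _ _ hQ' hcard hg1
        rw [L.sum_blockSum_sq_insert v haY hiQ] at b0 b1
        simp only [sgn, Bool.false_eq_true, if_false, if_true] at b0 b1
        simp only [QueryTree.size]
        set Φ := ∑ a, (L.blockSum Q v a : ℝ) ^ 2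
        -- The linear terms cancel: the sum of squares gains 1 on average while `j` loses 1, so the
        -- potential term is preserved.
        have e1 : (Φ + 2 * (-1) * L.blockSum Q v a + 1 + j) / μ +
            (Φ + 2 * 1 * L.blockSum Q v a + 1 + j) / μ = 2 * ((Φ + ((j + 1 : ℕ) : ℝ)) / μ) := by
          push_cast; field_simp; ring
        have e2 : (t₀.size : ℝ) / 2 ^ j + t₁.size / 2 ^ j =
            2 * (((t₀.size + t₁.size : ℕ) : ℝ) / 2 ^ (j + 1)) := by
          push_cast; rw [pow_succ]; field_simp
        linarith

end Layout

/-- The selector function is hard for top-down induction. -/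
theorem exists_hard_function {ε : ℝ} (hε : 0 < ε) (hε' : ε < 1 / 2) :
    ∃ C η : ℝ, 0 < C ∧ 0 < η ∧ ∀ n N w m : ℕ, 1 ≤ N → C ≤ m → C * (N * √(m : ℝ)) ≤ 2 ^ w →
      3 * 2 ^ w * w + N * m ≤ n → ∃ f : BoolFun n, Monotone f ∧
        dtSize f ≤ 2 ^ (3 * 2 ^ w * w + m) ∧ 2 ^ (m / 2) ≤ dtSize f ∧
        η * 2 ^ (η * (N * m)) ≤ (topDownDTSize f ε : ℝ) := by
  obtain ⟨γ, hγ⟩ : ∃ γ, γ = 1 / 2 - ε := ⟨_, rfl⟩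
  have hγ0 : 0 < γ := by linarith
  have hγ1 : γ < 1 / 2 := by linarith
  -- The first constant makes both `2 / √m` and the rounding error `3 * q * N` of the tribe count at
  -- most `γ / 8`.
  refine ⟨256 / γ ^ 2, γ ^ 3 / 2048, by positivity, by positivity, ?_⟩
  intro n N w m hN hm hw hn
  have hN' : (1 : ℝ) ≤ N := by exact_mod_cast hN
  have hγ2 : γ ^ 2 < 1 / 4 := by nlinarith
  have hC : (1024 : ℝ) ≤ 256 / γ ^ 2 := by rw [le_div_iff₀ (by positivity)]; linarith
  have hm' : (1024 : ℝ) ≤ m := hC.trans hm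
  have hmN : 1024 ≤ m := by exact_mod_cast hm'
  have hsm : 32 ≤ √(m : ℝ) := Real.le_sqrt_of_sq_le (by linarith)
  have hsmγ : 2 / √(m : ℝ) ≤ γ / 8 := by
    have : 16 / γ ≤ √(m : ℝ) := by
      apply Real.le_sqrt_of_sq_le
      rw [div_pow]
      norm_num
      exact hm
    rw [div_le_iff₀ hγ0] at this
    rw [div_le_iff₀ (by linarith)]
    linarith
  have hNs : N ≤ N * √(m : ℝ) := by nlinarith
  have hw1 : 1024 * (N * √(m : ℝ)) ≤ 2 ^ w :=
    le_trans (by gcongr) hw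
  have hw8 : (8 : ℝ) ≤ 2 ^ w := by nlinarith
  have hw3 : 3 ≤ w := by
    by_contra hc
    have : (2 : ℝ) ^ w ≤ 2 ^ 2 := pow_le_pow_right₀ (by norm_num) (by omega)
    norm_num at this
    linarith
  set q : ℝ := (1 / 2) ^ w with hq
  have hq0 : 0 < q := by positivity
  have hqw : q * 2 ^ w = 1 := by rw [hq, ← mul_pow]; norm_num
  have hq8 : q ≤ 1 / 8 := by nlinarith
  have hqN : 3 * q * N ≤ γ / 8 := by
    have h1 : 256 / γ ^ 2 * N ≤ 2 ^ w := le_trans (by gcongr) hw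
    have h2 : q * (256 / γ ^ 2 * N) ≤ 1 := by
      rw [← hqw]; gcongr
    have h3 : q * (256 / γ ^ 2 * N) = (3 * q * N) * (256 / (3 * γ ^ 2)) := by field_simp
    have h4 : 8 / γ ≤ 256 / (3 * γ ^ 2) := by
      rw [div_le_div_iff₀ (by positivity) (by positivity)]
      nlinarith
    have h5 : (3 * q * N) * (8 / γ) ≤ 1 := by
      refine le_trans ?_ (h3 ▸ h2)
      gcongr
    rw [mul_div_assoc', div_le_one hγ0] at h5
    linarith
  obtain ⟨u, hu, huq, hle, hge⟩ := exists_tribe_count hq0 hq8 hN hqN (by linarith)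
  have huw : N * u ≤ 3 * 2 ^ w := by
    have : ((N * u : ℕ) : ℝ) ≤ 3 * 2 ^ w := by
      calc ((N * u : ℕ) : ℝ) = ((N * u : ℕ) : ℝ) * q * 2 ^ w := by rw [mul_assoc, hqw, mul_one]
        _ ≤ 3 * 2 ^ w := by gcongr
    exact_mod_cast this
  have huw' : N * u * w ≤ 3 * 2 ^ w * w := Nat.mul_le_mul_right w huw
  obtain ⟨L⟩ := exists_layout (n := n) (N := N) (u := u) (w := w) (m := m) (by omega)
  refine ⟨L.sel, L.monotone_sel, (L.dtSize_sel_le hN).trans ?_,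
    L.two_pow_le_dtSize_sel hN hu (by omega), ?_⟩
  · exact Nat.pow_le_pow_right (by norm_num) (by omega)
  have hn1 : 1 ≤ n := by
    have := Nat.mul_le_mul hN hmN
    omega
  refine le_topDownDTSize hn1 hε.le fun T hT herr => ?_
  have hγ3 : γ ^ 3 ≤ γ / 4 := by
    rw [pow_succ]
    nlinarith
  -- The ratio `τ / θ ^ 2 = γ / 8` bounds the loss from large block sums. All losses together stay
  -- below `γ`, while an error at most `ε` leaves room `1 - 2 * ε = 2 * γ`.
  obtain ⟨θ, hθ⟩ : ∃ θ, θ = γ / 16 := ⟨_, rfl⟩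
  obtain ⟨τ, hτ⟩ : ∃ τ, τ = γ ^ 3 / 2048 := ⟨_, rfl⟩
  rw [← hτ]
  have hNm : 0 < (N : ℝ) * m := by positivity
  set t := ⌊τ * (N * m)⌋₊ with ht
  have hτ0 : 0 < τ := by rw [hτ]; positivity
  have hθ0 : 0 < θ := by rw [hθ]; positivity
  have ht1 : (t : ℝ) ≤ τ * (N * m) := Nat.floor_le (by positivity)
  have ht2 : τ * (N * m) < t + 1 := Nat.lt_floor_add_one _
  have hτθ : 4 * τ + 16 * θ ^ 2 < 1 := by rw [hτ, hθ, div_pow]; linarith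
  have hB : 1 / 8 ≤ ((N * u : ℕ) : ℝ) * L.onlyProb :=
    le_mul_onlyProb hq0 hq8 (by linarith) hle hge
  have hw128 : 128 * (N * √(m : ℝ)) < 2 ^ w := by linarith
  have hcardle : ∀ Q : Finset (Fin n), Q.card ≤ t → (Q.card : ℝ) ≤ τ * (N * m) := fun Q hQ =>
    le_trans (by exact_mod_cast hQ) ht1
  have key := L.bareError_ge (δ := γ / 8 + (2 * τ + 3 * θ + 2 / √m)) (μ := θ ^ 2 * (N * m)) (t := t)
    (by positivity) (by positivity)
    (fun Q v hQ hc hS => L.abs_mean_sgn_sel_le (by omega) hN hθ0 hle hge hQ (hcardle Q hc) hS)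
    (fun Q v i hQ hc hS hi => L.exists_block_of_isMostInfluential (by omega) hN hτθ hB
      hw128 hQ (hcardle Q hc) hS hi)
    T t ∅ (fun _ => false) (by simp) (by simp)
  have hov : (fun z => L.sel (overwrite ∅ (fun _ => false) z)) = L.sel := by
    ext z
    congr 1
  rw [hov] at key
  have key := key hT
  have hz : ∑ a, (L.blockSum ∅ (fun _ => false) a : ℝ) ^ 2 = 0 := by
    simp [Layout.blockSum, isum]
  rw [hz, zero_add] at key
  have hfrac : (t : ℝ) / (θ ^ 2 * (N * m)) ≤ γ / 8 := by
    rw [div_le_iff₀ (by positivity)]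
    refine ht1.trans (le_of_eq ?_)
    rw [hτ, hθ]
    ring
  have hτγ : τ ≤ γ / 8192 := by rw [hτ]; linarith
  have hsize : γ ≤ (T.size : ℝ) / 2 ^ t := by linarith
  rw [le_div_iff₀ (by positivity)] at hsize
  calc τ * 2 ^ (τ * (N * m)) ≤ (γ / 2) * 2 ^ ((t : ℝ) + 1) := by
        gcongr
        · linarith
        · norm_num
    _ = γ * 2 ^ t := by
        rw [Real.rpow_add (by norm_num), Real.rpow_natCast, Real.rpow_one]; ring
    _ ≤ T.size := hsize

/-! ### The choice of parameters -/

open Filter Topology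

lemma one_le_logb_two_add {x : ℝ} (hx : 0 ≤ x) : 1 ≤ Real.logb 2 (2 + x) := by
  rw [Real.le_logb_iff_rpow_le (by norm_num) (by linarith)]
  norm_num
  exact hx

lemma eventually_logb_pow_le (K : ℕ) :
    ∀ᶠ x : ℝ in atTop, Real.logb 2 (2 + x) ^ K ≤ x ^ (1 / 4 : ℝ) := by
  have h2 : 0 < Real.log 2 := Real.log_pos (by norm_num)
  have ho := isLittleO_log_rpow_rpow_atTop (s := 1 / 4) (K : ℝ) (by norm_num)
  have hb := ho.bound (c := Real.log 2 ^ K / 2) (by positivity)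
  have ht : Tendsto (fun x : ℝ => 2 + x) atTop atTop := tendsto_atTop_add_const_left _ _ tendsto_id
  filter_upwards [ht.eventually hb, eventually_ge_atTop 1] with x hx hx1
  have hlog : 0 ≤ Real.log (2 + x) := Real.log_nonneg (by linarith)
  rw [Real.rpow_natCast, Real.norm_of_nonneg (by positivity), Real.norm_of_nonneg (by positivity)]
    at hx
  have h3 : (2 + x) ^ (1 / 4 : ℝ) ≤ 2 * x ^ (1 / 4 : ℝ) := by
    calc (2 + x) ^ (1 / 4 : ℝ) ≤ (16 * x) ^ (1 / 4 : ℝ) := by gcongr; linarith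
      _ = 2 * x ^ (1 / 4 : ℝ) := by
        rw [Real.mul_rpow (by norm_num) (by linarith)]
        congr 1
        rw [show (16 : ℝ) = 2 ^ (4 : ℝ) by norm_num, ← Real.rpow_mul (by norm_num)]
        norm_num
  rw [Real.logb, div_pow, div_le_iff₀ (by positivity)]
  calc Real.log (2 + x) ^ K ≤ Real.log 2 ^ K / 2 * (2 + x) ^ (1 / 4 : ℝ) := hx
    _ ≤ Real.log 2 ^ K / 2 * (2 * x ^ (1 / 4 : ℝ)) := by gcongr
    _ = _ := by ring

lemma eventually_mul_logb_le {C : ℝ} (hC : 0 < C) :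
    ∀ᶠ x : ℝ in atTop, 24 * (C * x ^ (3 / 4 : ℝ)) * (Real.logb 2 (C * x ^ (3 / 4 : ℝ)) + 1) ≤ x := by
  have h2 : 0 < Real.log 2 := Real.log_pos (by norm_num)
  have h1 : (fun x : ℝ => (Real.logb 2 C + 1) + 3 / (4 * Real.log 2) * Real.log x) =o[atTop]
      fun x : ℝ => x ^ (1 / 4 : ℝ) := by
    refine Asymptotics.IsLittleO.add ?_ ((isLittleO_log_rpow_atTop (by norm_num)).const_mul_left _)
    rw [Asymptotics.isLittleO_const_left]
    right
    exact tendsto_norm_atTop_atTop.comp (tendsto_rpow_atTop (by norm_num))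
  filter_upwards [h1.bound (c := 1 / (24 * C)) (by positivity), eventually_ge_atTop 1] with x hx hx1
  have hx0 : 0 < x := by linarith
  have e : Real.logb 2 (C * x ^ (3 / 4 : ℝ)) + 1 =
      (Real.logb 2 C + 1) + 3 / (4 * Real.log 2) * Real.log x := by
    rw [Real.logb_mul hC.ne' (by positivity), Real.logb_rpow_eq_mul_logb_of_pos hx0]
    simp only [Real.logb]
    field_simp
    ring
  rw [← e, Real.norm_of_nonneg (by positivity : 0 ≤ x ^ (1 / 4 : ℝ))] at hx
  have h3 := (le_abs_self _).trans hx
  calc 24 * (C * x ^ (3 / 4 : ℝ)) * (Real.logb 2 (C * x ^ (3 / 4 : ℝ)) + 1)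
      ≤ 24 * (C * x ^ (3 / 4 : ℝ)) * (1 / (24 * C) * x ^ (1 / 4 : ℝ)) := by gcongr
    _ = x ^ (3 / 4 : ℝ) * x ^ (1 / 4 : ℝ) := by field_simp
    _ = x := by rw [← Real.rpow_add hx0]; norm_num

/-- A function of size `2 ^ l` needs at least `l ^ (5 / 4)` variables, up to logarithmic factors. -/
lemma rpow_div_le_of_le_mul {A n : ℕ} {l : ℝ} (hl : 1 ≤ l)
    (hA : (A : ℝ) * 2 ^ A ≤ Real.logb 2 (2 + l))
    (h : l ≤ A * (n : ℝ) ^ (4 / 5 : ℝ) * Real.logb 2 ((n : ℝ) + 1) ^ A) :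
    l ^ (5 / 4 : ℝ) / Real.logb 2 (2 + l) ^ (2 * A + 2) ≤ n := by
  have hℓ := one_le_logb_two_add (x := l) (by linarith)
  set ℓ := Real.logb 2 (2 + l) with hℓdef
  by_contra! hc
  have hn0 : (0 : ℝ) ≤ n := by positivity
  have hnl : (n : ℝ) ≤ l ^ 2 := by
    calc (n : ℝ) ≤ l ^ (5 / 4 : ℝ) / ℓ ^ (2 * A + 2) := hc.le
      _ ≤ l ^ (5 / 4 : ℝ) := div_le_self (by positivity) (one_le_pow₀ hℓ)
      _ ≤ l ^ (2 : ℝ) := Real.rpow_le_rpow_of_exponent_le hl (by norm_num)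
      _ = l ^ 2 := by norm_num
  have hlog : Real.logb 2 ((n : ℝ) + 1) ≤ 2 * ℓ := by
    rw [hℓdef, show (2 : ℝ) * Real.logb 2 (2 + l) = Real.logb 2 ((2 + l) ^ 2) by
      rw [Real.logb_pow]; norm_num]
    exact Real.logb_le_logb_of_le (by norm_num) (by linarith) (by nlinarith)
  have hlog0 : 0 ≤ Real.logb 2 ((n : ℝ) + 1) := Real.logb_nonneg (by norm_num) (by linarith)
  have hpow : (n : ℝ) ^ (4 / 5 : ℝ) * ℓ ^ (A + 1) ≤ l := by
    have h1 : (n : ℝ) ^ (4 / 5 : ℝ) ≤ (l ^ (5 / 4 : ℝ) / ℓ ^ (2 * A + 2)) ^ (4 / 5 : ℝ) := by gcongr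
    have h2 : (l ^ (5 / 4 : ℝ) / ℓ ^ (2 * A + 2)) ^ (4 / 5 : ℝ) =
        l / (ℓ ^ (2 * A + 2)) ^ (4 / 5 : ℝ) := by
      rw [Real.div_rpow (by positivity) (by positivity), ← Real.rpow_mul (by linarith)]
      norm_num
    -- The exponent `2 * A + 2` of the logarithm survives the power 4/5 with at least `A + 1`: `A`
    -- of these absorb the logarithm in the hypothesis, one absorbs the constant `A * 2 ^ A`.
    have h3 : ℓ ^ (A + 1) ≤ (ℓ ^ (2 * A + 2)) ^ (4 / 5 : ℝ) := by
      rw [← Real.rpow_natCast, ← Real.rpow_natCast, ← Real.rpow_mul (by linarith)]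
      apply Real.rpow_le_rpow_of_exponent_le hℓ
      push_cast
      have : (0 : ℝ) ≤ A := by positivity
      linarith
    rw [h2] at h1
    calc (n : ℝ) ^ (4 / 5 : ℝ) * ℓ ^ (A + 1)
        ≤ l / (ℓ ^ (2 * A + 2)) ^ (4 / 5 : ℝ) * (ℓ ^ (2 * A + 2)) ^ (4 / 5 : ℝ) := by gcongr
      _ = l := div_mul_cancel₀ _ (by positivity)
  have hlt : (n : ℝ) ^ (4 / 5 : ℝ) * ℓ ^ (A + 1) < l := by
    refine lt_of_le_of_ne hpow fun he => ?_
    have h3 : ℓ ^ (A + 1) ≤ (ℓ ^ (2 * A + 2)) ^ (4 / 5 : ℝ) := by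
      rw [← Real.rpow_natCast, ← Real.rpow_natCast, ← Real.rpow_mul (by linarith)]
      apply Real.rpow_le_rpow_of_exponent_le hℓ
      push_cast
      have : (0 : ℝ) ≤ A := by positivity
      linarith
    have h1 : (n : ℝ) ^ (4 / 5 : ℝ) < (l ^ (5 / 4 : ℝ) / ℓ ^ (2 * A + 2)) ^ (4 / 5 : ℝ) :=
      Real.rpow_lt_rpow hn0 hc (by norm_num)
    rw [Real.div_rpow (by positivity) (by positivity), ← Real.rpow_mul (by linarith)] at h1
    norm_num at h1
    rw [lt_div_iff₀ (by positivity)] at h1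
    have := mul_le_mul_of_nonneg_left h3 (Real.rpow_nonneg hn0 (4 / 5))
    norm_num at this he
    linarith
  have : l < l := by
    calc l ≤ A * (n : ℝ) ^ (4 / 5 : ℝ) * Real.logb 2 ((n : ℝ) + 1) ^ A := h
      _ ≤ A * (n : ℝ) ^ (4 / 5 : ℝ) * (2 * ℓ) ^ A := by gcongr
      _ = ((A : ℝ) * 2 ^ A) * ((n : ℝ) ^ (4 / 5 : ℝ) * ℓ ^ A) := by rw [mul_pow]; ring
      _ ≤ ℓ * ((n : ℝ) ^ (4 / 5 : ℝ) * ℓ ^ A) := by gcongr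
      _ = (n : ℝ) ^ (4 / 5 : ℝ) * ℓ ^ (A + 1) := by ring
      _ < l := hlt
  exact lt_irrefl _ this

/-- The lower bound for approximate representation, for large sizes. -/
lemma exists_hard_of_large {ε : ℝ} (hε : 0 < ε) (hε' : ε < 1 / 2) (A : ℕ) :
    ∃ c l₀ : ℝ, 0 < c ∧ 1 ≤ l₀ ∧ ∀ (n : ℕ) (l : ℝ), l₀ ≤ l →
      l ≤ A * (n : ℝ) ^ (4 / 5 : ℝ) * Real.logb 2 ((n : ℝ) + 1) ^ A →
      ∃ f : BoolFun n, Monotone f ∧ (dtSize f : ℝ) ≤ 2 ^ l ∧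
        (2 : ℝ) ^ (c * l) ≤ dtSize f ∧
        (2 : ℝ) ^ (c * (l ^ (5 / 4 : ℝ) / Real.logb 2 (2 + l) ^ (2 * A + 2))) ≤
          topDownDTSize f ε := by
  obtain ⟨C, η, hC, hη, H⟩ := exists_hard_function hε hε'
  have hlarge : ∀ᶠ l : ℝ in atTop, Real.logb 2 (2 + l) ^ (2 * A + 2) ≤ l ^ (1 / 4 : ℝ) ∧
      24 * (C * l ^ (3 / 4 : ℝ)) * (Real.logb 2 (C * l ^ (3 / 4 : ℝ)) + 1) ≤ l ∧
      1 ≤ C * l ^ (3 / 4 : ℝ) ∧ (A : ℝ) * 2 ^ A ≤ Real.logb 2 (2 + l) ∧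
      4 * (C + 1) ≤ l ∧ 16 ≤ l ∧ -Real.logb 2 η * 32 / η ≤ l := by
    have ht1 : Tendsto (fun l : ℝ => C * l ^ (3 / 4 : ℝ)) atTop atTop :=
      (tendsto_rpow_atTop (by norm_num)).const_mul_atTop hC
    have ht2 : Tendsto (fun l : ℝ => Real.logb 2 (2 + l)) atTop atTop :=
      (Real.tendsto_logb_atTop (by norm_num)).comp
        (tendsto_atTop_add_const_left _ _ tendsto_id)
    filter_upwards [eventually_logb_pow_le (2 * A + 2), eventually_mul_logb_le hC,
      ht1.eventually_ge_atTop 1, ht2.eventually_ge_atTop _, eventually_ge_atTop _,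
      eventually_ge_atTop _, eventually_ge_atTop _] with l h1 h2 h3 h4 h5 h6 h7
    exact ⟨h1, h2, h3, h4, h5, h6, h7⟩
  obtain ⟨l₁, hl₁⟩ := eventually_atTop.1 hlarge
  refine ⟨min (1 / 16) (η / 32), max l₁ 1, by positivity, le_max_right _ _, fun n l hl hn => ?_⟩
  obtain ⟨h1, h2, h3, h4, h5, h6, h7⟩ := hl₁ l ((le_max_left _ _).trans hl)
  have hl0 : 0 < l := by linarith
  have hnx := rpow_div_le_of_le_mul (by linarith) h4 hn
  have hℓ := one_le_logb_two_add hl0.le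
  set D := Real.logb 2 (2 + l) ^ (2 * A + 2) with hD
  have hD1 : 1 ≤ D := one_le_pow₀ hℓ
  set x := l ^ (5 / 4 : ℝ) / D with hx
  have hl54 : l ^ (5 / 4 : ℝ) = l ^ (1 / 4 : ℝ) * l := by
    conv_rhs => rw [← Real.rpow_one l, ← Real.rpow_mul hl0.le, ← Real.rpow_add hl0]
    norm_num
  have hxl : l ≤ x := by
    rw [hx, hl54, le_div_iff₀ (by linarith), mul_comm]
    gcongr
  have hxe : x = l ^ (1 / 4 : ℝ) / D * l := by rw [hx, hl54]; ring
  set y := l ^ (1 / 4 : ℝ) / D with hy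
  have hy1 : 1 ≤ y := by rw [hy, le_div_iff₀ (by linarith)]; linarith
  have hyl : y ≤ l ^ (1 / 4 : ℝ) := div_le_self (by positivity) hD1
  -- Tribes and a block each get a quarter of the exponent budget `l`. The width is the least with
  -- `2 ^ w ≥ C * l ^ (3/4)`, which dominates `C * N * √m`; the blocks contain between `x / 16` and
  -- `x / 4` variables in total.
  set N := ⌊y⌋₊ with hN
  set m := ⌊l / 4⌋₊ with hm
  set w := ⌈Real.logb 2 (C * l ^ (3 / 4 : ℝ))⌉₊ with hw
  have hN1 : 1 ≤ N := Nat.le_floor (by exact_mod_cast hy1)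
  have hNy : (N : ℝ) ≤ y := Nat.floor_le (by linarith)
  have hNy' : y / 2 ≤ N := by
    have := Nat.lt_floor_add_one y
    have : (1 : ℝ) ≤ N := by exact_mod_cast hN1
    linarith
  have hml : (m : ℝ) ≤ l / 4 := Nat.floor_le (by linarith)
  have hml' : l / 4 < m + 1 := Nat.lt_floor_add_one _
  have hlog0 : 0 ≤ Real.logb 2 (C * l ^ (3 / 4 : ℝ)) := Real.logb_nonneg (by norm_num) h3
  have hw1 : Real.logb 2 (C * l ^ (3 / 4 : ℝ)) ≤ w := Nat.le_ceil _
  have hw2 : (w : ℝ) < Real.logb 2 (C * l ^ (3 / 4 : ℝ)) + 1 := Nat.ceil_lt_add_one hlog0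
  have hpos : 0 < C * l ^ (3 / 4 : ℝ) := by positivity
  have hw3 : C * l ^ (3 / 4 : ℝ) ≤ 2 ^ w := by
    rw [← Real.rpow_natCast, ← Real.logb_le_iff_le_rpow (by norm_num) hpos]
    exact hw1
  have hw4 : (2 : ℝ) ^ w ≤ 2 * (C * l ^ (3 / 4 : ℝ)) := by
    rw [← Real.rpow_natCast, ← Real.le_logb_iff_rpow_le (by norm_num) (by positivity),
      Real.logb_mul (by norm_num) hpos.ne', Real.logb_self_eq_one (by norm_num)]
    linarith
  have hww : (3 * 2 ^ w * w : ℝ) ≤ l / 4 := by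
    calc (3 * 2 ^ w * w : ℝ) ≤ 3 * (2 * (C * l ^ (3 / 4 : ℝ))) *
          (Real.logb 2 (C * l ^ (3 / 4 : ℝ)) + 1) := by gcongr
      _ ≤ l / 4 := by linarith
  have hsm : √(m : ℝ) ≤ l ^ (1 / 2 : ℝ) := by
    rw [← Real.sqrt_eq_rpow]
    exact Real.sqrt_le_sqrt (by linarith)
  have hNm : (N : ℝ) * m ≤ x / 4 := by
    rw [hxe]
    calc (N : ℝ) * m ≤ y * (l / 4) := by gcongr
      _ = _ := by ring
  have hNm' : x / 16 ≤ (N : ℝ) * m := by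
    rw [hxe]
    have : l / 8 ≤ m := by linarith
    calc y * l / 16 = (y / 2) * (l / 8) := by ring
      _ ≤ _ := by gcongr
  obtain ⟨f, hf, hs1, hs2, hs3⟩ := H n N w m hN1 (by linarith) (by
      refine le_trans ?_ hw3
      gcongr
      calc (N : ℝ) * √m ≤ l ^ (1 / 4 : ℝ) * l ^ (1 / 2 : ℝ) := by
            gcongr
            exact hNy.trans hyl
        _ = l ^ (3 / 4 : ℝ) := by rw [← Real.rpow_add hl0]; norm_num) (by
      have : ((3 * 2 ^ w * w + N * m : ℕ) : ℝ) ≤ n := by push_cast; linarith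
      exact_mod_cast this)
  refine ⟨f, hf, ?_, ?_, ?_⟩
  · calc (dtSize f : ℝ) ≤ (2 : ℝ) ^ ((3 * 2 ^ w * w + m : ℕ) : ℝ) := by
          rw [Real.rpow_natCast]; exact_mod_cast hs1
      _ ≤ 2 ^ l := by
          apply Real.rpow_le_rpow_of_exponent_le (by norm_num)
          push_cast
          linarith
  · calc (2 : ℝ) ^ (min (1 / 16) (η / 32) * l) ≤ (2 : ℝ) ^ (((m / 2 : ℕ) : ℝ)) := by
          apply Real.rpow_le_rpow_of_exponent_le (by norm_num)
          have h8 : min (1 / 16) (η / 32) * l ≤ 1 / 16 * l := by gcongr; exact min_le_left _ _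
          have h9 : (m : ℝ) ≤ 2 * ((m / 2 : ℕ) : ℝ) + 1 := by
            exact_mod_cast (by omega : m ≤ 2 * (m / 2) + 1)
          linarith
      _ ≤ dtSize f := by rw [Real.rpow_natCast]; exact_mod_cast hs2
  · refine le_trans ?_ hs3
    -- The constant factor `η` is absorbed into the exponent by halving `η / 16`, as `l`, and hence
    -- `x`, is large.
    have he : η = (2 : ℝ) ^ Real.logb 2 η := (Real.rpow_logb (by norm_num) (by norm_num) hη).symm
    have h8 : -Real.logb 2 η * 32 ≤ η * x := by
      rw [div_le_iff₀ hη] at h7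
      calc _ ≤ l * η := h7
        _ ≤ x * η := by gcongr
        _ = η * x := mul_comm _ _
    have h9 : η * (x / 16) ≤ η * (N * m) := by gcongr
    calc (2 : ℝ) ^ (min (1 / 16) (η / 32) * x) ≤ 2 ^ (Real.logb 2 η + η * (N * m)) := by
          apply Real.rpow_le_rpow_of_exponent_le (by norm_num)
          have : min (1 / 16) (η / 32) * x ≤ η / 32 * x := by
            gcongr
            exact min_le_right _ _
          linarith
      _ = η * 2 ^ (η * (N * m)) := by rw [Real.rpow_add (by norm_num), ← he]

/-! ### Small sizes -/

lemma one_le_dtSize {n : ℕ} (f : BoolFun n) : 1 ≤ dtSize f := by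
  obtain ⟨T, -, hT⟩ := exists_tree f
  exact hT ▸ one_le_size T

lemma one_le_topDownDTSize {n : ℕ} (hn : 1 ≤ n) (f : BoolFun n) {ε : ℝ} (hε : 0 ≤ ε) :
    (1 : ℝ) ≤ topDownDTSize f ε :=
  le_topDownDTSize hn hε fun T _ _ => by exact_mod_cast one_le_size T

lemma exists_monotone_dtSize_one (n : ℕ) : ∃ f : BoolFun n, Monotone f ∧ dtSize f ≤ 1 :=
  ⟨fun _ => true, monotone_const,
    (dtSize_le (T := .leaf true) (by ext z; simp [QueryTree.eval])).trans (by simp [QueryTree.size])⟩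

lemma exists_monotone_dtSize_two {n : ℕ} (hn : 1 ≤ n) {ε : ℝ} (hε : 0 ≤ ε) (hε' : ε < 1 / 2) :
    ∃ f : BoolFun n, Monotone f ∧ dtSize f = 2 ∧ (2 : ℝ) ≤ topDownDTSize f ε := by
  let i : Fin n := ⟨0, hn⟩
  let f : BoolFun n := fun z => z i
  have hinf : 0 < influence f i := by
    rw [influence_pos_iff]
    exact ⟨fun _ => false, by simp [f, flipAt]⟩
  have hmean : mean (fun z => sgn (f z)) = 0 := by
    rw [mean_split _ i]
    simp [f, sgn, mean_const]
  refine ⟨f, fun x z h => h i, le_antisymm ?_ ?_, ?_⟩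
  · refine (dtSize_le (T := .node i (.leaf false) (.leaf true)) ?_).trans le_rfl
    ext z
    simp [QueryTree.eval, f]
  · have := card_lt_dtSize (f := f) (s := {i}) (by simpa using hinf)
    rwa [card_singleton] at this
  · refine le_topDownDTSize hn hε fun T _ he => ?_
    cases T with
    | leaf a =>
      have := bareError_leaf_ge f
      rw [hmean, abs_zero] at this
      cases a
      linarith
    | node j t₀ t₁ =>
      have h0 := one_le_size t₀
      have h1 := one_le_size t₁
      simp only [QueryTree.size]
      exact_mod_cast (by omega : 2 ≤ t₀.size + t₁.size)

/-- The lower bound for approximate representation. -/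
theorem approximate_lower_bound {ε : ℝ} (hε : 0 < ε) (hε' : ε < 1 / 2) (A : ℕ) :
    ∃ c : ℝ, 0 < c ∧ ∃ K : ℕ, ∀ n s : ℕ, 1 ≤ n → 1 ≤ s →
      (s : ℝ) ≤ (2 : ℝ) ^ ((A : ℝ) * (n : ℝ) ^ (4 / 5 : ℝ) * Real.logb 2 ((n : ℝ) + 1) ^ A) →
      ∃ f : BoolFun n, Monotone f ∧ dtSize f ≤ s ∧
        (s : ℝ) ^ (c / Real.logb 2 (2 + Real.logb 2 s) ^ K) ≤ dtSize f ∧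
        (s : ℝ) ^ (c * Real.logb 2 s ^ (1 / 4 : ℝ) / Real.logb 2 (2 + Real.logb 2 s) ^ K) ≤
          topDownDTSize f ε := by
  obtain ⟨c₁, l₀, hc₁, hl₀, H⟩ := exists_hard_of_large hε hε' A
  have hc0 : 0 < min c₁ (1 / l₀ ^ 2) := lt_min hc₁ (by positivity)
  refine ⟨min c₁ (1 / l₀ ^ 2), hc0, 2 * A + 2, fun n s hn hs hsn => ?_⟩
  set c := min c₁ (1 / l₀ ^ 2) with hc
  have hs0 : (0 : ℝ) < s := by exact_mod_cast hs
  have hs1 : (1 : ℝ) ≤ s := by exact_mod_cast hs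
  obtain ⟨l, hl⟩ : ∃ l, l = Real.logb 2 s := ⟨_, rfl⟩
  have hsl : (s : ℝ) = 2 ^ l := by rw [hl, Real.rpow_logb (by norm_num) (by norm_num) hs0]
  rw [← hl]
  have hl1 : 0 ≤ l := hl ▸ Real.logb_nonneg (by norm_num) hs1
  have hℓ := one_le_logb_two_add hl1
  set D := Real.logb 2 (2 + l) ^ (2 * A + 2)
  have hD1 : 1 ≤ D := one_le_pow₀ hℓ
  rw [hsl, Real.rpow_le_rpow_left_iff (by norm_num)] at hsn
  rcases le_or_gt l₀ l with hll | hll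
  · obtain ⟨f, hf, h1, h2, h3⟩ := H n l hll hsn
    have hl0 : 0 < l := by linarith
    refine ⟨f, hf, by rw [← hsl] at h1; exact_mod_cast h1, ?_, ?_⟩
    · refine le_trans ?_ h2
      rw [hsl, ← Real.rpow_mul (by norm_num)]
      apply Real.rpow_le_rpow_of_exponent_le (by norm_num)
      rw [mul_comm]
      gcongr
      exact (div_le_self hc0.le hD1).trans (min_le_left _ _)
    · refine le_trans ?_ h3
      rw [hsl, ← Real.rpow_mul (by norm_num)]
      apply Real.rpow_le_rpow_of_exponent_le (by norm_num)
      have e : l * (c * l ^ (1 / 4 : ℝ) / D) = c * (l ^ (5 / 4 : ℝ) / D) := by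
        have : l ^ (5 / 4 : ℝ) = l ^ (1 / 4 : ℝ) * l := by
          conv_rhs => rw [← Real.rpow_one l, ← Real.rpow_mul hl0.le, ← Real.rpow_add hl0]
          norm_num
        rw [this]
        ring
      rw [e]
      gcongr
      exact min_le_left _ _
  -- For bounded `l` a constant function (`s = 1`) or a single variable suffices: `c ≤ 1 / l₀ ^ 2`
  -- makes both claimed lower bounds at most 2.
  · rcases hs.eq_or_lt with h1 | h2
    · obtain ⟨f, hf, hle⟩ := exists_monotone_dtSize_one n
      subst h1
      refine ⟨f, hf, hle, ?_, ?_⟩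
      · rw [Nat.cast_one, Real.one_rpow]
        exact_mod_cast one_le_dtSize f
      · rw [Nat.cast_one, Real.one_rpow]
        exact one_le_topDownDTSize hn f hε.le
    · obtain ⟨f, hf, heq, htd⟩ := exists_monotone_dtSize_two hn hε.le hε'
      have hcl : c * l₀ ^ 2 ≤ 1 := by
        calc c * l₀ ^ 2 ≤ 1 / l₀ ^ 2 * l₀ ^ 2 := by gcongr; exact min_le_right _ _
          _ = 1 := by field_simp
      have hl14 : l ^ (1 / 4 : ℝ) ≤ l₀ := by
        calc l ^ (1 / 4 : ℝ) ≤ l₀ ^ (1 / 4 : ℝ) := by gcongr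
          _ ≤ l₀ ^ (1 : ℝ) := Real.rpow_le_rpow_of_exponent_le hl₀ (by norm_num)
          _ = l₀ := Real.rpow_one _
      have hl140 : 0 ≤ l ^ (1 / 4 : ℝ) := by positivity
      refine ⟨f, hf, by omega, ?_, ?_⟩
      · rw [heq, hsl, ← Real.rpow_mul (by norm_num)]
        calc (2 : ℝ) ^ (l * (c / D)) ≤ (2 : ℝ) ^ (1 : ℝ) := by
              apply Real.rpow_le_rpow_of_exponent_le (by norm_num)
              calc l * (c / D) ≤ l₀ ^ 2 * c := by
                    have : c / D ≤ c := div_le_self hc0.le hD1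
                    have : l ≤ l₀ ^ 2 := by nlinarith
                    gcongr
                _ ≤ 1 := by linarith
          _ = ((2 : ℕ) : ℝ) := by norm_num
      · refine le_trans ?_ htd
        rw [hsl, ← Real.rpow_mul (by norm_num)]
        calc (2 : ℝ) ^ (l * (c * l ^ (1 / 4 : ℝ) / D)) ≤ (2 : ℝ) ^ (1 : ℝ) := by
              apply Real.rpow_le_rpow_of_exponent_le (by norm_num)
              calc l * (c * l ^ (1 / 4 : ℝ) / D) ≤ l * (c * l ^ (1 / 4 : ℝ)) := by
                    gcongr
                    exact div_le_self (by positivity) hD1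
                _ ≤ l₀ * (c * l₀) := by gcongr
                _ ≤ 1 := by linarith
          _ = 2 := by norm_num

end TopDownDT

theorem theorem4 :
    -- (a) exact representation
    (∃ c₁ c₂ c₃ : ℝ, 0 < c₁ ∧ 0 < c₂ ∧ 0 < c₃ ∧
      ∀ n : ℕ, 1 ≤ n →
        ∃ f : TopDownDT.BoolFun n, Monotone f ∧
          c₁ * n ≤ (TopDownDT.dtSize f : ℝ) ∧ (TopDownDT.dtSize f : ℝ) ≤ c₂ * n ∧
          (2 : ℝ) ^ (c₃ * (TopDownDT.dtSize f : ℝ)) ≤ (TopDownDT.topDownDTSize f 0 : ℝ)) ∧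
    -- (b) approximate representation
    (∀ ε : ℝ, 0 < ε → ε < 1 / 2 → ∀ A : ℕ,
      ∃ c : ℝ, 0 < c ∧ ∃ K : ℕ,
        ∀ s : ℕ → ℕ,
          (∀ n : ℕ, 1 ≤ n → 1 ≤ s n ∧
            (s n : ℝ) ≤ (2 : ℝ) ^ ((A : ℝ) * (n : ℝ) ^ (4 / 5 : ℝ) *
              (Real.logb 2 ((n : ℝ) + 1)) ^ A)) →
          ∀ n : ℕ, 1 ≤ n →
            ∃ f : TopDownDT.BoolFun n, Monotone f ∧
              TopDownDT.dtSize f ≤ s n ∧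
              (s n : ℝ) ^ (c / (Real.logb 2 (2 + Real.logb 2 (s n))) ^ K) ≤
                (TopDownDT.dtSize f : ℝ) ∧
              (s n : ℝ) ^ (c * (Real.logb 2 (s n)) ^ (1 / 4 : ℝ) /
                  (Real.logb 2 (2 + Real.logb 2 (s n))) ^ K) ≤
                (TopDownDT.topDownDTSize f ε : ℝ)) := by
  refine ⟨⟨1 / 5, 12, 1 / 26, by norm_num, by norm_num, by norm_num,
    TopDownDT.exact_lower_bound⟩, fun ε hε hε' A => ?_⟩
  obtain ⟨c, hc, K, H⟩ := TopDownDT.approximate_lower_bound hε hε' A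
  exact ⟨c, hc, K, fun s hs n hn => H n (s n) hn (hs n hn).1 (hs n hn).2⟩
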